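/- Let $\mathrm{Nil}_3$ be the Heisenberg group, i.e. $\mathbb{R}^3$ with the left-invariant metric $dx^2+dy^2+\big(dz+\tfrac12(y\,dx-x\,dy)\big)^2$. For $a>0$ let $f=f(a,\cdot):\mathbb{R}\to(0,\infty)$ be the global solution of the Cauchy problem $f(f^2+4)f''=4(1+f'^2)$, $f(0)=a$, $f'(0)=0$, and let the catenoid $\mathcal{C}_a\subset\mathrm{Nil}_3$ be the surface of revolution $(t,\theta)\mapsto(f(t)\cos\theta,f(t)\sin\theta,t)$, which is a complete minimal surface. Let $J=-\Delta-(|A|^2+\mathrm{Ric}(N,N))$ be its Jacobi operator, where $\Delta$ is the (non-positive) Laplacian of the induced metric, $N$ a unit normal, $A$ the second fundamental form and $\mathrm{Ric}$ the Ricci curvature of $\mathrm{Nil}_3$. The Morse index $\mathrm{Ind}(\mathcal{C}_a)\in\mathbb{N}\cup\{\infty\}$ is the supremum, over all relatively compact regular domains $\Omega$ of $\mathcal{C}_a$, of the number of negative eigenvalues, counted with multiplicity, of $J$ in $\Omega$ with Dirichlet boundary conditions. (i) For every $a>0$ the Morse index of $\mathcal{C}_a$ is finite, and $$3\le \mathrm{Ind}(\mathcal{C}_a)\le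 1+2\big[\sqrt{a^2+2}\,\big],$$ where $[x]$ denotes the integer part of $x$. In particular, $\mathrm{Ind}(\mathcal{C}_a)=3$ for all $a>0$ close enough to $0$. (ii) As $a\to\infty$ the index grows at least like $\sqrt3\,a$: for every $c<\sqrt3$ one has $\mathrm{Ind}(\mathcal{C}_a)\ge c\,a$ for all sufficiently large $a$, i.e. $\liminf_{a\to\infty}\mathrm{Ind}(\mathcal{C}_a)/a\ge\sqrt3$. In particular, $\mathrm{Ind}(\mathcal{C}_a)\to\infty$ as $a\to\infty$. -/

import Mathlib

open Set Filter Topology MeasureTheory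
open scoped ContDiff Matrix ENNReal

noncomputable section

/-! ### Partial derivatives and Riemannian geometry in coordinates -/

/-- The partial derivative of `u` in the `i`-th coordinate direction. -/
def partialD {n : ℕ} (i : Fin n) (u : (Fin n → ℝ) → ℝ) (p : Fin n → ℝ) : ℝ :=
  fderiv ℝ u p (Pi.single i 1)

/-- Christoffel symbols `Γᵏᵢⱼ` of the Levi-Civita connection of the metric `g` on `ℝ³`. -/
def christoffel (g : (Fin 3 → ℝ) → Matrix (Fin 3) (Fin 3) ℝ) (k i j : Fin 3)
    (p : Fin 3 → ℝ) : ℝ :=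
  (1 / 2) * ∑ l, (g p)⁻¹ k l *
    (partialD i (fun q => g q j l) p + partialD j (fun q => g q i l) p
      - partialD l (fun q => g q i j) p)

/-- The Ricci tensor `Ricᵢⱼ` of the metric `g` on `ℝ³`. -/
def ricci (g : (Fin 3 → ℝ) → Matrix (Fin 3) (Fin 3) ℝ) (p : Fin 3 → ℝ) :
    Matrix (Fin 3) (Fin 3) ℝ :=
  Matrix.of fun i j => ∑ k,
    (partialD k (christoffel g k i j) p - partialD j (christoffel g k i k) p
      + ∑ l, (christoffel g k k l p * christoffel g l i j p
          - christoffel g k j l p * christoffel g l i k p))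

/-- The left-invariant metric `dx² + dy² + (dz + (y dx - x dy)/2)²` of the Heisenberg group
`Nil₃`, in exponential coordinates `(x, y, z) = (p 0, p 1, p 2)`. -/
def nilMetric (p : Fin 3 → ℝ) : Matrix (Fin 3) (Fin 3) ℝ :=
  Matrix.diagonal ![1, 1, 0] +
    Matrix.vecMulVec ![p 1 / 2, -(p 0) / 2, 1] ![p 1 / 2, -(p 0) / 2, 1]

/-! ### Geometry of a parametrized surface `F : ℝ² → Nil₃` -/

/-- The coordinate tangent vector `∂ₐF`. -/
def tangentVec (F : (Fin 2 → ℝ) → (Fin 3 → ℝ)) (a : Fin 2) (p : Fin 2 → ℝ) : Fin 3 → ℝ :=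
  fun i => partialD a (fun q => F q i) p

/-- The first fundamental form (the induced metric). -/
def firstForm (F : (Fin 2 → ℝ) → (Fin 3 → ℝ)) (p : Fin 2 → ℝ) : Matrix (Fin 2) (Fin 2) ℝ :=
  Matrix.of fun a b => tangentVec F a p ⬝ᵥ (nilMetric (F p) *ᵥ tangentVec F b p)

/-- The unit normal: the metric dual of the conormal `∂₀F × ∂₁F`, normalized. -/
def unitNormal (F : (Fin 2 → ℝ) → (Fin 3 → ℝ)) (p : Fin 2 → ℝ) : Fin 3 → ℝ :=
  let ν := crossProduct (tangentVec F 0 p) (tangentVec F 1 p)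
  (1 / √(ν ⬝ᵥ ((nilMetric (F p))⁻¹ *ᵥ ν))) • ((nilMetric (F p))⁻¹ *ᵥ ν)

/-- The covariant derivative `∇_{∂ₐF} ∂_bF` in `Nil₃`. -/
def covDeriv (F : (Fin 2 → ℝ) → (Fin 3 → ℝ)) (a b : Fin 2) (p : Fin 2 → ℝ) : Fin 3 → ℝ :=
  fun k => partialD a (fun q => tangentVec F b q k) p
    + ∑ i, ∑ j, christoffel nilMetric k i j (F p) * tangentVec F a p i * tangentVec F b p j

/-- The second fundamental form with respect to `unitNormal F`. -/
def secondForm (F : (Fin 2 → ℝ) → (Fin 3 → ℝ)) (p : Fin 2 → ℝ) : Matrix (Fin 2) (Fin 2) ℝ :=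
  Matrix.of fun a b => covDeriv F a b p ⬝ᵥ (nilMetric (F p) *ᵥ unitNormal F p)

/-- The squared norm `|A|²` of the second fundamental form. -/
def secondFormNormSq (F : (Fin 2 → ℝ) → (Fin 3 → ℝ)) (p : Fin 2 → ℝ) : ℝ :=
  ((firstForm F p)⁻¹ * secondForm F p * (firstForm F p)⁻¹ * secondForm F p).trace

/-- The Ricci curvature `Ric(N, N)` of `Nil₃` in the direction of the unit normal. -/
def ricciNormal (F : (Fin 2 → ℝ) → (Fin 3 → ℝ)) (p : Fin 2 → ℝ) : ℝ :=
  unitNormal F p ⬝ᵥ (ricci nilMetric (F p) *ᵥ unitNormal F p)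

/-- The density `√(det g)` of the area measure in the parameters. -/
def areaDensity (F : (Fin 2 → ℝ) → (Fin 3 → ℝ)) (p : Fin 2 → ℝ) : ℝ := √(firstForm F p).det

/-- The (non-positive) Laplacian of the induced metric. -/
def surfaceLaplacian (F : (Fin 2 → ℝ) → (Fin 3 → ℝ)) (u : (Fin 2 → ℝ) → ℝ)
    (p : Fin 2 → ℝ) : ℝ :=
  (1 / areaDensity F p) * ∑ a, partialD a
    (fun q => areaDensity F q * ∑ b, (firstForm F q)⁻¹ a b * partialD b u q) p

/-- The Jacobi operator `J u = -Δ u - (|A|² + Ric(N, N)) u`. -/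
def jacobiOp (F : (Fin 2 → ℝ) → (Fin 3 → ℝ)) (u : (Fin 2 → ℝ) → ℝ) (p : Fin 2 → ℝ) : ℝ :=
  -surfaceLaplacian F u p - (secondFormNormSq F p + ricciNormal F p) * u p

/-! ### The Dirichlet problem and the Morse index

The surface is the image of `F`, where `F` is `2π`-periodic in its second parameter `p 1` and
injective on the cell `0 < p 1 ≤ 2π`. Functions on the surface are represented by their lifts to
the parameter plane, subsets of the surface by subsets of `Nil₃`. -/

/-- A relatively compact regular domain of the surface `F`: connected, open in the surface, with
compact closure, and with smooth boundary, lying locally on one side of it. -/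
structure IsRegularDomain (F : (Fin 2 → ℝ) → (Fin 3 → ℝ)) (Ω : Set (Fin 3 → ℝ)) : Prop where
  connected : IsConnected Ω
  isOpen : IsOpen (F ⁻¹' Ω)
  compact : IsCompact (closure Ω)
  closure_subset : closure Ω ⊆ range F
  boundary : ∀ p ∈ frontier (F ⁻¹' Ω), ∃ U ∈ 𝓝 p, ∃ ρ : (Fin 2 → ℝ) → ℝ,
    ContDiff ℝ ∞ ρ ∧ fderiv ℝ ρ p ≠ 0 ∧ ∀ q ∈ U, q ∈ F ⁻¹' Ω ↔ ρ q < 0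

/-- The area measure of `Ω` (on one period of the parameter plane). -/
def domainMeasure (F : (Fin 2 → ℝ) → (Fin 3 → ℝ)) (Ω : Set (Fin 3 → ℝ)) :
    Measure (Fin 2 → ℝ) :=
  (volume.restrict ({p | p 1 ∈ Ioc 0 (2 * Real.pi)} ∩ F ⁻¹' Ω)).withDensity
    fun p => ENNReal.ofReal (areaDensity F p)

/-- Lifts of the smooth functions on the surface with support in `Ω` (the support is compact,
as it is closed in the surface and `Ω` is relatively compact). -/
structure IsTestFunction (F : (Fin 2 → ℝ) → (Fin 3 → ℝ)) (Ω : Set (Fin 3 → ℝ))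
    (φ : (Fin 2 → ℝ) → ℝ) : Prop where
  smooth : ContDiff ℝ ∞ φ
  descends : Function.FactorsThrough φ F
  support : tsupport φ ⊆ F ⁻¹' Ω

/-- `u ∈ H¹₀(Ω)`: `u` is the `L²(Ω)`-limit of test functions whose first partial derivatives
converge in `L²(Ω)`. On a relatively compact domain the norm of the coordinate partial derivatives
is equivalent to that of the Riemannian gradient. -/
def IsH10 (F : (Fin 2 → ℝ) → (Fin 3 → ℝ)) (Ω : Set (Fin 3 → ℝ))
    (u : Lp ℝ 2 (domainMeasure F Ω)) : Prop :=
  ∃ (φ : ℕ → (Fin 2 → ℝ) → ℝ) (w : Fin 2 → Lp ℝ 2 (domainMeasure F Ω)),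
    (∀ n, IsTestFunction F Ω (φ n)) ∧
    Tendsto (fun n => eLpNorm (fun p => φ n p - u p) 2 (domainMeasure F Ω)) atTop (𝓝 0) ∧
    ∀ i, Tendsto (fun n => eLpNorm (fun p => partialD i (φ n) p - w i p) 2 (domainMeasure F Ω))
      atTop (𝓝 0)

/-- `u` lies in the eigenspace of the Jacobi operator with Dirichlet boundary conditions in `Ω`
for `lam`: `u ∈ H¹₀(Ω)` and `J u = lam u` in the sense of distributions on `Ω`. -/
def IsDirichletEigen (F : (Fin 2 → ℝ) → (Fin 3 → ℝ)) (Ω : Set (Fin 3 → ℝ)) (lam : ℝ)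
    (u : Lp ℝ 2 (domainMeasure F Ω)) : Prop :=
  IsH10 F Ω u ∧ ∀ φ, IsTestFunction F Ω φ →
    ∫ p, u p * jacobiOp F φ p ∂(domainMeasure F Ω) = lam * ∫ p, u p * φ p ∂(domainMeasure F Ω)

/-- The number of negative eigenvalues of the Jacobi operator for the Dirichlet problem in `Ω`,
counted with multiplicity: the total dimension of the eigenspaces (which are linearly independent
for distinct eigenvalues) of the negative eigenvalues. -/
def dirichletIndex (F : (Fin 2 → ℝ) → (Fin 3 → ℝ)) (Ω : Set (Fin 3 → ℝ)) : ℕ∞ :=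
  Cardinal.toENat (Module.rank ℝ
    (Submodule.span ℝ {u : Lp ℝ 2 (domainMeasure F Ω) | ∃ lam < 0, IsDirichletEigen F Ω lam u}))

/-- The Morse index: the supremum of the indices of the relatively compact regular domains. -/
def morseIndex (F : (Fin 2 → ℝ) → (Fin 3 → ℝ)) : ℕ∞ :=
  ⨆ (Ω : Set (Fin 3 → ℝ)) (_ : IsRegularDomain F Ω), dirichletIndex F Ω

/-! ### The catenoids -/

/-- The surface of revolution about the `z`-axis, with parameters `(t, θ) = (p 0, p 1)`,
generated by the curve `t ↦ (f t, t)`. -/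
def revolutionSurface (f : ℝ → ℝ) (p : Fin 2 → ℝ) : Fin 3 → ℝ :=
  ![f (p 0) * Real.cos (p 1), f (p 0) * Real.sin (p 1), p 0]

/-- `f` is the global positive solution of the Cauchy problem
`f (f² + 4) f'' = 4 (1 + f'²)`, `f 0 = a`, `f' 0 = 0`. -/
structure IsCatenoidProfile (a : ℝ) (f : ℝ → ℝ) : Prop where
  smooth : ContDiff ℝ 2 f
  pos : ∀ t, 0 < f t
  ode : ∀ t, f t * (f t ^ 2 + 4) * deriv (deriv f) t = 4 * (1 + deriv f t ^ 2)
  init : f 0 = a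
  init' : deriv f 0 = 0

/-- The Cauchy problem has a global solution. -/
theorem exists_catenoidProfile (a : ℝ) (ha : 0 < a) : ∃ f, IsCatenoidProfile a f := by
  set e : ℝ → ℝ := fun s => √(a ^ 2 * Real.cosh s ^ 2 + 4) with he
  have hepos : ∀ s, 0 < a ^ 2 * Real.cosh s ^ 2 + 4 := fun s => by positivity
  have he1 : ∀ s, 0 < e s := fun s => Real.sqrt_pos.2 (hepos s)
  have hesq : ∀ s, e s ^ 2 = a ^ 2 * Real.cosh s ^ 2 + 4 := fun s => Real.sq_sqrt (hepos s).le
  have he2 : ∀ s, 2 ≤ e s := fun s => by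
    rw [he]; exact Real.le_sqrt_of_sq_le (by nlinarith [sq_nonneg (a * Real.cosh s)])
  have hecont : Continuous e := by
    have := Real.continuous_cosh
    exact Continuous.sqrt (by fun_prop)
  set T : ℝ → ℝ := fun s => ∫ x in (0 : ℝ)..s, a / 2 * e x with hT
  have hTd : ∀ s, HasDerivAt T (a / 2 * e s) s := fun s =>
    intervalIntegral.integral_hasDerivAt_right
      ((continuous_const.mul hecont).intervalIntegrable _ _)
      ((continuous_const.mul hecont).stronglyMeasurableAtFilter _ _)
      (continuous_const.mul hecont).continuousAt
  have hTpos : ∀ s, 0 < a / 2 * e s := fun s => mul_pos (by positivity) (he1 s)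
  have hTmono : StrictMono T := strictMono_of_deriv_pos fun s => by
    rw [(hTd s).deriv]; exact hTpos s
  have hTdiff : Differentiable ℝ T := fun s => (hTd s).differentiableAt
  have hTcont : Continuous T := hTdiff.continuous
  have hT0 : T 0 = 0 := by simp [hT]
  have hmono2 : Monotone fun s => T s - a * s := by
    apply monotone_of_deriv_nonneg
    · fun_prop
    · intro s
      have : HasDerivAt (fun s => T s - a * s) (a / 2 * e s - a * 1) s :=
        (hTd s).sub ((hasDerivAt_id s).const_mul a)
      rw [this.deriv]
      nlinarith [he2 s]
  have htop : Tendsto T atTop atTop := by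
    refine tendsto_atTop_mono' atTop ?_ (tendsto_id.const_mul_atTop ha)
    filter_upwards [eventually_ge_atTop 0] with s hs
    have := hmono2 hs
    simp only [hT0, mul_zero, sub_zero, id] at this ⊢
    linarith
  have hbot : Tendsto T atBot atBot := by
    refine tendsto_atBot_mono' atBot ?_ (tendsto_id.const_mul_atBot ha)
    filter_upwards [eventually_le_atBot 0] with s hs
    have := hmono2 hs
    simp only [hT0, mul_zero, sub_zero, id] at this ⊢
    linarith
  have hsurj : Function.Surjective T := hTcont.surjective htop hbot
  set E : ℝ ≃o ℝ := hTmono.orderIsoOfSurjective T hsurj with hE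
  set S : ℝ → ℝ := fun t => E.symm t with hS
  have hTS : ∀ t, T (S t) = t := fun t => E.apply_symm_apply t
  have hScont : Continuous S := E.symm.continuous
  have hSd : ∀ t, HasDerivAt S (a / 2 * e (S t))⁻¹ t := fun t =>
    (hTd (S t)).of_local_left_inverse hScont.continuousAt (hTpos _).ne'
      (Eventually.of_forall hTS)
  have hS0 : S 0 = 0 := hTmono.injective (by rw [hTS, hT0])
  have hed : ∀ s, HasDerivAt e (a ^ 2 * Real.cosh s * Real.sinh s / e s) s := fun s => by
    have h1 : HasDerivAt (fun s => a ^ 2 * Real.cosh s ^ 2 + 4)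
        (a ^ 2 * (2 * Real.cosh s * Real.sinh s)) s := by
      have := (((Real.hasDerivAt_cosh s).pow 2).const_mul (a ^ 2)).add_const 4
      simpa using this
    have := h1.sqrt (hepos s).ne'
    refine this.congr_deriv ?_
    change a ^ 2 * (2 * Real.cosh s * Real.sinh s) / (2 * e s) = _
    have := (he1 s).ne'
    field_simp
  have hf1 : ∀ t, HasDerivAt (fun t => a * Real.cosh (S t)) (2 * Real.sinh (S t) / e (S t)) t :=
    fun t => by
      have := ((Real.hasDerivAt_cosh (S t)).comp t (hSd t)).const_mul a
      refine this.congr_deriv ?_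
      have := (he1 (S t)).ne'
      field_simp
  have hd1 : deriv (fun t => a * Real.cosh (S t)) = fun t => 2 * Real.sinh (S t) / e (S t) :=
    funext fun t => (hf1 t).deriv
  have hf2 : ∀ t, HasDerivAt (fun t => 2 * Real.sinh (S t) / e (S t))
      ((2 * (Real.cosh (S t) * (a / 2 * e (S t))⁻¹) * e (S t) - 2 * Real.sinh (S t) *
        (a ^ 2 * Real.cosh (S t) * Real.sinh (S t) / e (S t) * (a / 2 * e (S t))⁻¹))
          / e (S t) ^ 2) t := fun t =>
    (((Real.hasDerivAt_sinh (S t)).comp t (hSd t)).const_mul 2).div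
      ((hed (S t)).comp t (hSd t)) (he1 _).ne'
  refine ⟨fun t => a * Real.cosh (S t), ⟨?_, fun t => by positivity, fun t => ?_, ?_, ?_⟩⟩
  · have h2 : (2 : WithTop ℕ∞) = 1 + 1 := by norm_num
    rw [h2, contDiff_succ_iff_deriv]
    refine ⟨fun t => (hf1 t).differentiableAt, by simp, ?_⟩
    rw [hd1, contDiff_one_iff_deriv]
    refine ⟨fun t => (hf2 t).differentiableAt, ?_⟩
    rw [funext fun t => (hf2 t).deriv]
    have h1 : ∀ t, e (S t) ≠ 0 := fun t => (he1 _).ne'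
    have h3 : ∀ t, a / 2 * e (S t) ≠ 0 := fun t => (hTpos _).ne'
    have h4 : ∀ t, e (S t) ^ 2 ≠ 0 := fun t => pow_ne_zero _ (h1 t)
    have c1 : Continuous fun t => e (S t) := hecont.comp hScont
    have c2 : Continuous fun t => Real.cosh (S t) := Real.continuous_cosh.comp hScont
    have c3 : Continuous fun t => Real.sinh (S t) := Real.continuous_sinh.comp hScont
    have c4 : Continuous fun t => (a / 2 * e (S t))⁻¹ := (continuous_const.mul c1).inv₀ h3
    exact ((((continuous_const.mul (c2.mul c4)).mul c1).sub ((continuous_const.mul c3).mul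
      ((((continuous_const.mul c2).mul c3).div c1 h1).mul c4))).div (c1.pow 2) h4)
  · rw [hd1, (hf2 t).deriv]
    have h1 := (he1 (S t)).ne'
    have h2 := hesq (S t)
    have h3 := Real.cosh_sq (S t)
    have h4 : e (S t) ^ 2 = a ^ 2 * (Real.sinh (S t) ^ 2 + 1) + 4 := by rw [h2, h3]
    field_simp
    simp only [h4, h3]
    ring
  · simp [hS0]
  · rw [hd1]; simp [hS0]

/-- The generating function of the catenoid `C_a`, for `a > 0`. -/
def catenoidProfile (a : ℝ) : ℝ → ℝ :=
  if h : 0 < a then Classical.choose (exists_catenoidProfile a h) else 0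

/-- The catenoid `C_a` in `Nil₃`, for `a > 0`. -/
def catenoid (a : ℝ) : (Fin 2 → ℝ) → (Fin 3 → ℝ) := revolutionSurface (catenoidProfile a)

end

/-!
Write `f` for the generating curve, `χ' = 2 / (f² + 4)` and `σ' = weight = 4 / (a (f² + 4))`. In the
coordinates `σ` and `ϑ = θ - χ` the metric of the catenoid is conformal to `dσ² + dϑ²`, and the index
form becomes `∫∫ u_σ² + u_ϑ² - P u²` with a potential `P` depending on `t` only and satisfying
`a² ≤ P ≤ a² + 2` (`IsCatenoidProfile.jacobiOp_eq`, `bilin_self`, `potential_le`, `le_potential`). So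
the Fourier modes `v(t) cos k(θ - χ(t))`, `v(t) sin k(θ - χ(t))` decouple, with one-dimensional forms
`∫ v_σ² + (k² - P) v²`.

*Upper bound.* The vertical translations of `Nil₃` are isometries and give the Jacobi function
`f' / f`, which vanishes only at the neck `t = 0`. Its Riccati equation shows that the form of every
mode is nonnegative on the functions vanishing at the neck (`mode_nonneg`). The modes with
`k² ≥ a² + 2 ≥ P` are nonnegative without any condition. Hence the index form is nonnegative under
`1 + 2m` linear conditions if `(m + 1)² ≥ a² + 2` (`integral_bilin_self_nonneg`). On the span of the
eigenfunctions of negative eigenvalues it is negative definite; as these functions are known only as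
`H¹₀` limits of test functions, the comparison is made for the approximations, and a compactness
argument on the unit sphere of the coefficients excludes more than `1 + 2m` independent
eigenfunctions (`dirichletIndex_le`).

*Lower bound.* For `k ≤ K` a negative Dirichlet eigenvalue of the `k`-th mode on a large band
`|t| < T` is found by shooting with the Prüfer angle (`exists_neg_eigenvalue`), once the solution of
the equation with eigenvalue `0` has a zero in `(0, T)`. By Sturm's theorem it is enough to exhibit an
even function with a zero solving an equation of smaller potential (`exists_comparison`). For `K = 1`
a horizontal translation of `Nil₃` provides it. For larger `K` the constant potential `a²` is used: its
solution `cos (√(a² - K²) σ)` has a zero as soon as the conformal half-length, which is at least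
`π / √(a² + 4)` (`arctan_le_conformal`), exceeds `π / (2 √(a² - K²))`, that is, if
`K² < 3a²/4 - 1`. The `2K + 1` modes obtained are orthogonal eigenfunctions (`le_morseIndex`), which
yields `3 ≤ Ind` and the linear growth with slope `√3`.
-/

open Set Filter Topology MeasureTheory
open scoped ContDiff Matrix ENNReal

noncomputable section

/-! ### The generating curve -/

namespace IsCatenoidProfile

variable {a : ℝ} {f : ℝ → ℝ}

theorem hasDerivAt (h : IsCatenoidProfile a f) (t : ℝ) : HasDerivAt f (deriv f t) t :=
  ((h.smooth.differentiable (by norm_num)) t).hasDerivAt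

theorem contDiff_deriv (h : IsCatenoidProfile a f) : ContDiff ℝ 1 (deriv f) := by
  have := h.smooth
  rw [show (2 : WithTop ℕ∞) = 1 + 1 by norm_num, contDiff_succ_iff_deriv] at this
  exact this.2.2

theorem deriv_deriv (h : IsCatenoidProfile a f) (t : ℝ) :
    deriv (deriv f) t = 4 * (1 + deriv f t ^ 2) / (f t * (f t ^ 2 + 4)) := by
  have h1 := h.pos t
  have h2 : f t * (f t ^ 2 + 4) ≠ 0 := by positivity
  rw [eq_div_iff h2, ← h.ode t]; ring

theorem hasDerivAt_deriv (h : IsCatenoidProfile a f) (t : ℝ) :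
    HasDerivAt (deriv f) (4 * (1 + deriv f t ^ 2) / (f t * (f t ^ 2 + 4))) t := by
  rw [← h.deriv_deriv]
  exact ((h.contDiff_deriv.differentiable (by norm_num)) t).hasDerivAt

theorem a_pos (h : IsCatenoidProfile a f) : 0 < a := h.init ▸ h.pos 0

/-- The first integral of the Cauchy problem. -/
theorem energy (h : IsCatenoidProfile a f) (t : ℝ) :
    a ^ 2 * (f t ^ 2 + 4) * deriv f t ^ 2 = 4 * (f t ^ 2 - a ^ 2) := by
  have hd : ∀ t, HasDerivAt (fun t => (1 + deriv f t ^ 2) * (f t ^ 2 + 4) / f t ^ 2) 0 t := by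
    intro t
    have hp := h.pos t
    have := ((((h.hasDerivAt_deriv t).pow 2).const_add 1).mul
      (((h.hasDerivAt t).pow 2).add_const 4)).div ((h.hasDerivAt t).pow 2) (pow_ne_zero 2 hp.ne')
    refine this.congr_deriv ?_
    field_simp
    simp
    ring
  have hc := is_const_of_deriv_eq_zero (fun t => (hd t).differentiableAt)
    (fun t => (hd t).deriv) t 0
  simp only [h.init, h.init'] at hc
  have hp := h.pos t
  have ha := h.a_pos
  field_simp at hc
  nlinarith [hc]

theorem le_apply (h : IsCatenoidProfile a f) (t : ℝ) : a ≤ f t := by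
  have h1 := h.energy t
  have h2 := h.pos t
  have h3 : 0 ≤ a ^ 2 * (f t ^ 2 + 4) * deriv f t ^ 2 := by positivity
  exact abs_le_of_sq_le_sq' (by linarith) h2.le |>.2

theorem contDiff (h : IsCatenoidProfile a f) : ContDiff ℝ ∞ f := by
  rw [contDiff_infty]
  have key : ∀ n : ℕ, ContDiff ℝ (n + 2 : ℕ) f := by
    intro n
    induction n with
    | zero => exact h.smooth
    | succ n ih =>
      have e : deriv (deriv f) = fun t => 4 * (1 + deriv f t ^ 2) / (f t * (f t ^ 2 + 4)) :=
        funext h.deriv_deriv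
      have hdf : ContDiff ℝ (n + 1 : ℕ) (deriv f) := by
        have : ContDiff ℝ ((n + 1 : ℕ) + 1) f := by exact_mod_cast ih
        exact (contDiff_succ_iff_deriv.1 this).2.2
      have hf1 : ContDiff ℝ (n + 1 : ℕ) f := ih.of_le (by norm_cast; omega)
      have hddf : ContDiff ℝ (n + 1 : ℕ) (deriv (deriv f)) := by
        rw [e]
        exact (contDiff_const.mul (contDiff_const.add (hdf.pow 2))).div
          (hf1.mul ((hf1.pow 2).add contDiff_const))
          (fun t => by have := h.pos t; positivity)
      have h1 : ContDiff ℝ ((n + 1 : ℕ) + 1) (deriv f) :=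
        contDiff_succ_iff_deriv.2 ⟨h.contDiff_deriv.differentiable (by norm_num), by simp, hddf⟩
      have h2 : ContDiff ℝ ((n + 1 + 1 : ℕ) + 1) f :=
        contDiff_succ_iff_deriv.2 ⟨fun t => (h.hasDerivAt t).differentiableAt, by simp,
          by exact_mod_cast h1⟩
      exact_mod_cast h2
  exact fun n => (key n).of_le (by norm_cast; omega)

theorem strictMono_deriv (h : IsCatenoidProfile a f) : StrictMono (deriv f) :=
  strictMono_of_deriv_pos fun t => by
    rw [h.deriv_deriv]; have := h.pos t; positivity

theorem deriv_pos (h : IsCatenoidProfile a f) {t : ℝ} (ht : 0 < t) : 0 < deriv f t :=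
  h.init' ▸ h.strictMono_deriv ht

theorem deriv_neg (h : IsCatenoidProfile a f) {t : ℝ} (ht : t < 0) : deriv f t < 0 :=
  h.init' ▸ h.strictMono_deriv ht

/-- The Cauchy problem is invariant under `t ↦ -t`. -/
theorem comp_neg (h : IsCatenoidProfile a f) : IsCatenoidProfile a fun t => f (-t) := by
  have e : deriv (fun t => f (-t)) = fun t => -deriv f (-t) := funext fun t => deriv_comp_neg f t
  have e2 : deriv (fun t => -deriv f (-t)) = fun t => deriv (deriv f) (-t) := funext fun t => by
    rw [deriv.fun_neg, deriv_comp_neg, neg_neg]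
  exact ⟨h.smooth.comp contDiff_neg, fun t => h.pos _, fun t => by
    rw [e, e2]; simpa using h.ode (-t), by simp [h.init], by simp [e, h.init']⟩

theorem sq_eq (h : IsCatenoidProfile a f) (t : ℝ) :
    f t ^ 2 = a ^ 2 * (1 + (deriv f t * √(f t ^ 2 + 4) / 2) ^ 2) := by
  have := h.energy t
  rw [div_pow, mul_pow, Real.sq_sqrt (by positivity)]
  linarith

/-- `f'√(f² + 4)/2` is `sinh s` for the parameter `s` with `f = a cosh s`; in this coordinate along
the generating curve the Cauchy problem becomes an equation of first order. -/
theorem hasDerivAt_sinh (h : IsCatenoidProfile a f) (t : ℝ) :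
    HasDerivAt (fun t => deriv f t * √(f t ^ 2 + 4) / 2) (2 * f t / (a ^ 2 * √(f t ^ 2 + 4))) t := by
  have hp := h.pos t
  have ha := h.a_pos
  have hE : 0 < f t ^ 2 + 4 := by positivity
  have hs := Real.sqrt_pos.2 hE
  have hss := Real.sq_sqrt hE.le
  have := (((h.hasDerivAt_deriv t).mul
    ((((h.hasDerivAt t).pow 2).add_const 4).sqrt hE.ne')).div_const 2)
  refine this.congr_deriv ?_
  have en := h.energy t
  have en2 : deriv f t ^ 2 = 4 * (f t ^ 2 - a ^ 2) / (a ^ 2 * (f t ^ 2 + 4)) := by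
    rw [eq_div_iff (by positivity)]; linarith
  simp only [Nat.cast_ofNat, Pi.pow_apply]
  have e3 : deriv f t * (2 * f t ^ (2 - 1) * deriv f t / (2 * √(f t ^ 2 + 4)))
      = deriv f t ^ 2 * f t / √(f t ^ 2 + 4) := by
    field_simp
    norm_num
  rw [e3, en2]
  have hE2 : f t ^ 2 = √(f t ^ 2 + 4) ^ 2 - 4 := by rw [hss]; ring
  generalize √(f t ^ 2 + 4) = r at *
  rw [hE2, show r ^ 2 - 4 + 4 = r ^ 2 by ring]
  field_simp
  rw [hE2]
  ring

/-- Uniqueness for the Cauchy problem, by separation of variables. -/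
theorem unique {g : ℝ → ℝ} (h : IsCatenoidProfile a f) (hg : IsCatenoidProfile a g) : f = g := by
  have ha := h.a_pos
  set ψ : ℝ → ℝ := fun x => a * √(a ^ 2 * (1 + x ^ 2) + 4) / (2 * √(1 + x ^ 2)) with hψ
  have hpos : ∀ x, 0 < ψ x := fun x => by positivity
  have hcont : Continuous ψ := by
    have : ∀ x : ℝ, 2 * √(1 + x ^ 2) ≠ 0 := fun x => by positivity
    fun_prop (disch := assumption)
  set T : ℝ → ℝ := fun s => ∫ x in (0 : ℝ)..s, ψ x with hT
  have hTd : ∀ s, HasDerivAt T (ψ s) s := fun s =>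
    intervalIntegral.integral_hasDerivAt_right (hcont.intervalIntegrable _ _)
      (hcont.stronglyMeasurableAtFilter _ _) hcont.continuousAt
  have hTmono : StrictMono T := strictMono_of_deriv_pos fun s => by
    rw [(hTd s).deriv]; exact hpos s
  have key : ∀ {f : ℝ → ℝ}, IsCatenoidProfile a f → ∀ t,
      T (deriv f t * √(f t ^ 2 + 4) / 2) = t := by
    intro f h t
    have hd : ∀ t, HasDerivAt (fun t => T (deriv f t * √(f t ^ 2 + 4) / 2) - t) 0 t := by
      intro t
      have := ((hTd _).comp t (h.hasDerivAt_sinh t)).sub (hasDerivAt_id t)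
      refine this.congr_deriv ?_
      have h1 := h.sq_eq t
      have hp := h.pos t
      set X := deriv f t * √(f t ^ 2 + 4) / 2
      have h2 : √(1 + X ^ 2) = f t / a := by
        rw [Real.sqrt_eq_iff_mul_self_eq (by positivity) (by positivity)]
        field_simp; linarith
      rw [hψ]
      simp only [h2, ← h1]
      have : 0 < √(f t ^ 2 + 4) := by positivity
      field_simp
      ring
    have hc := is_const_of_deriv_eq_zero (fun t => (hd t).differentiableAt)
      (fun t => (hd t).deriv) t 0
    have : T 0 = 0 := by simp [hT]
    simp only [h.init', zero_mul, zero_div, this, sub_zero] at hc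
    linarith
  funext t
  have hX := hTmono.injective ((key h t).trans (key hg t).symm)
  have h1 := h.sq_eq t
  rw [hX, ← hg.sq_eq t] at h1
  nlinarith [h.pos t, hg.pos t]

theorem apply_neg (h : IsCatenoidProfile a f) (t : ℝ) : f (-t) = f t :=
  congrFun (h.comp_neg.unique h) t

end IsCatenoidProfile

theorem isCatenoidProfile_catenoidProfile {a : ℝ} (ha : 0 < a) :
    IsCatenoidProfile a (catenoidProfile a) := by
  rw [catenoidProfile, dif_pos ha]
  exact Classical.choose_spec (exists_catenoidProfile a ha)

/-! ### Curvature of `Nil₃` -/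

theorem partialD_eq {n : ℕ} {u : (Fin n → ℝ) → ℝ} {p : Fin n → ℝ} {u' : (Fin n → ℝ) →L[ℝ] ℝ}
    (h : HasFDerivAt u u' p) (i : Fin n) : partialD i u p = u' (Pi.single i 1) := by
  rw [partialD, h.fderiv]

/-- The inverse of `nilMetric`. -/
def nilMetricInv (p : Fin 3 → ℝ) : Matrix (Fin 3) (Fin 3) ℝ :=
  !![1, 0, -(p 1) / 2; 0, 1, p 0 / 2; -(p 1) / 2, p 0 / 2, 1 + (p 0 ^ 2 + p 1 ^ 2) / 4]

theorem nilMetric_eq (p : Fin 3 → ℝ) : nilMetric p =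
    !![1 + p 1 ^ 2 / 4, -(p 0 * p 1) / 4, p 1 / 2; -(p 0 * p 1) / 4, 1 + p 0 ^ 2 / 4, -(p 0) / 2;
      p 1 / 2, -(p 0) / 2, 1] := by
  ext i j
  fin_cases i <;> fin_cases j <;> simp [nilMetric] <;> ring

theorem inv_nilMetric (p : Fin 3 → ℝ) : (nilMetric p)⁻¹ = nilMetricInv p := by
  apply Matrix.inv_eq_right_inv
  rw [nilMetric_eq, nilMetricInv]
  ext i j
  fin_cases i <;> fin_cases j <;> simp [Matrix.mul_apply, Fin.sum_univ_three] <;> ring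

/-- The Christoffel symbols `Γᵏᵢⱼ` of `nilMetric`. -/
def nilChristoffel (p : Fin 3 → ℝ) (k : Fin 3) : Matrix (Fin 3) (Fin 3) ℝ :=
  ![!![0, p 1 / 4, 0; p 1 / 4, -(p 0) / 2, 1 / 2; 0, 1 / 2, 0],
    !![-(p 1) / 2, p 0 / 4, -1 / 2; p 0 / 4, 0, 0; -1 / 2, 0, 0],
    !![-(p 0 * p 1) / 4, (p 0 ^ 2 - p 1 ^ 2) / 8, -(p 0) / 4;
      (p 0 ^ 2 - p 1 ^ 2) / 8, p 0 * p 1 / 4, -(p 1) / 4; -(p 0) / 4, -(p 1) / 4, 0]] k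

section
variable {n : ℕ} {u v : (Fin n → ℝ) → ℝ} {p : Fin n → ℝ} (i : Fin n)

theorem partialD_add (hu : DifferentiableAt ℝ u p) (hv : DifferentiableAt ℝ v p) :
    partialD i (fun q => u q + v q) p = partialD i u p + partialD i v p := by
  simp [partialD, fderiv_fun_add hu hv]

theorem partialD_sub (hu : DifferentiableAt ℝ u p) (hv : DifferentiableAt ℝ v p) :
    partialD i (fun q => u q - v q) p = partialD i u p - partialD i v p := by
  simp [partialD, fderiv_fun_sub hu hv]

theorem partialD_mul (hu : DifferentiableAt ℝ u p) (hv : DifferentiableAt ℝ v p) :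
    partialD i (fun q => u q * v q) p = u p * partialD i v p + partialD i u p * v p := by
  simp [partialD, fderiv_fun_mul hu hv, mul_comm]

theorem partialD_neg : partialD i (fun q => -u q) p = -partialD i u p := by
  simp [partialD, fderiv_fun_neg]

theorem partialD_div_const (c : ℝ) (hu : DifferentiableAt ℝ u p) :
    partialD i (fun q => u q / c) p = partialD i u p / c := by
  simp only [div_eq_mul_inv]
  rw [partialD_mul i hu (by fun_prop)]
  simp [partialD]

theorem partialD_pow_two (hu : DifferentiableAt ℝ u p) :
    partialD i (fun q => u q ^ 2) p = 2 * u p * partialD i u p := by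
  simp only [pow_two]; rw [partialD_mul i hu hu]; ring

theorem partialD_const (c : ℝ) : partialD i (fun _ => c) p = 0 := by simp [partialD]

theorem partialD_coord (j : Fin n) : partialD i (fun q => q j) p = if j = i then 1 else 0 := by
  have : HasFDerivAt (fun q : Fin n → ℝ => q j) (ContinuousLinearMap.proj j) p :=
    (ContinuousLinearMap.proj (R := ℝ) (φ := fun _ : Fin n => ℝ) j).hasFDerivAt
  rw [partialD_eq this]
  simp [Pi.single_apply]

end

theorem partialD_nilMetric (p : Fin 3 → ℝ) (l i j : Fin 3) :
    partialD l (fun q => nilMetric q i j) p =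
    ![!![0, -(p 1) / 4, 0; -(p 1) / 4, p 0 / 2, -1 / 2; 0, -1 / 2, 0],
      !![p 1 / 2, -(p 0) / 4, 1 / 2; -(p 0) / 4, 0, 0; 1 / 2, 0, 0],
      !![0, 0, 0; 0, 0, 0; 0, 0, 0]] l i j := by
  simp only [nilMetric_eq]
  fin_cases i <;> fin_cases j <;> simp only [Fin.zero_eta, Fin.mk_one, Fin.reduceFinMk, Fin.isValue,
    Matrix.of_apply, Matrix.cons_val', Matrix.cons_val_zero, Matrix.cons_val_one, Matrix.cons_val,
    Matrix.cons_val_fin_one] <;>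
  simp (disch := fun_prop) only [partialD_add, partialD_div_const, partialD_neg, partialD_mul,
    partialD_pow_two, partialD_const, partialD_coord] <;>
  fin_cases l <;> simp <;> ring

theorem christoffel_nilMetric (p : Fin 3 → ℝ) (k i j : Fin 3) :
    christoffel nilMetric k i j p = nilChristoffel p k i j := by
  simp only [christoffel, inv_nilMetric, partialD_nilMetric, Fin.sum_univ_three]
  fin_cases i <;> fin_cases j <;> fin_cases k <;> simp [nilMetricInv, nilChristoffel] <;> ring

theorem partialD_nilChristoffel (p : Fin 3 → ℝ) (l k i j : Fin 3) :
    partialD l (fun q => nilChristoffel q k i j) p =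
    ![![!![0, 0, 0; 0, -1 / 2, 0; 0, 0, 0], !![0, 1 / 4, 0; 1 / 4, 0, 0; 0, 0, 0],
        !![0, 0, 0; 0, 0, 0; 0, 0, 0]],
      ![!![0, 1 / 4, 0; 1 / 4, 0, 0; 0, 0, 0], !![-1 / 2, 0, 0; 0, 0, 0; 0, 0, 0],
        !![0, 0, 0; 0, 0, 0; 0, 0, 0]],
      ![!![-(p 1) / 4, p 0 / 4, -1 / 4; p 0 / 4, p 1 / 4, 0; -1 / 4, 0, 0],
        !![-(p 0) / 4, -(p 1) / 4, 0; -(p 1) / 4, p 0 / 4, -1 / 4; 0, -1 / 4, 0],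
        !![0, 0, 0; 0, 0, 0; 0, 0, 0]]] k l i j := by
  simp only [nilChristoffel]
  fin_cases k <;> fin_cases i <;> fin_cases j <;> simp only [Fin.zero_eta, Fin.mk_one,
    Fin.reduceFinMk, Fin.isValue, Matrix.of_apply, Matrix.cons_val', Matrix.cons_val_zero,
    Matrix.cons_val_one, Matrix.cons_val, Matrix.cons_val_fin_one] <;>
  simp (disch := fun_prop) only [partialD_sub, partialD_div_const, partialD_neg,
    partialD_mul, partialD_pow_two, partialD_const, partialD_coord] <;>
  fin_cases l <;> simp only [Fin.zero_eta, Fin.mk_one, Fin.reduceFinMk, Fin.isValue,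
    Matrix.of_apply, Matrix.cons_val', Matrix.cons_val_zero, Matrix.cons_val_one, Matrix.cons_val,
    Matrix.cons_val_fin_one] <;>
  simp <;> ring

/-- The Ricci tensor of `nilMetric`. -/
theorem ricci_nilMetric (p : Fin 3 → ℝ) : ricci nilMetric p =
    !![-1 / 2 + p 1 ^ 2 / 8, -(p 0 * p 1) / 8, p 1 / 4;
      -(p 0 * p 1) / 8, -1 / 2 + p 0 ^ 2 / 8, -(p 0) / 4; p 1 / 4, -(p 0) / 4, 1 / 2] := by
  ext i j
  have e : ∀ k i j, christoffel nilMetric k i j = fun q => nilChristoffel q k i j :=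
    fun k i j => funext fun q => christoffel_nilMetric q k i j
  simp only [ricci, Matrix.of_apply, e, partialD_nilChristoffel, Fin.sum_univ_three]
  simp only [nilChristoffel]
  fin_cases i <;> fin_cases j <;>
  simp only [Fin.zero_eta, Fin.mk_one, Fin.reduceFinMk, Fin.isValue,
    Matrix.of_apply, Matrix.cons_val', Matrix.cons_val_zero, Matrix.cons_val_one, Matrix.cons_val,
    Matrix.cons_val_fin_one] <;>
  ring

/-! ### The Jacobi operator of the catenoid -/

namespace Catenoid

/-- The coefficient `√g gᵗᵗ` of the Laplacian of the catenoid; it is the inverse of `weight`. -/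
def radial (a : ℝ) (f : ℝ → ℝ) (t : ℝ) : ℝ := a * (f t ^ 2 + 4) / 4

/-- The weight `dσ/dt` of the parameter `σ` for which the metric is conformal to `dσ² + dϑ²`, where
`ϑ = θ - ∫ 2/(f² + 4) dt`. -/
def weight (a : ℝ) (f : ℝ → ℝ) (t : ℝ) : ℝ := 4 / (a * (f t ^ 2 + 4))

/-- The coefficient `√g g^θθ` of the Laplacian of the catenoid. -/
def angular (a : ℝ) (f : ℝ → ℝ) (t : ℝ) : ℝ := (4 + a ^ 2) / (a * (f t ^ 2 + 4))

/-- The potential `|A|² + Ric(N, N)` multiplied by the conformal factor of the metric with respect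
to `dσ² + dϑ²`. -/
def potential (a : ℝ) (f : ℝ → ℝ) (t : ℝ) : ℝ :=
  a ^ 2 + 2 - 8 * (f t ^ 2 - a ^ 2) / (f t ^ 2 * (f t ^ 2 + 4))

end Catenoid

section
variable {u v : ℝ → ℝ} {p : Fin 2 → ℝ}

theorem differentiableAt_comp_coord (i : Fin 2) (hu : DifferentiableAt ℝ u (p i)) :
    DifferentiableAt ℝ (fun q : Fin 2 → ℝ => u (q i)) p :=
  DifferentiableAt.comp (g := u) p hu (hasFDerivAt_apply i p).differentiableAt

theorem partialD_comp_coord {u' : ℝ} (i j : Fin 2) (hu : HasDerivAt u u' (p j)) :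
    partialD i (fun q : Fin 2 → ℝ => u (q j)) p = if j = i then u' else 0 := by
  have e := partialD_eq (hu.comp_hasFDerivAt p (hasFDerivAt_apply (𝕜 := ℝ) j p)) i
  simp only [Function.comp_def] at e
  rw [e]
  simp [Pi.single_apply]

theorem partialD_zero_mul_comp {u' : ℝ} (hu : HasDerivAt u u' (p 0))
    (hv : DifferentiableAt ℝ v (p 1)) :
    partialD 0 (fun q : Fin 2 → ℝ => u (q 0) * v (q 1)) p = u' * v (p 1) := by
  rw [partialD_mul 0 (differentiableAt_comp_coord 0 hu.differentiableAt)
    (differentiableAt_comp_coord 1 hv), partialD_comp_coord 0 0 hu,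
    partialD_comp_coord 0 1 hv.hasDerivAt]
  simp

theorem partialD_one_mul_comp {v' : ℝ} (hu : DifferentiableAt ℝ u (p 0))
    (hv : HasDerivAt v v' (p 1)) :
    partialD 1 (fun q : Fin 2 → ℝ => u (q 0) * v (q 1)) p = u (p 0) * v' := by
  rw [partialD_mul 1 (differentiableAt_comp_coord 0 hu)
    (differentiableAt_comp_coord 1 hv.differentiableAt), partialD_comp_coord 1 0 hu.hasDerivAt,
    partialD_comp_coord 1 1 hv]
  simp

end

namespace IsCatenoidProfile

variable {a : ℝ} {f : ℝ → ℝ}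

theorem tangentVec_zero (h : IsCatenoidProfile a f) (p : Fin 2 → ℝ) :
    tangentVec (revolutionSurface f) 0 p =
      ![deriv f (p 0) * Real.cos (p 1), deriv f (p 0) * Real.sin (p 1), 1] := by
  ext i
  fin_cases i
  · exact partialD_zero_mul_comp (h.hasDerivAt _) (by fun_prop)
  · exact partialD_zero_mul_comp (h.hasDerivAt _) (by fun_prop)
  · exact partialD_coord 0 0

theorem tangentVec_one (h : IsCatenoidProfile a f) (p : Fin 2 → ℝ) :
    tangentVec (revolutionSurface f) 1 p =
      ![f (p 0) * -Real.sin (p 1), f (p 0) * Real.cos (p 1), 0] := by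
  ext i
  have := (h.hasDerivAt (p 0)).differentiableAt
  fin_cases i
  · exact partialD_one_mul_comp this (Real.hasDerivAt_cos _)
  · exact partialD_one_mul_comp this (Real.hasDerivAt_sin _)
  · exact partialD_coord 1 0

theorem sq_deriv (h : IsCatenoidProfile a f) (t : ℝ) :
    deriv f t ^ 2 = 4 * (f t ^ 2 - a ^ 2) / (a ^ 2 * (f t ^ 2 + 4)) := by
  have ha := h.a_pos
  have := h.energy t
  have h2 : a ^ 2 * (f t ^ 2 + 4) ≠ 0 := by positivity
  rw [eq_div_iff h2]; linarith

theorem nilMetric_inner (q V W : Fin 3 → ℝ) : V ⬝ᵥ (nilMetric q *ᵥ W) = V 0 * W 0 + V 1 * W 1 +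
    (V 2 + (q 1 * V 0 - q 0 * V 1) / 2) * (W 2 + (q 1 * W 0 - q 0 * W 1) / 2) := by
  simp [nilMetric_eq, dotProduct, Matrix.mulVec, Fin.sum_univ_three]
  ring

theorem firstForm_eq (h : IsCatenoidProfile a f) (p : Fin 2 → ℝ) :
    firstForm (revolutionSurface f) p = (f (p 0) ^ 2 / a) •
      !![Catenoid.angular a f (p 0), -(a / 2); -(a / 2), Catenoid.radial a f (p 0)] := by
  have ha := h.a_pos
  have hsq := h.sq_deriv (p 0)
  have hf := h.pos (p 0)
  have hcs : Real.cos (p 1) ^ 2 = 1 - Real.sin (p 1) ^ 2 := Real.cos_sq' _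
  have e00 : firstForm (revolutionSurface f) p 0 0 = deriv f (p 0) ^ 2 + 1 := by
    simp only [firstForm, Matrix.of_apply, nilMetric_inner, h.tangentVec_zero, revolutionSurface,
      Matrix.cons_val_zero, Matrix.cons_val_one, Matrix.cons_val]
    linear_combination deriv f (p 0) ^ 2 * hcs
  have e01 : firstForm (revolutionSurface f) p 0 1 = -(f (p 0) ^ 2 / 2) := by
    simp only [firstForm, Matrix.of_apply, nilMetric_inner, h.tangentVec_zero, h.tangentVec_one,
      revolutionSurface, Matrix.cons_val_zero, Matrix.cons_val_one, Matrix.cons_val]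
    linear_combination (-f (p 0) ^ 2 / 2) * hcs
  have e10 : firstForm (revolutionSurface f) p 1 0 = -(f (p 0) ^ 2 / 2) := by
    simp only [firstForm, Matrix.of_apply, nilMetric_inner, h.tangentVec_zero, h.tangentVec_one,
      revolutionSurface, Matrix.cons_val_zero, Matrix.cons_val_one, Matrix.cons_val]
    linear_combination (-f (p 0) ^ 2 / 2) * hcs
  have e11 : firstForm (revolutionSurface f) p 1 1 = f (p 0) ^ 2 + f (p 0) ^ 4 / 4 := by
    simp only [firstForm, Matrix.of_apply, nilMetric_inner, h.tangentVec_one,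
      revolutionSurface, Matrix.cons_val_zero, Matrix.cons_val_one, Matrix.cons_val]
    linear_combination (f (p 0) ^ 2 + f (p 0) ^ 4 / 4 * (1 + Real.cos (p 1) ^ 2 + Real.sin (p 1) ^ 2)) * hcs
  ext i j
  fin_cases i <;> fin_cases j
  · simp [e00, Catenoid.angular, hsq]; field_simp; ring
  · simp [e01]; field_simp
  · simp [e10]; field_simp
  · simp [e11, Catenoid.radial]; field_simp; ring

theorem det_firstForm (h : IsCatenoidProfile a f) (p : Fin 2 → ℝ) :
    (firstForm (revolutionSurface f) p).det = (f (p 0) ^ 2 / a) ^ 2 := by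
  have ha := h.a_pos
  rw [h.firstForm_eq, Matrix.det_smul, Matrix.det_fin_two_of, Catenoid.angular, Catenoid.radial]
  simp only [Fintype.card_fin]
  field_simp
  ring

theorem areaDensity_eq (h : IsCatenoidProfile a f) (p : Fin 2 → ℝ) :
    areaDensity (revolutionSurface f) p = f (p 0) ^ 2 / a := by
  have ha := h.a_pos
  rw [areaDensity, h.det_firstForm, Real.sqrt_sq (by positivity)]

theorem inv_firstForm (h : IsCatenoidProfile a f) (p : Fin 2 → ℝ) :
    (firstForm (revolutionSurface f) p)⁻¹ = (a / f (p 0) ^ 2) •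
      !![Catenoid.radial a f (p 0), a / 2; a / 2, Catenoid.angular a f (p 0)] := by
  have ha := h.a_pos
  have hf := h.pos (p 0)
  apply Matrix.inv_eq_right_inv
  rw [h.firstForm_eq, Catenoid.radial, Catenoid.angular]
  ext i j
  fin_cases i <;> fin_cases j <;> simp [Matrix.mul_apply] <;> field_simp <;> ring

/-- The conormal `∂₀F × ∂₁F`. -/
theorem conormal_eq (h : IsCatenoidProfile a f) (p : Fin 2 → ℝ) :
    crossProduct (tangentVec (revolutionSurface f) 0 p) (tangentVec (revolutionSurface f) 1 p) =
      ![-(f (p 0) * Real.cos (p 1)), -(f (p 0) * Real.sin (p 1)), f (p 0) * deriv f (p 0)] := by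
  have hcs : Real.cos (p 1) ^ 2 = 1 - Real.sin (p 1) ^ 2 := Real.cos_sq' _
  rw [h.tangentVec_zero, h.tangentVec_one, cross_apply]
  ext i
  fin_cases i <;> simp
  linear_combination (f (p 0) * deriv f (p 0)) * hcs

theorem unitNormal_eq (h : IsCatenoidProfile a f) (p : Fin 2 → ℝ) :
    unitNormal (revolutionSurface f) p = (a / f (p 0)) •
      ![-Real.cos (p 1) - f (p 0) * deriv f (p 0) / 2 * Real.sin (p 1),
        -Real.sin (p 1) + f (p 0) * deriv f (p 0) / 2 * Real.cos (p 1),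
        (1 + f (p 0) ^ 2 / 4) * deriv f (p 0)] := by
  have ha := h.a_pos
  have hf := h.pos (p 0)
  have hsq := h.sq_deriv (p 0)
  have hcs : Real.cos (p 1) ^ 2 = 1 - Real.sin (p 1) ^ 2 := Real.cos_sq' _
  have h1 : (nilMetric (revolutionSurface f p))⁻¹ *ᵥ
      ![-(f (p 0) * Real.cos (p 1)), -(f (p 0) * Real.sin (p 1)), f (p 0) * deriv f (p 0)] =
      f (p 0) • ![-Real.cos (p 1) - f (p 0) * deriv f (p 0) / 2 * Real.sin (p 1),
        -Real.sin (p 1) + f (p 0) * deriv f (p 0) / 2 * Real.cos (p 1),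
        (1 + f (p 0) ^ 2 / 4) * deriv f (p 0)] := by
    rw [inv_nilMetric]
    ext i
    fin_cases i <;> simp [nilMetricInv, revolutionSurface, Matrix.mulVec, dotProduct,
      Fin.sum_univ_three]
    · ring
    · ring
    · linear_combination (f (p 0) ^ 3 * deriv f (p 0) / 4) * hcs
  have h2 : (1 + f (p 0) ^ 2 / 4) * deriv f (p 0) ^ 2 + 1 = f (p 0) ^ 2 / a ^ 2 := by
    rw [hsq]; field_simp; ring
  have h3 : ![-(f (p 0) * Real.cos (p 1)), -(f (p 0) * Real.sin (p 1)), f (p 0) * deriv f (p 0)] ⬝ᵥ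
      ((nilMetric (revolutionSurface f p))⁻¹ *ᵥ
      ![-(f (p 0) * Real.cos (p 1)), -(f (p 0) * Real.sin (p 1)), f (p 0) * deriv f (p 0)])
      = (f (p 0) ^ 2 / a) ^ 2 := by
    rw [h1]
    simp [dotProduct, Fin.sum_univ_three]
    linear_combination f (p 0) ^ 2 * hcs + f (p 0) ^ 2 * h2
  simp only [unitNormal, h.conormal_eq, h3]
  rw [h1, Real.sqrt_sq (by positivity), smul_smul]
  congr 1
  field_simp

theorem nilMetric_mulVec_unitNormal (h : IsCatenoidProfile a f) (p : Fin 2 → ℝ) :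
    nilMetric (revolutionSurface f p) *ᵥ unitNormal (revolutionSurface f) p = (a / f (p 0)) •
      ![-Real.cos (p 1), -Real.sin (p 1), deriv f (p 0)] := by
  have hf := h.pos (p 0)
  have hcs : Real.cos (p 1) ^ 2 = 1 - Real.sin (p 1) ^ 2 := Real.cos_sq' _
  rw [h.unitNormal_eq, Matrix.mulVec_smul]
  congr 1
  rw [nilMetric_eq]
  ext i
  fin_cases i <;> simp [revolutionSurface, Matrix.mulVec, dotProduct, Fin.sum_univ_three]
  · linear_combination (-Real.sin (p 1) * f (p 0) ^ 3 * deriv f (p 0) / 8) * hcs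
  · linear_combination (Real.cos (p 1) * f (p 0) ^ 3 * deriv f (p 0) / 8) * hcs
  · linear_combination (-f (p 0) ^ 2 * deriv f (p 0) / 4) * hcs

theorem ricciNormal_eq (h : IsCatenoidProfile a f) (p : Fin 2 → ℝ) :
    ricciNormal (revolutionSurface f) p = -1 / 2 + a ^ 2 * deriv f (p 0) ^ 2 / f (p 0) ^ 2 := by
  have ha := h.a_pos
  have hf := h.pos (p 0)
  have hsq := h.sq_deriv (p 0)
  have hcs : Real.cos (p 1) ^ 2 = 1 - Real.sin (p 1) ^ 2 := Real.cos_sq' _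
  have h2 : a ^ 2 / f (p 0) ^ 2 * ((1 + f (p 0) ^ 2 / 4) * deriv f (p 0) ^ 2 + 1) = 1 := by
    rw [hsq]; field_simp; ring
  -- `Ric = -g/2 + η ⊗ η` with the contact form `η = dz + (y dx - x dy)/2`.
  have hric : ∀ q V : Fin 3 → ℝ, V ⬝ᵥ (ricci nilMetric q *ᵥ V) =
      -1 / 2 * (V ⬝ᵥ (nilMetric q *ᵥ V)) + (V 2 + (q 1 * V 0 - q 0 * V 1) / 2) ^ 2 := by
    intro q V
    rw [ricci_nilMetric, nilMetric_inner]
    simp [dotProduct, Matrix.mulVec, Fin.sum_univ_three]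
    ring
  have hN : unitNormal (revolutionSurface f) p ⬝ᵥ (nilMetric (revolutionSurface f p) *ᵥ
      unitNormal (revolutionSurface f) p) = 1 := by
    rw [h.nilMetric_mulVec_unitNormal, h.unitNormal_eq]
    simp [dotProduct, Fin.sum_univ_three]
    linear_combination h2 + a ^ 2 / f (p 0) ^ 2 * hcs
  have hη : a / f (p 0) * ((1 + f (p 0) ^ 2 / 4) * deriv f (p 0)) + (f (p 0) * Real.sin (p 1) *
      (a / f (p 0) * (-Real.cos (p 1) - f (p 0) * deriv f (p 0) / 2 * Real.sin (p 1))) -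
      f (p 0) * Real.cos (p 1) * (a / f (p 0) *
        (-Real.sin (p 1) + f (p 0) * deriv f (p 0) / 2 * Real.cos (p 1)))) / 2 =
      a * deriv f (p 0) / f (p 0) := by
    linear_combination (-a * f (p 0) ^ 2 * deriv f (p 0) / f (p 0) / 4) * hcs
  rw [ricciNormal, hric, hN, h.unitNormal_eq]
  simp only [revolutionSurface, Pi.smul_apply, smul_eq_mul, Matrix.cons_val_zero,
    Matrix.cons_val_one, Matrix.cons_val]
  rw [hη]
  ring

theorem covDeriv_zero_zero (h : IsCatenoidProfile a f) (p : Fin 2 → ℝ) :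
    covDeriv (revolutionSurface f) 0 0 p =
      ![deriv (deriv f) (p 0) * Real.cos (p 1) + deriv f (p 0) * Real.sin (p 1),
        deriv (deriv f) (p 0) * Real.sin (p 1) - deriv f (p 0) * Real.cos (p 1),
        - f (p 0) * deriv f (p 0) / 2] := by
  have hd := (h.hasDerivAt_deriv (p 0)).differentiableAt.hasDerivAt
  have hcs : Real.cos (p 1) ^ 2 = 1 - Real.sin (p 1) ^ 2 := Real.cos_sq' _
  ext k
  simp only [covDeriv, h.tangentVec_zero, christoffel_nilMetric, Fin.sum_univ_three]
  fin_cases k <;> simp [nilChristoffel, revolutionSurface, partialD_const,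
    partialD_zero_mul_comp hd Real.differentiable_cos.differentiableAt,
    partialD_zero_mul_comp hd Real.differentiable_sin.differentiableAt]
  all_goals grind

theorem covDeriv_zero_one (h : IsCatenoidProfile a f) (p : Fin 2 → ℝ) :
    covDeriv (revolutionSurface f) 0 1 p =
      ![f (p 0) / 2 * Real.cos (p 1) - deriv f (p 0) * (1 + f (p 0) ^ 2 / 4) * Real.sin (p 1),
        f (p 0) / 2 * Real.sin (p 1) + deriv f (p 0) * (1 + f (p 0) ^ 2 / 4) * Real.cos (p 1),
        f (p 0) ^ 3 * deriv f (p 0) / 8] := by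
  have hd := h.hasDerivAt (p 0)
  have hcs : Real.cos (p 1) ^ 2 = 1 - Real.sin (p 1) ^ 2 := Real.cos_sq' _
  ext k
  simp only [covDeriv, h.tangentVec_zero, h.tangentVec_one, christoffel_nilMetric,
    Fin.sum_univ_three]
  fin_cases k <;> simp [nilChristoffel, revolutionSurface, partialD_const, partialD_neg,
    partialD_zero_mul_comp hd Real.differentiable_cos.differentiableAt,
    partialD_zero_mul_comp hd Real.differentiable_sin.differentiableAt]
  all_goals grind

theorem covDeriv_one_one (h : IsCatenoidProfile a f) (p : Fin 2 → ℝ) :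
    covDeriv (revolutionSurface f) 1 1 p =
      ![-(f (p 0) + f (p 0) ^ 3 / 2) * Real.cos (p 1),
        -(f (p 0) + f (p 0) ^ 3 / 2) * Real.sin (p 1), 0] := by
  have hd := (h.hasDerivAt (p 0)).differentiableAt
  have hcs : Real.cos (p 1) ^ 2 = 1 - Real.sin (p 1) ^ 2 := Real.cos_sq' _
  ext k
  simp only [covDeriv, h.tangentVec_one, christoffel_nilMetric,
    Fin.sum_univ_three]
  fin_cases k <;> simp [nilChristoffel, revolutionSurface, partialD_const, partialD_neg,
    partialD_one_mul_comp hd (Real.hasDerivAt_cos _), partialD_one_mul_comp hd (Real.hasDerivAt_sin _)]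
  all_goals grind

theorem covDeriv_one_zero (h : IsCatenoidProfile a f) (p : Fin 2 → ℝ) :
    covDeriv (revolutionSurface f) 1 0 p =
      ![f (p 0) / 2 * Real.cos (p 1) - deriv f (p 0) * (1 + f (p 0) ^ 2 / 4) * Real.sin (p 1),
        f (p 0) / 2 * Real.sin (p 1) + deriv f (p 0) * (1 + f (p 0) ^ 2 / 4) * Real.cos (p 1),
        f (p 0) ^ 3 * deriv f (p 0) / 8] := by
  have hd := (h.hasDerivAt_deriv (p 0)).differentiableAt
  have hcs : Real.cos (p 1) ^ 2 = 1 - Real.sin (p 1) ^ 2 := Real.cos_sq' _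
  ext k
  simp only [covDeriv, h.tangentVec_zero, h.tangentVec_one, christoffel_nilMetric,
    Fin.sum_univ_three]
  fin_cases k <;> simp [nilChristoffel, revolutionSurface, partialD_const,
    partialD_one_mul_comp hd (Real.hasDerivAt_cos _),
    partialD_one_mul_comp hd (Real.hasDerivAt_sin _)]
  all_goals grind

theorem secondForm_eq (h : IsCatenoidProfile a f) (p : Fin 2 → ℝ) :
    secondForm (revolutionSurface f) p = (a / f (p 0)) •
      !![-deriv (deriv f) (p 0) - f (p 0) * deriv f (p 0) ^ 2 / 2,
        -f (p 0) / 2 + f (p 0) ^ 3 * deriv f (p 0) ^ 2 / 8;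
        -f (p 0) / 2 + f (p 0) ^ 3 * deriv f (p 0) ^ 2 / 8, f (p 0) + f (p 0) ^ 3 / 2] := by
  have hcs : Real.cos (p 1) ^ 2 = 1 - Real.sin (p 1) ^ 2 := Real.cos_sq' _
  ext i j
  simp only [secondForm, Matrix.of_apply, h.nilMetric_mulVec_unitNormal, dotProduct_smul,
    Matrix.smul_apply, smul_eq_mul]
  congr 1
  fin_cases i <;> fin_cases j
  · simp [h.covDeriv_zero_zero, dotProduct, Fin.sum_univ_three]
    linear_combination (-deriv (deriv f) (p 0)) * hcs
  · simp [h.covDeriv_zero_one, dotProduct, Fin.sum_univ_three]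
    linear_combination (-f (p 0) / 2) * hcs
  · simp [h.covDeriv_one_zero, dotProduct, Fin.sum_univ_three]
    linear_combination (-f (p 0) / 2) * hcs
  · simp [h.covDeriv_one_one, dotProduct, Fin.sum_univ_three]
    linear_combination (f (p 0) + f (p 0) ^ 3 / 2) * hcs

theorem curvature_eq (h : IsCatenoidProfile a f) (p : Fin 2 → ℝ) :
    secondFormNormSq (revolutionSurface f) p + ricciNormal (revolutionSurface f) p =
      Catenoid.weight a f (p 0) * Catenoid.potential a f (p 0) * (a / f (p 0) ^ 2) := by
  have ha := h.a_pos
  have hf := h.pos (p 0)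
  have hsq := h.sq_deriv (p 0)
  rw [h.ricciNormal_eq, secondFormNormSq, h.inv_firstForm, h.secondForm_eq, h.deriv_deriv, hsq]
  simp only [Matrix.trace_fin_two, Matrix.mul_apply, Fin.sum_univ_two, Matrix.smul_apply,
    Matrix.of_apply, Matrix.cons_val', Matrix.cons_val_zero, Matrix.cons_val_one,
    Matrix.cons_val_fin_one, smul_eq_mul,
    Catenoid.radial, Catenoid.angular, Catenoid.weight, Catenoid.potential]
  field_simp
  ring

/-- The Jacobi operator of the catenoid in divergence form. -/
theorem jacobiOp_eq (h : IsCatenoidProfile a f) (u : (Fin 2 → ℝ) → ℝ) (p : Fin 2 → ℝ) :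
    f (p 0) ^ 2 / a * jacobiOp (revolutionSurface f) u p =
      -(partialD 0 (fun q => Catenoid.radial a f (q 0) * partialD 0 u q + a / 2 * partialD 1 u q) p
        + partialD 1 (fun q => a / 2 * partialD 0 u q +
          Catenoid.angular a f (q 0) * partialD 1 u q) p)
      - Catenoid.weight a f (p 0) * Catenoid.potential a f (p 0) * u p := by
  have ha := h.a_pos
  have hf := h.pos
  have e0 : (fun q => f (q 0) ^ 2 / a * (a / f (q 0) ^ 2 * Catenoid.radial a f (q 0) *
      partialD 0 u q + a / f (q 0) ^ 2 * (a / 2) * partialD 1 u q)) =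
      fun q : Fin 2 → ℝ => Catenoid.radial a f (q 0) * partialD 0 u q + a / 2 * partialD 1 u q := by
    funext q; have := hf (q 0); field_simp
  have e1 : (fun q => f (q 0) ^ 2 / a * (a / f (q 0) ^ 2 * (a / 2) *
      partialD 0 u q + a / f (q 0) ^ 2 * Catenoid.angular a f (q 0) * partialD 1 u q)) =
      fun q : Fin 2 → ℝ => a / 2 * partialD 0 u q +
        Catenoid.angular a f (q 0) * partialD 1 u q := by
    funext q; have := hf (q 0); field_simp
  rw [jacobiOp, h.curvature_eq, surfaceLaplacian, h.areaDensity_eq]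
  simp only [Fin.sum_univ_two, h.areaDensity_eq, h.inv_firstForm, Matrix.smul_apply, smul_eq_mul,
    Matrix.of_apply, Matrix.cons_val', Matrix.cons_val_zero, Matrix.cons_val_one,
    Matrix.cons_val_fin_one]
  rw [e0, e1]
  have key : ∀ c S W : ℝ, c ≠ 0 → c * (-(1 / c * S) - W) = -S - c * W := by
    intro c S W hc; field_simp
  have := hf (p 0)
  rw [key _ _ _ (by positivity)]
  congr 1
  field_simp

end IsCatenoidProfile

/-! ### Integration over one period of the parameter plane -/

/-- One period of the part `|t| ≤ T` of the parameter plane. -/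
def strip (T : ℝ) : Set (Fin 2 → ℝ) := {p | p 0 ∈ Ioc (-T) T ∧ p 1 ∈ Ioc 0 (2 * Real.pi)}

theorem measurableSet_strip (T : ℝ) : MeasurableSet (strip T) :=
  ((measurable_pi_apply 0) measurableSet_Ioc).inter ((measurable_pi_apply 1) measurableSet_Ioc)

theorem vec_eta (p : Fin 2 → ℝ) : ![p 0, p 1] = p := by
  ext i; fin_cases i <;> rfl

theorem continuous_vec : Continuous fun q : ℝ × ℝ => ![q.1, q.2] := by
  refine continuous_pi fun i => ?_
  fin_cases i
  · exact continuous_fst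
  · exact continuous_snd

theorem integrableOn_strip {T : ℝ} {g : (Fin 2 → ℝ) → ℝ} (hg : Continuous g) :
    IntegrableOn g (strip T) := by
  refine (hg.continuousOn.integrableOn_compact
    (isCompact_Icc (a := ![-T, 0]) (b := ![T, 2 * Real.pi]))).mono_set ?_
  rintro p ⟨⟨h1, h2⟩, h3, h4⟩
  constructor <;> intro i <;> fin_cases i <;> simp <;> linarith

theorem strip_eq_preimage (T : ℝ) : strip T = (MeasurableEquiv.finTwoArrow (α := ℝ)) ⁻¹'
    (Ioc (-T) T ×ˢ Ioc 0 (2 * Real.pi)) := rfl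

theorem setIntegral_strip_eq_prod {T : ℝ} (g : (Fin 2 → ℝ) → ℝ) :
    ∫ p in strip T, g p = ∫ q in Ioc (-T) T ×ˢ Ioc 0 (2 * Real.pi), g ![q.1, q.2] := by
  have := (volume_preserving_finTwoArrow ℝ).setIntegral_preimage_emb
    (MeasurableEquiv.finTwoArrow (α := ℝ)).measurableEmbedding (fun q => g ![q.1, q.2])
    (Ioc (-T) T ×ˢ Ioc 0 (2 * Real.pi))
  rw [← this, strip_eq_preimage]
  congr 1
  funext p
  exact congrArg g (vec_eta p).symm

theorem integrableOn_prod_Ioc {g : ℝ × ℝ → ℝ} (hg : Continuous g) (a b c d : ℝ) :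
    IntegrableOn g (Ioc a b ×ˢ Ioc c d) (volume.prod volume) :=
  (hg.continuousOn.integrableOn_compact (isCompact_Icc.prod isCompact_Icc)).mono_set
    (prod_mono Ioc_subset_Icc_self Ioc_subset_Icc_self)

theorem setIntegral_strip {T : ℝ} (hT : 0 ≤ T) {g : (Fin 2 → ℝ) → ℝ} (hg : Continuous g) :
    ∫ p in strip T, g p = ∫ t in (-T)..T, ∫ θ in (0 : ℝ)..(2 * Real.pi), g ![t, θ] := by
  have h1 : IntegrableOn (fun q : ℝ × ℝ => g ![q.1, q.2]) (Ioc (-T) T ×ˢ Ioc 0 (2 * Real.pi))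
      (volume.prod volume) := integrableOn_prod_Ioc (hg.comp continuous_vec) _ _ _ _
  rw [setIntegral_strip_eq_prod, Measure.volume_eq_prod, setIntegral_prod _ h1,
    intervalIntegral.integral_of_le (by linarith)]
  simp only [intervalIntegral.integral_of_le (show (0 : ℝ) ≤ 2 * Real.pi by positivity)]

theorem setIntegral_strip_symm {T : ℝ} (hT : 0 ≤ T) {g : (Fin 2 → ℝ) → ℝ} (hg : Continuous g) :
    ∫ p in strip T, g p = ∫ θ in (0 : ℝ)..(2 * Real.pi), ∫ t in (-T)..T, g ![t, θ] := by
  have h1 : IntegrableOn (fun q : ℝ × ℝ => g ![q.2, q.1]) (Ioc 0 (2 * Real.pi) ×ˢ Ioc (-T) T)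
      (volume.prod volume) := integrableOn_prod_Ioc
        (hg.comp (continuous_vec.comp continuous_swap)) _ _ _ _
  rw [setIntegral_strip_eq_prod, Measure.volume_eq_prod, ← setIntegral_prod_swap]
  simp only [Prod.fst_swap, Prod.snd_swap]
  rw [setIntegral_prod _ h1,
    intervalIntegral.integral_of_le (show (0 : ℝ) ≤ 2 * Real.pi by positivity)]
  simp only [intervalIntegral.integral_of_le (show -T ≤ T by linarith)]

/-- Functions on the parameter plane of period `2π` in the second variable. -/
def IsPeriodic (u : (Fin 2 → ℝ) → ℝ) : Prop :=
  ∀ t θ : ℝ, u ![t, θ + 2 * Real.pi] = u ![t, θ]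

theorem contDiff_partialD {n : ℕ} {u : (Fin n → ℝ) → ℝ} (hu : ContDiff ℝ ∞ u) (i : Fin n) :
    ContDiff ℝ ∞ (partialD i u) := by
  have : ContDiff ℝ ∞ (fderiv ℝ u) := hu.fderiv_right (by norm_cast)
  exact this.clm_apply contDiff_const

theorem hasDerivAt_vec_zero {u : (Fin 2 → ℝ) → ℝ} {t θ : ℝ} (hu : DifferentiableAt ℝ u ![t, θ]) :
    HasDerivAt (fun s => u ![s, θ]) (partialD 0 u ![t, θ]) t := by
  have h1 : HasDerivAt (fun s : ℝ => (![s, θ] : Fin 2 → ℝ)) (Pi.single 0 1) t := by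
    rw [hasDerivAt_pi]
    intro i
    fin_cases i
    · simpa using hasDerivAt_id' t
    · simpa using hasDerivAt_const t θ
  exact hu.hasFDerivAt.comp_hasDerivAt t h1

theorem hasDerivAt_vec_one {u : (Fin 2 → ℝ) → ℝ} {t θ : ℝ} (hu : DifferentiableAt ℝ u ![t, θ]) :
    HasDerivAt (fun s => u ![t, s]) (partialD 1 u ![t, θ]) θ := by
  have h1 : HasDerivAt (fun s : ℝ => (![t, s] : Fin 2 → ℝ)) (Pi.single 1 1) θ := by
    rw [hasDerivAt_pi]
    intro i
    fin_cases i
    · simpa using hasDerivAt_const θ t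
    · simpa using hasDerivAt_id' θ
  exact hu.hasFDerivAt.comp_hasDerivAt θ h1

theorem IsPeriodic.partialD {u : (Fin 2 → ℝ) → ℝ} (h : IsPeriodic u) (hu : Differentiable ℝ u)
    (i : Fin 2) : IsPeriodic (partialD i u) := by
  intro t θ
  fin_cases i
  · have := hasDerivAt_vec_zero (hu ![t, θ + 2 * Real.pi])
    rw [funext fun s => h s θ] at this
    exact this.unique (hasDerivAt_vec_zero (hu _))
  · have := (hasDerivAt_vec_one (hu ![t, θ + 2 * Real.pi])).comp_add_const θ (2 * Real.pi)
    rw [funext fun s => h t s] at this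
    exact this.unique (hasDerivAt_vec_one (hu _))

theorem setIntegral_partialD_zero {T : ℝ} (hT : 0 ≤ T) {u : (Fin 2 → ℝ) → ℝ}
    (hu : ContDiff ℝ ∞ u) (h0 : ∀ θ, u ![-T, θ] = 0) (h1 : ∀ θ, u ![T, θ] = 0) :
    ∫ p in strip T, partialD 0 u p = 0 := by
  have hc := (contDiff_partialD hu 0).continuous
  rw [setIntegral_strip_symm hT hc]
  have : ∀ θ : ℝ, ∫ t in (-T)..T, partialD 0 u ![t, θ] = 0 := fun θ => by
    rw [intervalIntegral.integral_eq_sub_of_hasDerivAt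
      (fun t _ => hasDerivAt_vec_zero (hu.differentiable (by simp) _))
      ((hc.comp (continuous_vec.comp (continuous_id.prodMk continuous_const))).intervalIntegrable
        _ _), h0, h1, sub_zero]
  simp [this]

theorem setIntegral_partialD_one {T : ℝ} (hT : 0 ≤ T) {u : (Fin 2 → ℝ) → ℝ}
    (hu : ContDiff ℝ ∞ u) (hp : IsPeriodic u) : ∫ p in strip T, partialD 1 u p = 0 := by
  have hc := (contDiff_partialD hu 1).continuous
  rw [setIntegral_strip hT hc]
  have : ∀ t : ℝ, ∫ θ in (0 : ℝ)..(2 * Real.pi), partialD 1 u ![t, θ] = 0 := fun t => by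
    rw [intervalIntegral.integral_eq_sub_of_hasDerivAt
      (fun θ _ => hasDerivAt_vec_one (hu.differentiable (by simp) _))
      ((hc.comp (continuous_vec.comp (continuous_const.prodMk continuous_id))).intervalIntegrable
        _ _)]
    have := hp t 0
    rw [zero_add] at this
    rw [this, sub_self]
  simp [this]

/-! ### The index form -/

namespace Catenoid

/-- The integrand of the bilinear form of the Jacobi operator. -/
def bilin (a : ℝ) (f : ℝ → ℝ) (u v : (Fin 2 → ℝ) → ℝ) (p : Fin 2 → ℝ) : ℝ :=
  radial a f (p 0) * (partialD 0 u p * partialD 0 v p)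
    + a / 2 * (partialD 0 u p * partialD 1 v p + partialD 1 u p * partialD 0 v p)
    + angular a f (p 0) * (partialD 1 u p * partialD 1 v p)
    - weight a f (p 0) * potential a f (p 0) * (u p * v p)

theorem bilin_comm (a : ℝ) (f : ℝ → ℝ) (u v : (Fin 2 → ℝ) → ℝ) : bilin a f u v = bilin a f v u := by
  funext p; simp only [bilin]; ring

end Catenoid

namespace IsCatenoidProfile

variable {a : ℝ} {f : ℝ → ℝ}

theorem contDiff_radial (h : IsCatenoidProfile a f) : ContDiff ℝ ∞ (Catenoid.radial a f) := by
  have := h.contDiff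
  unfold Catenoid.radial; fun_prop

theorem contDiff_weight (h : IsCatenoidProfile a f) : ContDiff ℝ ∞ (Catenoid.weight a f) := by
  have := h.contDiff
  have ha := h.a_pos
  have : ∀ t, a * (f t ^ 2 + 4) ≠ 0 := fun t => by positivity
  unfold Catenoid.weight; fun_prop (disch := assumption)

theorem contDiff_angular (h : IsCatenoidProfile a f) : ContDiff ℝ ∞ (Catenoid.angular a f) := by
  have := h.contDiff
  have ha := h.a_pos
  have : ∀ t, a * (f t ^ 2 + 4) ≠ 0 := fun t => by positivity
  unfold Catenoid.angular; fun_prop (disch := assumption)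

theorem contDiff_potential (h : IsCatenoidProfile a f) : ContDiff ℝ ∞ (Catenoid.potential a f) := by
  have := h.contDiff
  have ha := h.pos
  have : ∀ t, f t ^ 2 * (f t ^ 2 + 4) ≠ 0 := fun t => by have := ha t; positivity
  unfold Catenoid.potential; fun_prop (disch := assumption)

theorem continuous_bilin (h : IsCatenoidProfile a f) {u v : (Fin 2 → ℝ) → ℝ}
    (hu : ContDiff ℝ ∞ u) (hv : ContDiff ℝ ∞ v) : Continuous (Catenoid.bilin a f u v) := by
  have h1 := h.contDiff_radial.continuous
  have h2 := h.contDiff_angular.continuous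
  have h3 := h.contDiff_weight.continuous
  have h4 := h.contDiff_potential.continuous
  have h5 := fun i => (contDiff_partialD hu i).continuous
  have h6 := fun i => (contDiff_partialD hv i).continuous
  have h7 := hu.continuous
  have h8 := hv.continuous
  have h50 := h5 0
  have h51 := h5 1
  have h60 := h6 0
  have h61 := h6 1
  unfold Catenoid.bilin
  fun_prop

theorem contDiff_flux (h : IsCatenoidProfile a f) {u : (Fin 2 → ℝ) → ℝ} (hu : ContDiff ℝ ∞ u) :
    ContDiff ℝ ∞ (fun q => Catenoid.radial a f (q 0) * partialD 0 u q + a / 2 * partialD 1 u q) ∧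
    ContDiff ℝ ∞ (fun q => a / 2 * partialD 0 u q + Catenoid.angular a f (q 0) * partialD 1 u q) := by
  have h1 := h.contDiff_radial
  have h2 := h.contDiff_angular
  have h50 := contDiff_partialD hu 0
  have h51 := contDiff_partialD hu 1
  constructor <;> fun_prop

theorem continuous_jacobiOp (h : IsCatenoidProfile a f) {u : (Fin 2 → ℝ) → ℝ}
    (hu : ContDiff ℝ ∞ u) : Continuous (jacobiOp (revolutionSurface f) u) := by
  have e : jacobiOp (revolutionSurface f) u = fun p => a / f (p 0) ^ 2 * (
      -(partialD 0 (fun q => Catenoid.radial a f (q 0) * partialD 0 u q + a / 2 * partialD 1 u q) p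
        + partialD 1 (fun q => a / 2 * partialD 0 u q +
          Catenoid.angular a f (q 0) * partialD 1 u q) p)
      - Catenoid.weight a f (p 0) * Catenoid.potential a f (p 0) * u p) := by
    funext p
    have ha := h.a_pos
    have hf := h.pos (p 0)
    rw [← h.jacobiOp_eq]
    field_simp
  have h1 := (contDiff_partialD (h.contDiff_flux hu).1 0).continuous
  have h2 := (contDiff_partialD (h.contDiff_flux hu).2 1).continuous
  have h3 := h.contDiff_weight.continuous
  have h4 := h.contDiff_potential.continuous
  have h5 := hu.continuous
  have h6 := h.contDiff.continuous
  have h7 : ∀ p : Fin 2 → ℝ, f (p 0) ^ 2 ≠ 0 := fun p => by have := h.pos (p 0); positivity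
  rw [e]
  fun_prop (disch := assumption)

/-- Green's formula: for periodic functions, `J` is represented by the form `bilin`, if the boundary
terms at `|t| = T` vanish. -/
theorem integral_mul_jacobiOp (h : IsCatenoidProfile a f) {T : ℝ} (hT : 0 ≤ T)
    {u v : (Fin 2 → ℝ) → ℝ} (hu : ContDiff ℝ ∞ u) (hv : ContDiff ℝ ∞ v) (hup : IsPeriodic u)
    (hvp : IsPeriodic v)
    (h0 : ∀ p : Fin 2 → ℝ, |p 0| = T → v p = 0 ∨ (partialD 0 u p = 0 ∧ partialD 1 u p = 0)) :
    ∫ p in strip T, v p * (f (p 0) ^ 2 / a * jacobiOp (revolutionSurface f) u p) =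
      ∫ p in strip T, Catenoid.bilin a f u v p := by
  obtain ⟨hX, hY⟩ := h.contDiff_flux hu
  set X : (Fin 2 → ℝ) → ℝ := fun q =>
    Catenoid.radial a f (q 0) * partialD 0 u q + a / 2 * partialD 1 u q with hXdef
  set Y : (Fin 2 → ℝ) → ℝ := fun q =>
    a / 2 * partialD 0 u q + Catenoid.angular a f (q 0) * partialD 1 u q with hYdef
  have hvX : ContDiff ℝ ∞ fun q => v q * X q := hv.mul hX
  have hvY : ContDiff ℝ ∞ fun q => v q * Y q := hv.mul hY
  have e : ∀ p, v p * (f (p 0) ^ 2 / a * jacobiOp (revolutionSurface f) u p) =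
      Catenoid.bilin a f u v p - partialD 0 (fun q => v q * X q) p
        - partialD 1 (fun q => v q * Y q) p := by
    intro p
    have hd : ∀ {w : (Fin 2 → ℝ) → ℝ}, ContDiff ℝ ∞ w → DifferentiableAt ℝ w p :=
      fun hw => hw.differentiable (by simp) p
    rw [h.jacobiOp_eq, partialD_mul 0 (hd hv) (hd hX), partialD_mul 1 (hd hv) (hd hY),
      Catenoid.bilin, ← hXdef, ← hYdef]
    simp only [hXdef, hYdef]
    ring
  have i1 : IntegrableOn (Catenoid.bilin a f u v) (strip T) :=
    integrableOn_strip (h.continuous_bilin hu hv)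
  have i2 : IntegrableOn (partialD 0 (fun q => v q * X q)) (strip T) :=
    integrableOn_strip (contDiff_partialD hvX 0).continuous
  have i3 : IntegrableOn (partialD 1 (fun q => v q * Y q)) (strip T) :=
    integrableOn_strip (contDiff_partialD hvY 1).continuous
  have z : ∀ p : Fin 2 → ℝ, |p 0| = T → v p * X p = 0 := by
    intro p hp
    rcases h0 p hp with h0 | ⟨h0, h1⟩
    · simp [h0]
    · simp [hXdef, h0, h1]
  simp only [e]
  have i12 : IntegrableOn (fun p => Catenoid.bilin a f u v p -
      partialD 0 (fun q => v q * X q) p) (strip T) := i1.sub i2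
  rw [integral_sub i12 i3, integral_sub i1 i2, setIntegral_partialD_zero hT hvX
    (fun θ => z _ (by simp [abs_of_nonneg hT])) (fun θ => z _ (by simp [abs_of_nonneg hT])),
    setIntegral_partialD_one hT hvY]
  · ring
  · intro t θ
    simp only [hYdef]
    rw [hvp, hup.partialD (hu.differentiable (by simp)) 0,
      hup.partialD (hu.differentiable (by simp)) 1]
    simp

end IsCatenoidProfile

/-! ### The mode inequality -/

namespace IsCatenoidProfile

variable {a : ℝ} {f : ℝ → ℝ}

theorem radial_pos (h : IsCatenoidProfile a f) (t : ℝ) : 0 < Catenoid.radial a f t := by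
  have := h.a_pos
  unfold Catenoid.radial; positivity

theorem weight_pos (h : IsCatenoidProfile a f) (t : ℝ) : 0 < Catenoid.weight a f t := by
  have := h.a_pos
  unfold Catenoid.weight; positivity

/-- The logarithmic derivative `w = √g gᵗᵗ y'/y` of the Jacobi function `y = f'/f` of the vertical
translations solves the Riccati equation of the rotationally invariant Jacobi fields. -/
theorem hasDerivAt_riccati (h : IsCatenoidProfile a f) {t : ℝ} (ht : deriv f t ≠ 0) :
    HasDerivAt (fun t => (2 * a ^ 2 * f t ^ 2 + 4 * a ^ 2 - f t ^ 4) / (a * f t * (f t ^ 2 + 4))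
      / deriv f t)
      (-((2 * a ^ 2 * f t ^ 2 + 4 * a ^ 2 - f t ^ 4) / (a * f t * (f t ^ 2 + 4))
      / deriv f t) ^ 2 / Catenoid.radial a f t -
        Catenoid.weight a f t * Catenoid.potential a f t) t := by
  have ha := h.a_pos
  have hf := h.pos t
  have hd := h.hasDerivAt t
  have hd2 := h.hasDerivAt_deriv t
  have hsq := h.sq_deriv t
  have hE : a * f t * (f t ^ 2 + 4) ≠ 0 := by positivity
  have := (((((hd.pow 2).const_mul (2 * a ^ 2)).add_const (4 * a ^ 2)).sub (hd.pow 4)).div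
    ((hd.const_mul a).mul ((hd.pow 2).add_const 4)) hE).div hd2 ht
  refine this.congr_deriv ?_
  have hen := h.energy t
  have h4 : f t ^ 2 - a ^ 2 ≠ 0 := by
    intro h0; rw [h0, mul_zero] at hen
    have : deriv f t ^ 2 = 0 := by
      rcases mul_eq_zero.1 hen with h1 | h1
      · exact absurd h1 (by positivity)
      · exact h1
    exact ht (by simpa using this)
  simp only [Catenoid.radial, Catenoid.weight, Catenoid.potential, Pi.pow_apply, Pi.mul_apply,
    Pi.sub_apply, Pi.div_apply]
  generalize deriv f t = p at *
  generalize f t = y at *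
  have e1 : ∀ q : ℝ, q = 4 * (y ^ 2 - a ^ 2) / (a ^ 2 * (y ^ 2 + 4)) →
      (4 * a ^ 2 * y - 4 * y ^ 3) / (a * y * (y ^ 2 + 4)) -
      (2 * a ^ 2 * y ^ 2 + 4 * a ^ 2 - y ^ 4) * (3 * y ^ 2 + 4) / (a * (y * (y ^ 2 + 4)) ^ 2) -
      (2 * a ^ 2 * y ^ 2 + 4 * a ^ 2 - y ^ 4) * (4 * (1 + q)) / (a * (y * (y ^ 2 + 4)) ^ 2 * q) =
      -(((2 * a ^ 2 * y ^ 2 + 4 * a ^ 2 - y ^ 4) / (a * y * (y ^ 2 + 4))) ^ 2 / q) /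
        (a * (y ^ 2 + 4) / 4) - 4 / (a * (y ^ 2 + 4)) *
        (a ^ 2 + 2 - 8 * (y ^ 2 - a ^ 2) / (y ^ 2 * (y ^ 2 + 4))) := by
    rintro q rfl
    field_simp
    ring
  rw [div_pow _ p, ← e1 _ hsq]
  field_simp
  ring

/-- A rotationally symmetric function which vanishes at the neck and at `t = ±T` has nonnegative
index form. The boundary term `w v²` at the neck vanishes although `w` has a pole there. -/
theorem mode_nonneg (h : IsCatenoidProfile a f) {T : ℝ} (hT : 0 ≤ T) {v v' : ℝ → ℝ}
    (hv : ∀ t, HasDerivAt v (v' t) t) (hv' : Continuous v') (h0 : v 0 = 0) (h1 : v T = 0)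
    (h2 : v (-T) = 0) :
    0 ≤ ∫ t in (-T)..T, (Catenoid.radial a f t * v' t ^ 2 -
      Catenoid.weight a f t * Catenoid.potential a f t * v t ^ 2) := by
  set φ : ℝ → ℝ := fun t => Catenoid.radial a f t * v' t ^ 2 -
      Catenoid.weight a f t * Catenoid.potential a f t * v t ^ 2 with hφ
  have hvc : Continuous v := continuous_iff_continuousAt.2 fun t => (hv t).continuousAt
  have hφc : Continuous φ := by
    have h1 := h.contDiff_radial.continuous
    have h3 := h.contDiff_weight.continuous
    have h4 := h.contDiff_potential.continuous
    fun_prop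
  set n : ℝ → ℝ := fun t => (2 * a ^ 2 * f t ^ 2 + 4 * a ^ 2 - f t ^ 4) /
    (a * f t * (f t ^ 2 + 4)) with hn
  have hnc : Continuous n := by
    have h6 := h.contDiff.continuous
    have ha := h.a_pos
    have : ∀ t, a * f t * (f t ^ 2 + 4) ≠ 0 := fun t => by have := h.pos t; positivity
    fun_prop (disch := assumption)
  set H : ℝ → ℝ := fun t => n t * (v t ^ 2 / deriv f t) with hH
  have hne : ∀ t, t ≠ 0 → deriv f t ≠ 0 := fun t ht => by
    rcases lt_or_gt_of_ne ht with ht | ht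
    · exact (h.deriv_neg ht).ne
    · exact (h.deriv_pos ht).ne'
  have hquot : Continuous fun t => v t ^ 2 / deriv f t := by
    refine continuous_iff_continuousAt.2 fun t => ?_
    by_cases ht : t = 0
    · subst ht
      rw [continuousAt_iff_punctured_nhds]
      have l1 := (hasDerivAt_iff_tendsto_slope_zero.1 (hv 0))
      have l2 := (hasDerivAt_iff_tendsto_slope_zero.1 (h.hasDerivAt_deriv 0))
      have l3 : Tendsto v (𝓝[≠] 0) (𝓝 0) := by
        have := (hvc.tendsto 0).mono_left (nhdsWithin_le_nhds (s := {0}ᶜ))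
        rwa [h0] at this
      have hpos : 4 * (1 + deriv f 0 ^ 2) / (f 0 * (f 0 ^ 2 + 4)) ≠ 0 := by
        have := h.pos 0; positivity
      have l4 := l3.mul (l1.div l2 hpos)
      rw [zero_mul] at l4
      simp only [h.init', div_zero]
      refine l4.congr' ?_
      filter_upwards [self_mem_nhdsWithin] with t ht
      have ht : t ≠ 0 := ht
      have := hne t ht
      simp only [zero_add, h0, h.init', sub_zero, smul_eq_mul, Pi.div_apply]
      field_simp
    · exact (hvc.continuousAt.pow 2).div
        (h.contDiff_deriv.continuous.continuousAt) (hne t ht)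
  have hHc : Continuous H := hnc.mul hquot
  have hder : ∀ t, t ≠ 0 → ∃ d, HasDerivAt H d t ∧ d ≤ φ t := by
    intro t ht
    have d1 := (h.hasDerivAt_riccati (hne t ht)).mul ((hv t).pow 2)
    refine ⟨_, (d1.congr_of_eventuallyEq (Eventually.of_forall fun s => ?_)), ?_⟩
    · simp only [hH, hn, Pi.mul_apply, Pi.pow_apply]; ring
    · have hr := h.radial_pos t
      simp only [hφ, Pi.pow_apply]
      generalize (2 * a ^ 2 * f t ^ 2 + 4 * a ^ 2 - f t ^ 4) / (a * f t * (f t ^ 2 + 4))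
        / deriv f t = w
      have : 0 ≤ (Catenoid.radial a f t * v' t - w * v t) ^ 2 / Catenoid.radial a f t := by
        positivity
      have e : (Catenoid.radial a f t * v' t - w * v t) ^ 2 / Catenoid.radial a f t =
        Catenoid.radial a f t * v' t ^ 2 - 2 * w * v t * v' t
          + w ^ 2 / Catenoid.radial a f t * v t ^ 2 := by
        field_simp; ring
      rw [e] at this
      norm_num
      linear_combination this
  choose! d hd hdle using hder
  have hH0 : H 0 = 0 := by simp [hH, h0]
  have hint : ∀ a b : ℝ, IntegrableOn φ (Icc a b) := fun a b =>
    hφc.continuousOn.integrableOn_compact isCompact_Icc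
  have I1 := intervalIntegral.sub_le_integral_of_hasDeriv_right_of_le (g := H) (g' := d) hT
    hHc.continuousOn (fun x hx => (hd x hx.1.ne').hasDerivWithinAt) (hint _ _)
    (fun x hx => hdle x hx.1.ne')
  have I2 := intervalIntegral.sub_le_integral_of_hasDeriv_right_of_le (g := H) (g' := d)
    (neg_nonpos.2 hT) hHc.continuousOn (fun x hx => (hd x hx.2.ne).hasDerivWithinAt) (hint _ _)
    (fun x hx => hdle x hx.2.ne)
  rw [← intervalIntegral.integral_add_adjacent_intervals (hφc.intervalIntegrable (-T) 0)
    (hφc.intervalIntegrable 0 T)]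
  have e1 : H T = 0 := by simp [hH, h1]
  have e2 : H (-T) = 0 := by simp [hH, h2]
  linarith

/-- `P ≤ a² + 2`, which bounds the number of unstable Fourier modes from above. -/
theorem potential_le (h : IsCatenoidProfile a f) (t : ℝ) :
    Catenoid.potential a f t ≤ a ^ 2 + 2 := by
  have h1 := h.le_apply t
  have h2 := h.a_pos
  have : 0 ≤ 8 * (f t ^ 2 - a ^ 2) / (f t ^ 2 * (f t ^ 2 + 4)) :=
    div_nonneg (by nlinarith) (by positivity)
  unfold Catenoid.potential; linarith

/-- `a² ≤ P`, which bounds the number of unstable Fourier modes from below. -/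
theorem le_potential (h : IsCatenoidProfile a f) (t : ℝ) :
    a ^ 2 ≤ Catenoid.potential a f t := by
  have h1 := h.pos t
  have : 8 * (f t ^ 2 - a ^ 2) / (f t ^ 2 * (f t ^ 2 + 4)) ≤ 2 := by
    rw [div_le_iff₀ (by positivity)]
    nlinarith [sq_nonneg a, sq_nonneg (f t ^ 2)]
  unfold Catenoid.potential; linarith

end IsCatenoidProfile

/-! ### Fourier coefficients -/

/-- The squared modulus of the `k`-th Fourier coefficient, for the origin `c` of the angle. -/
def modeSq (c : ℝ) (k : ℤ) (g : ℝ → ℝ) : ℝ :=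
  (∫ θ in (0 : ℝ)..(2 * Real.pi), g θ * Real.cos (k * (θ - c))) ^ 2 +
  (∫ θ in (0 : ℝ)..(2 * Real.pi), g θ * Real.sin (k * (θ - c))) ^ 2

theorem modeSq_nonneg (c : ℝ) (k : ℤ) (g : ℝ → ℝ) : 0 ≤ modeSq c k g := by
  unfold modeSq; positivity

theorem modeSq_eq_norm (c : ℝ) (k : ℤ) {g : ℝ → ℝ} (hg : Continuous g) :
    modeSq c k g = ‖∫ θ in (0 : ℝ)..(2 * Real.pi),
      Complex.exp (-(k * (θ - c) * Complex.I)) * (g θ : ℂ)‖ ^ 2 := by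
  have e : ∀ θ : ℝ, Complex.exp (-(k * (θ - c) * Complex.I)) * (g θ : ℂ) =
      ((g θ * Real.cos (k * (θ - c)) : ℝ) : ℂ) -
        ((g θ * Real.sin (k * (θ - c)) : ℝ) : ℂ) * Complex.I := by
    intro θ
    rw [← neg_mul, Complex.exp_mul_I, Complex.cos_neg, Complex.sin_neg]
    push_cast
    ring
  simp only [e]
  rw [intervalIntegral.integral_sub
    (Continuous.intervalIntegrable (by fun_prop) _ _)
    (Continuous.intervalIntegrable (by fun_prop) _ _),
    intervalIntegral.integral_mul_const, intervalIntegral.integral_ofReal,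
    intervalIntegral.integral_ofReal, ← Complex.normSq_eq_norm_sq, Complex.normSq_apply]
  simp only [modeSq, Complex.sub_re, Complex.ofReal_re, Complex.mul_re, Complex.I_re, mul_zero,
    Complex.ofReal_im, Complex.I_im, mul_one, sub_self, sub_zero, Complex.sub_im, Complex.mul_im,
    add_zero, zero_sub]
  ring

theorem hasSum_modeSq (c : ℝ) {g : ℝ → ℝ} (hg : Continuous g) :
    HasSum (fun k => modeSq c k g) (2 * Real.pi * ∫ θ in (0 : ℝ)..(2 * Real.pi), g θ ^ 2) := by
  have hpi := Real.two_pi_pos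
  have hL2 : MemLp (fun θ => (g θ : ℂ)) 2 (volume.restrict (Ioc 0 (2 * Real.pi))) := by
    have hc : Continuous fun θ => (g θ : ℂ) := by fun_prop
    rw [memLp_two_iff_integrable_sq_norm hc.aestronglyMeasurable]
    exact ((hc.norm.pow 2).continuousOn.integrableOn_compact isCompact_Icc).mono_set
      Ioc_subset_Icc_self
  have hs := hasSum_sq_fourierCoeffOn hpi hL2
  have hs2 := hs.mul_left ((2 * Real.pi) ^ 2)
  have hval : (2 * Real.pi) ^ 2 * ((2 * Real.pi - 0)⁻¹ • ∫ x in (0 : ℝ)..(2 * Real.pi),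
      ‖(g x : ℂ)‖ ^ 2) = 2 * Real.pi * ∫ θ in (0 : ℝ)..(2 * Real.pi), g θ ^ 2 := by
    simp only [Complex.norm_real, Real.norm_eq_abs, sq_abs, sub_zero, smul_eq_mul]
    field_simp
  rw [hval] at hs2
  suffices key : ∀ k, modeSq c k g =
      (2 * Real.pi) ^ 2 * ‖fourierCoeffOn hpi (fun θ => (g θ : ℂ)) k‖ ^ 2 by
    simpa only [key] using hs2
  intro k
  rw [modeSq_eq_norm c k hg, fourierCoeffOn_eq_integral, norm_smul]
  have hcoef : (2 * Real.pi) ^ 2 * (‖1 / (2 * Real.pi - 0)‖ ^ 2) = 1 := by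
    rw [sub_zero, Real.norm_of_nonneg (by positivity)]; field_simp
  rw [mul_pow ‖1 / (2 * Real.pi - 0)‖, ← mul_assoc, hcoef, one_mul]
  have e : ∀ θ : ℝ, Complex.exp (-(k * (θ - c) * Complex.I)) * (g θ : ℂ) =
      Complex.exp (((k * c : ℝ) : ℂ) * Complex.I) *
        (fourier (-k) (θ : AddCircle (2 * Real.pi - 0)) • (g θ : ℂ)) := by
    intro θ
    rw [fourier_coe_apply, smul_eq_mul, ← mul_assoc, ← Complex.exp_add]
    congr 2
    have : (Real.pi : ℂ) ≠ 0 := by exact_mod_cast Real.pi_ne_zero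
    push_cast
    field_simp
    ring
  simp only [e]
  rw [intervalIntegral.integral_const_mul, norm_mul, Complex.norm_exp_ofReal_mul_I, one_mul]

/-- Bessel's inequality. -/
theorem sum_modeSq_le (c : ℝ) {g : ℝ → ℝ} (hg : Continuous g) (s : Finset ℤ) :
    ∑ k ∈ s, modeSq c k g ≤ 2 * Real.pi * ∫ θ in (0 : ℝ)..(2 * Real.pi), g θ ^ 2 :=
  sum_le_hasSum s (fun _ _ => modeSq_nonneg _ _ _) (hasSum_modeSq c hg)

theorem integral_deriv_mul_of_periodic {g g' v v' : ℝ → ℝ} (hg : ∀ θ, HasDerivAt g (g' θ) θ)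
    (hv : ∀ θ, HasDerivAt v (v' θ) θ) (hg' : Continuous g') (hv' : Continuous v')
    (hgp : g (2 * Real.pi) = g 0) (hvp : v (2 * Real.pi) = v 0) :
    ∫ θ in (0 : ℝ)..(2 * Real.pi), g' θ * v θ = -∫ θ in (0 : ℝ)..(2 * Real.pi), g θ * v' θ := by
  rw [intervalIntegral.integral_mul_deriv_eq_deriv_mul (fun θ _ => hg θ) (fun θ _ => hv θ)
    (hg'.intervalIntegrable _ _) (hv'.intervalIntegrable _ _), hgp, hvp]
  ring

theorem integral_deriv_mul_cos (c : ℝ) (k : ℤ) {g g' : ℝ → ℝ}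
    (hd : ∀ θ, HasDerivAt g (g' θ) θ) (hg' : Continuous g') (hper : g (2 * Real.pi) = g 0) :
    ∫ θ in (0 : ℝ)..(2 * Real.pi), g' θ * Real.cos (k * (θ - c)) =
      k * ∫ θ in (0 : ℝ)..(2 * Real.pi), g θ * Real.sin (k * (θ - c)) := by
  have hc : ∀ θ : ℝ, HasDerivAt (fun θ => Real.cos (k * (θ - c)))
      (-(k * Real.sin (k * (θ - c)))) θ := fun θ =>
    (((hasDerivAt_id' θ).sub_const c).const_mul (k : ℝ)).cos.congr_deriv (by ring)
  rw [integral_deriv_mul_of_periodic hd hc hg' (by fun_prop) hper, ← intervalIntegral.integral_neg,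
    ← intervalIntegral.integral_const_mul]
  · congr 1; funext θ; ring
  · rw [show (k : ℝ) * (2 * Real.pi - c) = k * (0 - c) + k * (2 * Real.pi) by ring,
      Real.cos_add_int_mul_two_pi]

theorem integral_deriv_mul_sin (c : ℝ) (k : ℤ) {g g' : ℝ → ℝ}
    (hd : ∀ θ, HasDerivAt g (g' θ) θ) (hg' : Continuous g') (hper : g (2 * Real.pi) = g 0) :
    ∫ θ in (0 : ℝ)..(2 * Real.pi), g' θ * Real.sin (k * (θ - c)) =
      -(k * ∫ θ in (0 : ℝ)..(2 * Real.pi), g θ * Real.cos (k * (θ - c))) := by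
  have hc : ∀ θ : ℝ, HasDerivAt (fun θ => Real.sin (k * (θ - c)))
      (k * Real.cos (k * (θ - c))) θ := fun θ =>
    (((hasDerivAt_id' θ).sub_const c).const_mul (k : ℝ)).sin.congr_deriv (by ring)
  rw [integral_deriv_mul_of_periodic hd hc hg' (by fun_prop) hper,
    ← intervalIntegral.integral_const_mul]
  · congr 2; funext θ; ring
  · rw [show (k : ℝ) * (2 * Real.pi - c) = k * (0 - c) + k * (2 * Real.pi) by ring,
      Real.sin_add_int_mul_two_pi]

/-- The part of `∫ g'² - P g²` carried by the modes `|k| ≤ m` is a lower bound if the other modes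
are stable. -/
theorem sum_modeSq_le_of_le (c : ℝ) {g g' : ℝ → ℝ} (hd : ∀ θ, HasDerivAt g (g' θ) θ)
    (hg' : Continuous g') (hper : g (2 * Real.pi) = g 0) {P : ℝ} {m : ℕ}
    (hP : P ≤ ((m : ℝ) + 1) ^ 2) :
    ∑ k ∈ Finset.Icc (-(m : ℤ)) m, ((k : ℝ) ^ 2 - P) * modeSq c k g ≤
      2 * Real.pi * ∫ θ in (0 : ℝ)..(2 * Real.pi), (g' θ ^ 2 - P * g θ ^ 2) := by
  have hg : Continuous g := continuous_iff_continuousAt.2 fun θ => (hd θ).continuousAt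
  have hk : ∀ k : ℤ, modeSq c k g' = (k : ℝ) ^ 2 * modeSq c k g := by
    intro k
    rw [modeSq, integral_deriv_mul_cos c k hd hg' hper, integral_deriv_mul_sin c k hd hg' hper,
      modeSq]
    ring
  have hs := (hasSum_modeSq c hg').sub ((hasSum_modeSq c hg).mul_left P)
  have hval : 2 * Real.pi * (∫ θ in (0 : ℝ)..(2 * Real.pi), g' θ ^ 2) -
      P * (2 * Real.pi * ∫ θ in (0 : ℝ)..(2 * Real.pi), g θ ^ 2) =
      2 * Real.pi * ∫ θ in (0 : ℝ)..(2 * Real.pi), (g' θ ^ 2 - P * g θ ^ 2) := by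
    rw [intervalIntegral.integral_sub
      (Continuous.intervalIntegrable (by fun_prop) _ _)
      (Continuous.intervalIntegrable (by fun_prop) _ _),
      intervalIntegral.integral_const_mul]
    ring
  rw [hval] at hs
  simp only [hk, ← sub_mul] at hs
  refine sum_le_hasSum _ (fun k hk => mul_nonneg ?_ (modeSq_nonneg _ _ _)) hs
  have hkm : (m : ℤ) + 1 ≤ |k| := by
    by_contra hlt
    have := abs_le.1 (show |k| ≤ (m : ℤ) by omega)
    exact hk (Finset.mem_Icc.2 this)
  have h1 : ((m : ℝ) + 1) ≤ |(k : ℝ)| := by exact_mod_cast hkm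
  have h2 : ((m : ℝ) + 1) ^ 2 ≤ (k : ℝ) ^ 2 := by
    rw [← sq_abs (k : ℝ)]; gcongr
  linarith

theorem hasDerivAt_integral_vec {u : (Fin 2 → ℝ) → ℝ} (hu : ContDiff ℝ ∞ u) (t : ℝ) :
    HasDerivAt (fun t => ∫ θ in (0 : ℝ)..(2 * Real.pi), u ![t, θ])
      (∫ θ in (0 : ℝ)..(2 * Real.pi), partialD 0 u ![t, θ]) t := by
  have hc : Continuous fun q : ℝ × ℝ => partialD 0 u ![q.1, q.2] :=
    (contDiff_partialD hu 0).continuous.comp continuous_vec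
  obtain ⟨C, hC⟩ := ((isCompact_closedBall t 1).prod (isCompact_Icc (a := 0)
    (b := 2 * Real.pi))).exists_bound_of_continuousOn hc.continuousOn
  have hslice : ∀ s : ℝ, Continuous fun θ : ℝ => (![s, θ] : Fin 2 → ℝ) := fun s =>
    continuous_vec.comp (continuous_const.prodMk continuous_id)
  refine (intervalIntegral.hasDerivAt_integral_of_dominated_loc_of_deriv_le
    (F := fun t θ => u ![t, θ]) (F' := fun t θ => partialD 0 u ![t, θ]) (bound := fun _ => C)
    (Metric.closedBall_mem_nhds t one_pos)
    (Eventually.of_forall fun s => (hu.continuous.comp (hslice s)).aestronglyMeasurable)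
    ((hu.continuous.comp (hslice t)).intervalIntegrable _ _)
    (((contDiff_partialD hu 0).continuous.comp (hslice t)).aestronglyMeasurable)
    (Eventually.of_forall fun θ hθ s hs => ?_) intervalIntegrable_const
    (Eventually.of_forall fun θ _ s _ => hasDerivAt_vec_zero (hu.differentiable (by simp) _))).2
  rw [uIoc_of_le Real.two_pi_pos.le] at hθ
  exact hC (s, θ) ⟨hs, Ioc_subset_Icc_self hθ⟩

theorem continuous_integral_vec {u : (Fin 2 → ℝ) → ℝ} (hu : Continuous u) :
    Continuous fun t => ∫ θ in (0 : ℝ)..(2 * Real.pi), u ![t, θ] :=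
  intervalIntegral.continuous_parametric_intervalIntegral_of_continuous'
    (f := fun t θ => u ![t, θ]) (hu.comp continuous_vec) _ _

/-! ### Stability of the functions with vanishing low modes at the neck -/

/-- The angle `χ(t)` through which the orthogonal trajectories of the parallels turn between the neck
and the parallel at height `t`: these trajectories are the curves `θ - χ(t) = const`. -/
def phase (f : ℝ → ℝ) (t : ℝ) : ℝ := ∫ s in (0 : ℝ)..t, 2 / (f s ^ 2 + 4)

@[simp] theorem phase_zero (f : ℝ → ℝ) : phase f 0 = 0 := by simp [phase]

namespace IsCatenoidProfile

variable {a : ℝ} {f : ℝ → ℝ}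

theorem contDiff_twist (h : IsCatenoidProfile a f) : ContDiff ℝ ∞ fun s => 2 / (f s ^ 2 + 4) := by
  have := h.contDiff
  have : ∀ t, f t ^ 2 + 4 ≠ 0 := fun t => by positivity
  fun_prop (disch := assumption)

theorem hasDerivAt_phase (h : IsCatenoidProfile a f) (t : ℝ) :
    HasDerivAt (phase f) (2 / (f t ^ 2 + 4)) t := by
  have hc := h.contDiff_twist.continuous
  exact intervalIntegral.integral_hasDerivAt_right (hc.intervalIntegrable _ _)
    (hc.stronglyMeasurableAtFilter _ _) hc.continuousAt

theorem contDiff_phase (h : IsCatenoidProfile a f) : ContDiff ℝ ∞ (phase f) := by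
  rw [contDiff_infty_iff_deriv]
  refine ⟨fun t => (h.hasDerivAt_phase t).differentiableAt, ?_⟩
  rw [funext fun t => (h.hasDerivAt_phase t).deriv]
  exact h.contDiff_twist

/-- The index form in the orthogonal coordinates `(t, θ - χ(t))`. -/
theorem bilin_self (h : IsCatenoidProfile a f) (u : (Fin 2 → ℝ) → ℝ) (p : Fin 2 → ℝ) :
    Catenoid.bilin a f u u p =
      Catenoid.radial a f (p 0) * (partialD 0 u p + 2 / (f (p 0) ^ 2 + 4) * partialD 1 u p) ^ 2 +
      Catenoid.weight a f (p 0) *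
        (partialD 1 u p ^ 2 - Catenoid.potential a f (p 0) * u p ^ 2) := by
  have ha := h.a_pos
  simp only [Catenoid.bilin, Catenoid.radial, Catenoid.angular, Catenoid.weight]
  field_simp
  ring

/-- In a frame rotating with `χ`, the Fourier coefficients of `u` are differentiated along the
orthogonal trajectories of the parallels. -/
theorem hasDerivAt_modes (h : IsCatenoidProfile a f) {u : (Fin 2 → ℝ) → ℝ} (hu : ContDiff ℝ ∞ u)
    (hup : IsPeriodic u) (k : ℤ) (t : ℝ) :
    HasDerivAt (fun t => ∫ θ in (0 : ℝ)..(2 * Real.pi), u ![t, θ] * Real.cos (k * (θ - phase f t)))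
      (∫ θ in (0 : ℝ)..(2 * Real.pi), (partialD 0 u ![t, θ] + 2 / (f t ^ 2 + 4) *
        partialD 1 u ![t, θ]) * Real.cos (k * (θ - phase f t))) t ∧
    HasDerivAt (fun t => ∫ θ in (0 : ℝ)..(2 * Real.pi), u ![t, θ] * Real.sin (k * (θ - phase f t)))
      (∫ θ in (0 : ℝ)..(2 * Real.pi), (partialD 0 u ![t, θ] + 2 / (f t ^ 2 + 4) *
        partialD 1 u ![t, θ]) * Real.sin (k * (θ - phase f t))) t := by
  have hph := h.contDiff_phase
  have hslice : Continuous fun θ : ℝ => (![t, θ] : Fin 2 → ℝ) :=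
    continuous_vec.comp (continuous_const.prodMk continuous_id)
  have hc0 := (contDiff_partialD hu 0).continuous.comp hslice
  have hc1 := (contDiff_partialD hu 1).continuous.comp hslice
  have hcu := hu.continuous.comp hslice
  simp only [Function.comp_def] at hc0 hc1 hcu
  have hper : u ![t, 2 * Real.pi] = u ![t, 0] := by have := hup t 0; rwa [zero_add] at this
  have hdθ : ∀ θ, HasDerivAt (fun θ => u ![t, θ]) (partialD 1 u ![t, θ]) θ := fun θ =>
    hasDerivAt_vec_one (hu.differentiable (by simp) _)
  have hdt : ∀ θ, HasDerivAt (fun t => u ![t, θ]) (partialD 0 u ![t, θ]) t := fun θ =>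
    hasDerivAt_vec_zero (hu.differentiable (by simp) _)
  have hang : ∀ θ, HasDerivAt (fun t => k * (θ - phase f t)) (-(k * (2 / (f t ^ 2 + 4)))) t :=
    fun θ => (((h.hasDerivAt_phase t).const_sub θ).const_mul (k : ℝ)).congr_deriv (by ring)
  constructor
  · have hs : ContDiff ℝ ∞ fun p : Fin 2 → ℝ => u p * Real.cos (k * (p 1 - phase f (p 0))) := by
      have : ContDiff ℝ ∞ Real.cos := Real.contDiff_cos
      fun_prop
    have hp : ∀ θ : ℝ, partialD 0 (fun p : Fin 2 → ℝ => u p *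
        Real.cos (k * (p 1 - phase f (p 0)))) ![t, θ] = partialD 0 u ![t, θ] *
        Real.cos (k * (θ - phase f t)) + 2 / (f t ^ 2 + 4) *
          (k * (u ![t, θ] * Real.sin (k * (θ - phase f t)))) := fun θ => by
      refine (hasDerivAt_vec_zero (hs.differentiable (by simp) _)).unique ?_
      exact ((hdt θ).mul (hang θ).cos).congr_deriv (by ring)
    refine (hasDerivAt_integral_vec hs t).congr_deriv ?_
    simp only [hp, add_mul, mul_assoc]
    rw [intervalIntegral.integral_add (Continuous.intervalIntegrable (by fun_prop) _ _)
      (Continuous.intervalIntegrable (by fun_prop) _ _), intervalIntegral.integral_add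
      (Continuous.intervalIntegrable (by fun_prop) _ _)
      (Continuous.intervalIntegrable (by fun_prop) _ _), intervalIntegral.integral_const_mul,
      intervalIntegral.integral_const_mul, intervalIntegral.integral_const_mul,
      integral_deriv_mul_cos (phase f t) k hdθ hc1 hper]
  · have hs : ContDiff ℝ ∞ fun p : Fin 2 → ℝ => u p * Real.sin (k * (p 1 - phase f (p 0))) := by
      have : ContDiff ℝ ∞ Real.sin := Real.contDiff_sin
      fun_prop
    have hp : ∀ θ : ℝ, partialD 0 (fun p : Fin 2 → ℝ => u p *
        Real.sin (k * (p 1 - phase f (p 0)))) ![t, θ] = partialD 0 u ![t, θ] *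
        Real.sin (k * (θ - phase f t)) + 2 / (f t ^ 2 + 4) *
          (-k * (u ![t, θ] * Real.cos (k * (θ - phase f t)))) := fun θ => by
      refine (hasDerivAt_vec_zero (hs.differentiable (by simp) _)).unique ?_
      exact ((hdt θ).mul (hang θ).sin).congr_deriv (by ring)
    refine (hasDerivAt_integral_vec hs t).congr_deriv ?_
    simp only [hp, add_mul, mul_assoc]
    rw [intervalIntegral.integral_add (Continuous.intervalIntegrable (by fun_prop) _ _)
      (Continuous.intervalIntegrable (by fun_prop) _ _), intervalIntegral.integral_add
      (Continuous.intervalIntegrable (by fun_prop) _ _)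
      (Continuous.intervalIntegrable (by fun_prop) _ _), intervalIntegral.integral_const_mul,
      intervalIntegral.integral_const_mul, intervalIntegral.integral_const_mul,
      integral_deriv_mul_sin (phase f t) k hdθ hc1 hper]
    ring

/-- The index form is nonnegative on the functions whose Fourier modes `|k| ≤ m` vanish at the
neck, if `a² + 2 ≤ (m + 1)²`. -/
theorem integral_bilin_self_nonneg (h : IsCatenoidProfile a f) {T : ℝ} (hT : 0 ≤ T) {m : ℕ}
    (hm : a ^ 2 + 2 ≤ ((m : ℝ) + 1) ^ 2) {u : (Fin 2 → ℝ) → ℝ} (hu : ContDiff ℝ ∞ u)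
    (hup : IsPeriodic u) (hu0 : ∀ θ, u ![T, θ] = 0 ∧ u ![-T, θ] = 0)
    (hcos : ∀ k : ℕ, k ≤ m → ∫ θ in (0 : ℝ)..(2 * Real.pi), u ![0, θ] * Real.cos (k * θ) = 0)
    (hsin : ∀ k : ℕ, k ≤ m → ∫ θ in (0 : ℝ)..(2 * Real.pi), u ![0, θ] * Real.sin (k * θ) = 0) :
    0 ≤ ∫ p in strip T, Catenoid.bilin a f u u p := by
  set D : (Fin 2 → ℝ) → ℝ := fun p =>
    partialD 0 u p + 2 / (f (p 0) ^ 2 + 4) * partialD 1 u p with hD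
  set A : ℤ → ℝ → ℝ := fun k t =>
    ∫ θ in (0 : ℝ)..(2 * Real.pi), u ![t, θ] * Real.cos (k * (θ - phase f t)) with hA
  set B : ℤ → ℝ → ℝ := fun k t =>
    ∫ θ in (0 : ℝ)..(2 * Real.pi), u ![t, θ] * Real.sin (k * (θ - phase f t)) with hB
  set A' : ℤ → ℝ → ℝ := fun k t =>
    ∫ θ in (0 : ℝ)..(2 * Real.pi), D ![t, θ] * Real.cos (k * (θ - phase f t)) with hA'
  set B' : ℤ → ℝ → ℝ := fun k t =>
    ∫ θ in (0 : ℝ)..(2 * Real.pi), D ![t, θ] * Real.sin (k * (θ - phase f t)) with hB'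
  have hdA : ∀ k t, HasDerivAt (A k) (A' k t) t := fun k t => (h.hasDerivAt_modes hu hup k t).1
  have hdB : ∀ k t, HasDerivAt (B k) (B' k t) t := fun k t => (h.hasDerivAt_modes hu hup k t).2
  have hph := h.contDiff_phase.continuous
  have c0 := (contDiff_partialD hu 0).continuous
  have c1 := (contDiff_partialD hu 1).continuous
  have cf := h.contDiff.continuous
  have cu := hu.continuous
  have cD : Continuous D := by
    have : ∀ p : Fin 2 → ℝ, f (p 0) ^ 2 + 4 ≠ 0 := fun p => by positivity
    fun_prop (disch := assumption)
  have cA : ∀ k, Continuous (A k) := fun k =>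
    continuous_iff_continuousAt.2 fun t => (hdA k t).continuousAt
  have cB : ∀ k, Continuous (B k) := fun k =>
    continuous_iff_continuousAt.2 fun t => (hdB k t).continuousAt
  have cA' : ∀ k, Continuous (A' k) := fun k => continuous_integral_vec
    (u := fun p => D p * Real.cos (k * (p 1 - phase f (p 0)))) (by fun_prop)
  have cB' : ∀ k, Continuous (B' k) := fun k => continuous_integral_vec
    (u := fun p => D p * Real.sin (k * (p 1 - phase f (p 0)))) (by fun_prop)
  have cr := h.contDiff_radial.continuous
  have cw := h.contDiff_weight.continuous
  have cP := h.contDiff_potential.continuous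
  have hA0 : ∀ k ∈ Finset.Icc (-(m : ℤ)) m, A k 0 = 0 ∧ B k 0 = 0 := by
    intro k hk
    rw [Finset.mem_Icc] at hk
    simp only [hA, hB, phase_zero, sub_zero]
    have h1 := hcos k.natAbs (by omega)
    have h2 := hsin k.natAbs (by omega)
    rcases Int.natAbs_eq k with hk | hk
    · rw [hk]; exact ⟨h1, h2⟩
    · rw [hk]
      simp only [Int.cast_neg, Int.cast_natCast, neg_mul, Real.cos_neg, Real.sin_neg, mul_neg,
        intervalIntegral.integral_neg, neg_eq_zero]
      exact ⟨h1, h2⟩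
  have hT0 : ∀ k, (A k T = 0 ∧ A k (-T) = 0) ∧ (B k T = 0 ∧ B k (-T) = 0) := by
    intro k; simp [hA, hB, hu0]
  have hslice : ∀ t : ℝ, Continuous fun θ : ℝ => (![t, θ] : Fin 2 → ℝ) := fun t =>
    continuous_vec.comp (continuous_const.prodMk continuous_id)
  -- Bessel's inequality and the stability of the high modes, on each parallel
  have hpt : ∀ t, ∑ k ∈ Finset.Icc (-(m : ℤ)) m,
      (Catenoid.radial a f t * (A' k t ^ 2 + B' k t ^ 2) + Catenoid.weight a f t *
        (((k : ℝ) ^ 2 - Catenoid.potential a f t) * (A k t ^ 2 + B k t ^ 2))) ≤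
      2 * Real.pi * ∫ θ in (0 : ℝ)..(2 * Real.pi), Catenoid.bilin a f u u ![t, θ] := by
    intro t
    have cDs : Continuous fun θ => D ![t, θ] := cD.comp (hslice t)
    have c1s : Continuous fun θ => partialD 1 u ![t, θ] := c1.comp (hslice t)
    have cus : Continuous fun θ => u ![t, θ] := cu.comp (hslice t)
    have b1 := sum_modeSq_le (phase f t) cDs (Finset.Icc (-(m : ℤ)) m)
    have b2 := sum_modeSq_le_of_le (phase f t) (g := fun θ => u ![t, θ])
      (fun θ => hasDerivAt_vec_one (hu.differentiable (by simp) _)) c1s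
      (by have := hup t 0; rwa [zero_add] at this) ((h.potential_le t).trans hm)
    have e : ∫ θ in (0 : ℝ)..(2 * Real.pi), Catenoid.bilin a f u u ![t, θ] =
        Catenoid.radial a f t * (∫ θ in (0 : ℝ)..(2 * Real.pi), D ![t, θ] ^ 2) +
        Catenoid.weight a f t * ∫ θ in (0 : ℝ)..(2 * Real.pi), (partialD 1 u ![t, θ] ^ 2 -
          Catenoid.potential a f t * u ![t, θ] ^ 2) := by
      rw [← intervalIntegral.integral_const_mul, ← intervalIntegral.integral_const_mul,
        ← intervalIntegral.integral_add (Continuous.intervalIntegrable (by fun_prop) _ _)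
        (Continuous.intervalIntegrable (by fun_prop) _ _)]
      simp only [h.bilin_self, hD, Matrix.cons_val_zero]
    rw [e, Finset.sum_add_distrib, ← Finset.mul_sum, ← Finset.mul_sum]
    have := add_le_add (mul_le_mul_of_nonneg_left b1 (h.radial_pos t).le)
      (mul_le_mul_of_nonneg_left b2 (h.weight_pos t).le)
    refine (this.trans_eq (by ring))
  have hQ : ∀ k ∈ Finset.Icc (-(m : ℤ)) m, 0 ≤ ∫ t in (-T)..T,
      (Catenoid.radial a f t * (A' k t ^ 2 + B' k t ^ 2) + Catenoid.weight a f t *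
        (((k : ℝ) ^ 2 - Catenoid.potential a f t) * (A k t ^ 2 + B k t ^ 2))) := by
    intro k hk
    have q1 := h.mode_nonneg hT (hdA k) (cA' k) (hA0 k hk).1 (hT0 k).1.1 (hT0 k).1.2
    have q2 := h.mode_nonneg hT (hdB k) (cB' k) (hA0 k hk).2 (hT0 k).2.1 (hT0 k).2.2
    have q3 : 0 ≤ ∫ t in (-T)..T, Catenoid.weight a f t * ((k : ℝ) ^ 2 * (A k t ^ 2 + B k t ^ 2)) :=
      intervalIntegral.integral_nonneg (by linarith) fun t _ => by
        have := (h.weight_pos t).le; positivity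
    have cAk := cA k
    have cBk := cB k
    have cAk' := cA' k
    have cBk' := cB' k
    have := add_nonneg (add_nonneg q1 q2) q3
    rw [← intervalIntegral.integral_add (Continuous.intervalIntegrable (by fun_prop) _ _)
        (Continuous.intervalIntegrable (by fun_prop) _ _), ← intervalIntegral.integral_add
        (Continuous.intervalIntegrable (by fun_prop) _ _)
        (Continuous.intervalIntegrable (by fun_prop) _ _)] at this
    refine this.trans_eq ?_
    congr 1
    funext t
    ring
  have hbc := h.continuous_bilin hu hu
  rw [setIntegral_strip hT hbc]
  have hfin : 0 ≤ ∫ t in (-T)..T, 2 * Real.pi *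
      ∫ θ in (0 : ℝ)..(2 * Real.pi), Catenoid.bilin a f u u ![t, θ] := by
    have hcG : ∀ k, Continuous fun t => (Catenoid.radial a f t * (A' k t ^ 2 + B' k t ^ 2) +
        Catenoid.weight a f t *
        (((k : ℝ) ^ 2 - Catenoid.potential a f t) * (A k t ^ 2 + B k t ^ 2))) := fun k => by
      have cAk := cA k
      have cBk := cB k
      have cAk' := cA' k
      have cBk' := cB' k
      fun_prop
    calc 0 ≤ ∑ k ∈ Finset.Icc (-(m : ℤ)) m, ∫ t in (-T)..T, (Catenoid.radial a f t *
          (A' k t ^ 2 + B' k t ^ 2) + Catenoid.weight a f t *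
          (((k : ℝ) ^ 2 - Catenoid.potential a f t) * (A k t ^ 2 + B k t ^ 2))) :=
          Finset.sum_nonneg hQ
      _ = ∫ t in (-T)..T, ∑ k ∈ Finset.Icc (-(m : ℤ)) m, (Catenoid.radial a f t *
          (A' k t ^ 2 + B' k t ^ 2) + Catenoid.weight a f t *
          (((k : ℝ) ^ 2 - Catenoid.potential a f t) * (A k t ^ 2 + B k t ^ 2))) :=
          (intervalIntegral.integral_finsetSum fun k _ => (hcG k).intervalIntegrable _ _).symm
      _ ≤ _ := intervalIntegral.integral_mono_on (by linarith)
          ((continuous_finsetSum _ fun k _ => hcG k).intervalIntegrable _ _)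
          ((continuous_const.mul (continuous_integral_vec hbc)).intervalIntegrable _ _)
          fun t _ => hpt t
  rw [intervalIntegral.integral_const_mul] at hfin
  exact nonneg_of_mul_nonneg_right hfin Real.two_pi_pos

end IsCatenoidProfile

/-! ### Relatively compact domains and their `L²` spaces -/

theorem IsRegularDomain.exists_bound {f : ℝ → ℝ} {Ω : Set (Fin 3 → ℝ)}
    (hΩ : IsRegularDomain (revolutionSurface f) Ω) :
    ∃ T, 0 ≤ T ∧ ∀ p, revolutionSurface f p ∈ Ω → |p 0| < T := by
  obtain ⟨C, hC⟩ := hΩ.compact.exists_bound_of_continuousOn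
    (f := fun q : Fin 3 → ℝ => q 2) (by fun_prop)
  refine ⟨|C| + 1, by positivity, fun p hp => ?_⟩
  have := hC _ (subset_closure hp)
  have h2 : |p 0| ≤ C := by simpa [revolutionSurface] using this
  linarith [le_abs_self C]

theorem revolutionSurface_add_two_pi (f : ℝ → ℝ) (t θ : ℝ) :
    revolutionSurface f ![t, θ + 2 * Real.pi] = revolutionSurface f ![t, θ] := by
  simp [revolutionSurface]

theorem IsTestFunction.isPeriodic {f : ℝ → ℝ} {Ω : Set (Fin 3 → ℝ)} {φ : (Fin 2 → ℝ) → ℝ}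
    (hφ : IsTestFunction (revolutionSurface f) Ω φ) : IsPeriodic φ := fun t θ =>
  hφ.descends (revolutionSurface_add_two_pi f t θ)

theorem partialD_eq_zero {n : ℕ} {u : (Fin n → ℝ) → ℝ} {p : Fin n → ℝ} (hp : p ∉ tsupport u)
    (i : Fin n) : partialD i u p = 0 := by
  have : fderiv ℝ u p = 0 := image_eq_zero_of_notMem_tsupport
    fun h => hp (tsupport_fderiv_subset ℝ h)
  simp [partialD, this]

namespace IsCatenoidProfile

variable {a : ℝ} {f : ℝ → ℝ}

theorem jacobiOp_eq_zero (h : IsCatenoidProfile a f) {u : (Fin 2 → ℝ) → ℝ} {p : Fin 2 → ℝ}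
    (hp : p ∉ tsupport u) : jacobiOp (revolutionSurface f) u p = 0 := by
  have ha := h.a_pos
  have hf := h.pos (p 0)
  have e := h.jacobiOp_eq u p
  have hX : ∀ c d : ℝ → ℝ, ∀ q ∉ tsupport u, c (q 0) * partialD 0 u q + d (q 0) * partialD 1 u q = 0 := by
    intro c d q hq
    rw [partialD_eq_zero hq, partialD_eq_zero hq]; simp
  have hs : ∀ c d : ℝ → ℝ,
      p ∉ tsupport fun q : Fin 2 → ℝ => c (q 0) * partialD 0 u q + d (q 0) * partialD 1 u q := by
    intro c d hmem
    exact hp (closure_minimal (fun q hq => by by_contra h; exact hq (hX c d q h))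
      (isClosed_tsupport u) hmem)
  have h1 := partialD_eq_zero (hs (Catenoid.radial a f) fun _ => a / 2) 0
  have h2 := partialD_eq_zero (hs (fun _ => a / 2) (Catenoid.angular a f)) 1
  rw [h1, h2, image_eq_zero_of_notMem_tsupport hp] at e
  have hne : f (p 0) ^ 2 / a ≠ 0 := by positivity
  simpa [hne, ha.ne', hf.ne'] using e

variable {Ω : Set (Fin 3 → ℝ)} {T : ℝ}

theorem continuous_area (h : IsCatenoidProfile a f) :
    Continuous fun p : Fin 2 → ℝ => f (p 0) ^ 2 / a := by
  have := h.contDiff.continuous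
  fun_prop

theorem domainMeasure_eq (h : IsCatenoidProfile a f) (Ω : Set (Fin 3 → ℝ)) :
    domainMeasure (revolutionSurface f) Ω =
      (volume.restrict ({p | p 1 ∈ Ioc 0 (2 * Real.pi)} ∩ revolutionSurface f ⁻¹' Ω)).withDensity
        fun p => ENNReal.ofReal (f (p 0) ^ 2 / a) := by
  simp only [domainMeasure, h.areaDensity_eq]

theorem inter_preimage_subset_strip (hΩ : ∀ p, revolutionSurface f p ∈ Ω → |p 0| < T) :
    {p | p 1 ∈ Ioc 0 (2 * Real.pi)} ∩ revolutionSurface f ⁻¹' Ω ⊆ strip T := by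
  rintro p ⟨h1, h2⟩
  have := abs_lt.1 (hΩ p h2)
  exact ⟨⟨this.1, this.2.le⟩, h1⟩

theorem isFiniteMeasure_domainMeasure (h : IsCatenoidProfile a f)
    (hΩ : ∀ p, revolutionSurface f p ∈ Ω → |p 0| < T) :
    IsFiniteMeasure (domainMeasure (revolutionSurface f) Ω) := by
  rw [h.domainMeasure_eq]
  refine isFiniteMeasure_withDensity_ofReal ?_
  exact ((integrableOn_strip h.continuous_area).mono_set (inter_preimage_subset_strip hΩ)).2

theorem measurableSet_cell (hΩo : IsOpen (revolutionSurface f ⁻¹' Ω)) :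
    MeasurableSet ({p : Fin 2 → ℝ | p 1 ∈ Ioc 0 (2 * Real.pi)} ∩ revolutionSurface f ⁻¹' Ω) :=
  ((measurable_pi_apply 1) measurableSet_Ioc).inter hΩo.measurableSet

theorem ae_domainMeasure (h : IsCatenoidProfile a f) (hΩo : IsOpen (revolutionSurface f ⁻¹' Ω)) :
    ∀ᵐ p ∂(domainMeasure (revolutionSurface f) Ω),
      p ∈ {p : Fin 2 → ℝ | p 1 ∈ Ioc 0 (2 * Real.pi)} ∩ revolutionSurface f ⁻¹' Ω := by
  rw [h.domainMeasure_eq]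
  exact (withDensity_absolutelyContinuous _ _).ae_le (ae_restrict_mem (measurableSet_cell hΩo))

theorem integral_domainMeasure (h : IsCatenoidProfile a f)
    (hΩ : ∀ p, revolutionSurface f p ∈ Ω → |p 0| < T) {g : (Fin 2 → ℝ) → ℝ}
    (hg : ∀ p ∈ strip T, revolutionSurface f p ∉ Ω → g p = 0) :
    ∫ p, g p ∂(domainMeasure (revolutionSurface f) Ω) =
      ∫ p in strip T, f (p 0) ^ 2 / a * g p := by
  have ha := h.a_pos
  rw [h.domainMeasure_eq, integral_withDensity_eq_integral_toReal_smul
    (h.continuous_area.measurable.ennreal_ofReal) (Eventually.of_forall fun _ => by simp)]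
  have e : ∀ p : Fin 2 → ℝ, (ENNReal.ofReal (f (p 0) ^ 2 / a)).toReal • g p =
      f (p 0) ^ 2 / a * g p := fun p => by
    rw [ENNReal.toReal_ofReal (by positivity), smul_eq_mul]
  simp only [e]
  symm
  refine setIntegral_eq_of_subset_of_forall_sdiff_eq_zero (measurableSet_strip T)
    (inter_preimage_subset_strip hΩ) fun p hp => ?_
  rw [hg p hp.1 fun hpΩ => hp.2 ⟨hp.1.2, hpΩ⟩, mul_zero]

theorem exists_ae_bound (h : IsCatenoidProfile a f)
    (hΩo : IsOpen (revolutionSurface f ⁻¹' Ω))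
    (hΩ : ∀ p, revolutionSurface f p ∈ Ω → |p 0| < T) {g : (Fin 2 → ℝ) → ℝ} (hg : Continuous g) :
    ∃ C, ∀ᵐ p ∂(domainMeasure (revolutionSurface f) Ω), ‖g p‖ ≤ C := by
  obtain ⟨C, hC⟩ := (isCompact_Icc (a := ![-T, 0]) (b := ![T, 2 * Real.pi])).exists_bound_of_continuousOn
    hg.continuousOn
  refine ⟨C, ?_⟩
  filter_upwards [h.ae_domainMeasure hΩo] with p hp
  obtain ⟨⟨h1, h2⟩, h3, h4⟩ := inter_preimage_subset_strip hΩ hp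
  refine hC p ⟨fun i => ?_, fun i => ?_⟩ <;> fin_cases i <;> simp <;> linarith

theorem memLp_of_continuous (h : IsCatenoidProfile a f)
    (hΩo : IsOpen (revolutionSurface f ⁻¹' Ω))
    (hΩ : ∀ p, revolutionSurface f p ∈ Ω → |p 0| < T) {g : (Fin 2 → ℝ) → ℝ} (hg : Continuous g) :
    MemLp g 2 (domainMeasure (revolutionSurface f) Ω) := by
  have := h.isFiniteMeasure_domainMeasure hΩ
  obtain ⟨C, hC⟩ := h.exists_ae_bound hΩo hΩ hg
  exact MemLp.of_bound hg.aestronglyMeasurable C hC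

end IsCatenoidProfile

/-! ### Continuity of weighted `L²` pairings -/

section
variable {α : Type*} [MeasurableSpace α] {μ : Measure α}

theorem integral_mul_eq_inner {x y : α → ℝ} (hx : MemLp x 2 μ) (hy : MemLp y 2 μ) :
    ∫ p, x p * y p ∂μ = inner ℝ (hx.toLp x) (hy.toLp y) := by
  rw [L2.inner_def]
  refine integral_congr_ae ?_
  filter_upwards [hx.coeFn_toLp, hy.coeFn_toLp] with p h1 h2
  rw [h1, h2, real_inner_eq_re_inner]
  simp [mul_comm]

theorem tendsto_integral_mul {x y : α → ℝ} {xn yn : ℕ → α → ℝ} (hx : MemLp x 2 μ)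
    (hy : MemLp y 2 μ) (hxn : ∀ n, MemLp (xn n) 2 μ) (hyn : ∀ n, MemLp (yn n) 2 μ)
    (hxt : Tendsto (fun n => eLpNorm (fun p => xn n p - x p) 2 μ) atTop (𝓝 0))
    (hyt : Tendsto (fun n => eLpNorm (fun p => yn n p - y p) 2 μ) atTop (𝓝 0)) :
    Tendsto (fun n => ∫ p, xn n p * yn n p ∂μ) atTop (𝓝 (∫ p, x p * y p ∂μ)) := by
  rw [integral_mul_eq_inner hx hy]
  simp only [fun n => integral_mul_eq_inner (hxn n) (hyn n)]
  exact ((Lp.tendsto_Lp_iff_tendsto_eLpNorm'' _ hxn _ hx).2 hxt).inner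
    ((Lp.tendsto_Lp_iff_tendsto_eLpNorm'' _ hyn _ hy).2 hyt)

theorem tendsto_integral_coeff_mul {c x y : α → ℝ} {xn yn : ℕ → α → ℝ}
    (hcm : AEStronglyMeasurable c μ) (hc : ∃ C, ∀ᵐ p ∂μ, ‖c p‖ ≤ C) (hx : MemLp x 2 μ)
    (hy : MemLp y 2 μ) (hxn : ∀ n, MemLp (xn n) 2 μ) (hyn : ∀ n, MemLp (yn n) 2 μ)
    (hxt : Tendsto (fun n => eLpNorm (fun p => xn n p - x p) 2 μ) atTop (𝓝 0))
    (hyt : Tendsto (fun n => eLpNorm (fun p => yn n p - y p) 2 μ) atTop (𝓝 0)) :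
    Tendsto (fun n => ∫ p, c p * (xn n p * yn n p) ∂μ) atTop (𝓝 (∫ p, c p * (x p * y p) ∂μ)) := by
  obtain ⟨C, hC⟩ := hc
  have hmul : ∀ {y : α → ℝ}, MemLp y 2 μ → MemLp (fun p => c p * y p) 2 μ := fun {y} hy =>
    hy.of_le_mul (hcm.mul hy.1) (by
      filter_upwards [hC] with p hp
      rw [norm_mul]; gcongr)
  have hyt' : Tendsto (fun n => eLpNorm (fun p => c p * yn n p - c p * y p) 2 μ) atTop (𝓝 0) := by
    have hb : ∀ n, eLpNorm (fun p => c p * yn n p - c p * y p) 2 μ ≤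
        ENNReal.ofReal C * eLpNorm (fun p => yn n p - y p) 2 μ := fun n => by
      refine eLpNorm_le_mul_eLpNorm_of_ae_le_mul ?_ 2
      filter_upwards [hC] with p hp
      rw [← mul_sub, norm_mul]; gcongr
    refine tendsto_of_tendsto_of_tendsto_of_le_of_le tendsto_const_nhds ?_ (fun _ => zero_le) hb
    have := ENNReal.Tendsto.const_mul (a := ENNReal.ofReal C) hyt (Or.inr ENNReal.ofReal_ne_top)
    simpa using this
  have := tendsto_integral_mul hx (hmul hy) hxn (fun n => hmul (hyn n)) hxt hyt'
  simpa only [mul_left_comm] using this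

theorem integrable_coeff_mul {c x y : α → ℝ} (hcm : AEStronglyMeasurable c μ)
    (hc : ∃ C, ∀ᵐ p ∂μ, ‖c p‖ ≤ C) (hx : MemLp x 2 μ) (hy : MemLp y 2 μ) :
    Integrable (fun p => c p * (x p * y p)) μ := by
  obtain ⟨C, hC⟩ := hc
  exact (hx.integrable_mul hy).bdd_mul hcm hC

end

/-! ### The upper bound for the index -/

/-- If quadratic forms are nonnegative on the kernels of linear maps of too small rank to be
injective, then their limit is not negative definite. The kernels may vary with the form. -/
theorem exists_ne_zero_of_tendsto {ι κ : Type*} [Fintype ι] [Fintype κ]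
    (hcard : Fintype.card κ < Fintype.card ι) (A : ℕ → Matrix κ ι ℝ) {b : ℕ → ι → ι → ℝ}
    {B : ι → ι → ℝ} (hb : ∀ i j, Tendsto (fun n => b n i j) atTop (𝓝 (B i j)))
    (hnonneg : ∀ n c, A n *ᵥ c = 0 → 0 ≤ ∑ i, ∑ j, c i * c j * b n i j) :
    ∃ c : ι → ℝ, c ≠ 0 ∧ 0 ≤ ∑ i, ∑ j, c i * c j * B i j := by
  have hk : ∀ n, ∃ c : ι → ℝ, c ∈ Metric.sphere (0 : ι → ℝ) 1 ∧ A n *ᵥ c = 0 := fun n => by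
    obtain ⟨c, hc, hc0⟩ := Submodule.exists_mem_ne_zero_of_ne_bot
      (LinearMap.ker_ne_bot_of_finrank_lt (f := (A n).mulVecLin) (by simpa using hcard))
    refine ⟨‖c‖⁻¹ • c, ?_, ?_⟩
    · rw [mem_sphere_zero_iff_norm, norm_smul, norm_inv, norm_norm,
        inv_mul_cancel₀ (norm_ne_zero_iff.2 hc0)]
    · rw [Matrix.mulVec_smul, show A n *ᵥ c = 0 from hc, smul_zero]
  choose c hc hAc using hk
  obtain ⟨c', hc', φ, hφ, hlim⟩ := (isCompact_sphere (0 : ι → ℝ) 1).tendsto_subseq hc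
  refine ⟨c', fun h0 => by simp [h0] at hc', ?_⟩
  have hl : ∀ i, Tendsto (fun n => c (φ n) i) atTop (𝓝 (c' i)) := fun i =>
    tendsto_pi_nhds.1 hlim i
  refine ge_of_tendsto' (tendsto_finsetSum _ fun i _ => tendsto_finsetSum _ fun j _ =>
    ((hl i).mul (hl j)).mul ((hb i j).comp hφ.tendsto_atTop)) fun n => ?_
  exact hnonneg (φ n) (c (φ n)) (hAc (φ n))

/-- The form `λᵢ ⟪uᵢ, uⱼ⟫` with `λᵢ < 0` is negative definite: by symmetry, vectors with different
`λᵢ` are orthogonal, so that the form is minus the Gram matrix of the vectors `√(-λᵢ) uᵢ`. -/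
theorem sum_mul_inner_neg {ι H : Type*} [Fintype ι] [NormedAddCommGroup H]
    [InnerProductSpace ℝ H] {u : ι → H} (hu : LinearIndependent ℝ u) {lam : ι → ℝ}
    (hlam : ∀ i, lam i < 0) {B : ι → ι → ℝ} (hB : ∀ i j, B i j = lam i * inner ℝ (u i) (u j))
    (hsymm : ∀ i j, B i j = B j i) {c : ι → ℝ} (hc : c ≠ 0) :
    ∑ i, ∑ j, c i * c j * B i j < 0 := by
  have e : ∀ i j, B i j = -(√(-lam i) * √(-lam j) * inner ℝ (u i) (u j)) := fun i j => by
    have h1 := hB i j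
    have h2 := hsymm i j
    rw [hB j i, hB i j, real_inner_comm] at h2
    by_cases hij : lam i = lam j
    · rw [h1, ← hij, Real.mul_self_sqrt (by linarith [hlam i])]; ring
    · have : inner ℝ (u i) (u j) = 0 := by
        rw [real_inner_comm]
        rcases mul_eq_zero.1 (show (lam i - lam j) * inner ℝ (u j) (u i) = 0 by linarith) with h | h
        · exact absurd (sub_eq_zero.1 h) hij
        · exact h
      rw [h1, this]; simp
  have key : ∑ i, ∑ j, c i * c j * B i j =
      -inner ℝ (∑ i, (c i * √(-lam i)) • u i) (∑ i, (c i * √(-lam i)) • u i) := by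
    simp only [sum_inner, inner_sum, inner_smul_left, inner_smul_right, ← Finset.sum_neg_distrib, e]
    refine Finset.sum_congr rfl fun i _ => ?_
    rw [Finset.mul_sum, ← Finset.sum_neg_distrib]
    refine Finset.sum_congr rfl fun j _ => ?_
    simp only [conj_trivial]
    rw [real_inner_comm (u i) (u j)]
    ring
  rw [key, neg_lt_zero, real_inner_self_pos]
  intro h0
  obtain ⟨i, hi⟩ := Function.ne_iff.1 hc
  have := Fintype.linearIndependent_iff.1 hu _ h0 i
  have h3 : 0 < √(-lam i) := Real.sqrt_pos.2 (by linarith [hlam i])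
  rcases mul_eq_zero.1 this with h | h
  · exact hi h
  · exact h3.ne' h

/-- The `1`-jet of a function of two variables. -/
def jet (u : (Fin 2 → ℝ) → ℝ) : Fin 3 → (Fin 2 → ℝ) → ℝ := ![u, partialD 0 u, partialD 1 u]

theorem continuous_jet {u : (Fin 2 → ℝ) → ℝ} (hu : ContDiff ℝ ∞ u) (i : Fin 3) :
    Continuous (jet u i) := by
  fin_cases i
  · exact hu.continuous
  · exact (contDiff_partialD hu 0).continuous
  · exact (contDiff_partialD hu 1).continuous

namespace Catenoid

/-- The coefficients, with respect to the area measure of the catenoid, of the index form as a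
bilinear form in `1`-jets. -/
def indexCoeff (a : ℝ) (f : ℝ → ℝ) (i j : Fin 3) (t : ℝ) : ℝ :=
  a / f t ^ 2 * !![-(weight a f t * potential a f t), 0, 0;
    0, radial a f t, a / 2; 0, a / 2, angular a f t] i j

/-- The index form on `Ω`, extended to triples of square integrable functions. -/
def indexForm (a : ℝ) (f : ℝ → ℝ) (Ω : Set (Fin 3 → ℝ)) (x y : Fin 3 → (Fin 2 → ℝ) → ℝ) : ℝ :=
  ∑ i, ∑ j, ∫ p, indexCoeff a f i j (p 0) * (x i p * y j p)
    ∂(domainMeasure (revolutionSurface f) Ω)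

end Catenoid

namespace IsCatenoidProfile

variable {a : ℝ} {f : ℝ → ℝ} {Ω : Set (Fin 3 → ℝ)} {T : ℝ}

theorem continuous_indexCoeff (h : IsCatenoidProfile a f) (i j : Fin 3) :
    Continuous fun p : Fin 2 → ℝ => Catenoid.indexCoeff a f i j (p 0) := by
  have h1 : Continuous fun t => a / f t ^ 2 :=
    continuous_const.div (h.contDiff.continuous.pow 2) fun t => (pow_pos (h.pos t) 2).ne'
  have h2 := h.contDiff_radial.continuous
  have h3 := h.contDiff_weight.continuous
  have h4 := h.contDiff_angular.continuous
  have h5 := h.contDiff_potential.continuous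
  have : Continuous fun t => Catenoid.indexCoeff a f i j t := by
    unfold Catenoid.indexCoeff
    refine h1.mul ?_
    fin_cases i <;> fin_cases j <;> simp <;> fun_prop
  exact this.comp (continuous_apply 0)

theorem tendsto_indexForm (h : IsCatenoidProfile a f)
    (hΩo : IsOpen (revolutionSurface f ⁻¹' Ω)) (hΩ : ∀ p, revolutionSurface f p ∈ Ω → |p 0| < T)
    {x y : Fin 3 → (Fin 2 → ℝ) → ℝ} {xn yn : ℕ → Fin 3 → (Fin 2 → ℝ) → ℝ}
    (hx : ∀ i, MemLp (x i) 2 (domainMeasure (revolutionSurface f) Ω))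
    (hy : ∀ i, MemLp (y i) 2 (domainMeasure (revolutionSurface f) Ω))
    (hxn : ∀ n i, MemLp (xn n i) 2 (domainMeasure (revolutionSurface f) Ω))
    (hyn : ∀ n i, MemLp (yn n i) 2 (domainMeasure (revolutionSurface f) Ω))
    (hxt : ∀ i, Tendsto (fun n => eLpNorm (fun p => xn n i p - x i p) 2
      (domainMeasure (revolutionSurface f) Ω)) atTop (𝓝 0))
    (hyt : ∀ i, Tendsto (fun n => eLpNorm (fun p => yn n i p - y i p) 2
      (domainMeasure (revolutionSurface f) Ω)) atTop (𝓝 0)) :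
    Tendsto (fun n => Catenoid.indexForm a f Ω (xn n) (yn n)) atTop
      (𝓝 (Catenoid.indexForm a f Ω x y)) :=
  tendsto_finsetSum _ fun i _ => tendsto_finsetSum _ fun j _ =>
    tendsto_integral_coeff_mul (h.continuous_indexCoeff i j).aestronglyMeasurable
      (h.exists_ae_bound hΩo hΩ (h.continuous_indexCoeff i j)) (hx i) (hy j)
      (fun n => hxn n i) (fun n => hyn n j) (hxt i) (hyt j)

theorem indexForm_jet (h : IsCatenoidProfile a f)
    (hΩo : IsOpen (revolutionSurface f ⁻¹' Ω)) (hΩ : ∀ p, revolutionSurface f p ∈ Ω → |p 0| < T)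
    {u v : (Fin 2 → ℝ) → ℝ} (hu : IsTestFunction (revolutionSurface f) Ω u)
    (hv : ContDiff ℝ ∞ v) :
    Catenoid.indexForm a f Ω (jet u) (jet v) = ∫ p in strip T, Catenoid.bilin a f u v p := by
  have ha := h.a_pos
  have hint : ∀ i j, Integrable (fun p : Fin 2 → ℝ => Catenoid.indexCoeff a f i j (p 0) *
      (jet u i p * jet v j p)) (domainMeasure (revolutionSurface f) Ω) := fun i j =>
    integrable_coeff_mul (h.continuous_indexCoeff i j).aestronglyMeasurable
      (h.exists_ae_bound hΩo hΩ (h.continuous_indexCoeff i j))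
      (h.memLp_of_continuous hΩo hΩ (continuous_jet hu.smooth i))
      (h.memLp_of_continuous hΩo hΩ (continuous_jet hv j))
  unfold Catenoid.indexForm
  simp only [← integral_finsetSum _ fun j _ => hint _ j]
  rw [← integral_finsetSum _ fun i _ => integrable_finsetSum _ fun j _ => hint i j,
    h.integral_domainMeasure hΩ]
  · refine setIntegral_congr_fun (measurableSet_strip T) fun p _ => ?_
    have := h.pos (p 0)
    simp only [Fin.sum_univ_three, jet, Catenoid.indexCoeff, Catenoid.bilin, Matrix.cons_val,
      Matrix.of_apply]
    field_simp
    ring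
  · intro p _ hp
    have hp' : p ∉ tsupport u := fun hm => hp (hu.support hm)
    have e : ∀ i, jet u i p = 0 := fun i => by
      fin_cases i
      · exact image_eq_zero_of_notMem_tsupport hp'
      · exact partialD_eq_zero hp' 0
      · exact partialD_eq_zero hp' 1
    simp [e]

theorem integral_mul_jacobiOp_domain (h : IsCatenoidProfile a f) (hT : 0 ≤ T)
    (hΩ : ∀ p, revolutionSurface f p ∈ Ω → |p 0| < T)
    {u v : (Fin 2 → ℝ) → ℝ} (hu : IsTestFunction (revolutionSurface f) Ω u)
    (hv : ContDiff ℝ ∞ v) (hvp : IsPeriodic v) :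
    ∫ p, v p * jacobiOp (revolutionSurface f) u p ∂(domainMeasure (revolutionSurface f) Ω) =
      ∫ p in strip T, Catenoid.bilin a f u v p := by
  rw [h.integral_domainMeasure hΩ, ← h.integral_mul_jacobiOp hT hu.smooth hv hu.isPeriodic hvp]
  · simp only [mul_left_comm]
  · intro p hp
    have hp' : p ∉ tsupport u := fun hm => (hΩ p (hu.support hm)).ne hp
    exact Or.inr ⟨partialD_eq_zero hp' 0, partialD_eq_zero hp' 1⟩
  · intro p _ hp
    rw [h.jacobiOp_eq_zero fun hm => hp (hu.support hm), mul_zero]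


/-- If `φₙ → u` and `ψₙ → v` in `H¹₀`, where `u` is an eigenfunction for `λ`, the index form of `φₙ`
and `ψₙ` converges to `λ ⟪u, v⟫`. -/
theorem indexForm_eigen (h : IsCatenoidProfile a f) (hT : 0 ≤ T)
    (hΩo : IsOpen (revolutionSurface f ⁻¹' Ω)) (hΩ : ∀ p, revolutionSurface f p ∈ Ω → |p 0| < T)
    {lam : ℝ} {u v : Lp ℝ 2 (domainMeasure (revolutionSurface f) Ω)}
    {φ ψ : ℕ → (Fin 2 → ℝ) → ℝ} {w z : Fin 2 → Lp ℝ 2 (domainMeasure (revolutionSurface f) Ω)}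
    (hu : ∀ φ, IsTestFunction (revolutionSurface f) Ω φ →
      ∫ p, u p * jacobiOp (revolutionSurface f) φ p ∂(domainMeasure (revolutionSurface f) Ω) =
        lam * ∫ p, u p * φ p ∂(domainMeasure (revolutionSurface f) Ω))
    (hφ : ∀ n, IsTestFunction (revolutionSurface f) Ω (φ n))
    (hφu : Tendsto (fun n => eLpNorm (fun p => φ n p - u p) 2
      (domainMeasure (revolutionSurface f) Ω)) atTop (𝓝 0))
    (hφw : ∀ i, Tendsto (fun n => eLpNorm (fun p => partialD i (φ n) p - w i p) 2
      (domainMeasure (revolutionSurface f) Ω)) atTop (𝓝 0))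
    (hψ : ∀ n, IsTestFunction (revolutionSurface f) Ω (ψ n))
    (hψu : Tendsto (fun n => eLpNorm (fun p => ψ n p - v p) 2
      (domainMeasure (revolutionSurface f) Ω)) atTop (𝓝 0))
    (hψw : ∀ i, Tendsto (fun n => eLpNorm (fun p => partialD i (ψ n) p - z i p) 2
      (domainMeasure (revolutionSurface f) Ω)) atTop (𝓝 0)) :
    Tendsto (fun n => ∫ p in strip T, Catenoid.bilin a f (φ n) (ψ n) p) atTop
      (𝓝 (lam * inner ℝ u v)) := by
  set x : Fin 3 → (Fin 2 → ℝ) → ℝ := ![u, w 0, w 1] with hx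
  set y : Fin 3 → (Fin 2 → ℝ) → ℝ := ![v, z 0, z 1] with hy
  have hxm : ∀ i, MemLp (x i) 2 (domainMeasure (revolutionSurface f) Ω) := fun i => by fin_cases i <;> exact Lp.memLp _
  have hym : ∀ i, MemLp (y i) 2 (domainMeasure (revolutionSurface f) Ω) := fun i => by fin_cases i <;> exact Lp.memLp _
  have hjm : ∀ {g : (Fin 2 → ℝ) → ℝ}, ContDiff ℝ ∞ g → ∀ i, MemLp (jet g i) 2 (domainMeasure (revolutionSurface f) Ω) := fun hg i =>
    h.memLp_of_continuous hΩo hΩ (continuous_jet hg i)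
  have hφm : ∀ n i, MemLp (jet (φ n) i) 2 (domainMeasure (revolutionSurface f) Ω) := fun n => hjm (hφ n).smooth
  have hψm : ∀ n i, MemLp (jet (ψ n) i) 2 (domainMeasure (revolutionSurface f) Ω) := fun n => hjm (hψ n).smooth
  have hφt : ∀ i, Tendsto (fun n => eLpNorm (fun p => jet (φ n) i p - x i p) 2 (domainMeasure (revolutionSurface f) Ω)) atTop (𝓝 0) :=
    fun i => by
      fin_cases i
      · exact hφu
      · exact hφw 0
      · exact hφw 1
  have hψt : ∀ i, Tendsto (fun n => eLpNorm (fun p => jet (ψ n) i p - y i p) 2 (domainMeasure (revolutionSurface f) Ω)) atTop (𝓝 0) :=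
    fun i => by
      fin_cases i
      · exact hψu
      · exact hψw 0
      · exact hψw 1
  have hconst : ∀ {g : Fin 3 → (Fin 2 → ℝ) → ℝ}, ∀ i,
      Tendsto (fun _ : ℕ => eLpNorm (fun p => g i p - g i p) 2 (domainMeasure (revolutionSurface f) Ω)) atTop (𝓝 0) := fun {g} i => by
    simp
  -- The weak equation for `u`, expressed through the index form.
  have hweak : ∀ g, IsTestFunction (revolutionSurface f) Ω g →
      Catenoid.indexForm a f Ω (jet g) x = lam * ∫ p, u p * g p ∂(domainMeasure (revolutionSurface f) Ω) := fun g hg => by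
    have h1 := h.tendsto_indexForm hΩo hΩ (hjm hg.smooth) hxm (fun _ => hjm hg.smooth) hφm
      hconst hφt
    have h2 : Tendsto (fun n => ∫ p, φ n p * jacobiOp (revolutionSurface f) g p ∂(domainMeasure (revolutionSurface f) Ω)) atTop
        (𝓝 (∫ p, u p * jacobiOp (revolutionSurface f) g p ∂(domainMeasure (revolutionSurface f) Ω))) := by
      have hJ : MemLp (jacobiOp (revolutionSurface f) g) 2 (domainMeasure (revolutionSurface f) Ω) :=
        h.memLp_of_continuous hΩo hΩ (h.continuous_jacobiOp hg.smooth)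
      exact tendsto_integral_mul (Lp.memLp u) hJ (fun n => hφm n 0) (fun _ => hJ) hφu (by simp)
    simp only [fun n => h.indexForm_jet hΩo hΩ hg (hφ n).smooth] at h1
    simp only [fun n => h.integral_mul_jacobiOp_domain hT hΩ hg (hφ n).smooth
      (hφ n).isPeriodic] at h2
    rw [tendsto_nhds_unique h1 h2, hu g hg]
  have h1 := h.tendsto_indexForm hΩo hΩ hym hxm hψm hφm hψt hφt
  have h2 : Catenoid.indexForm a f Ω y x = lam * inner ℝ u v := by
    have h3 := h.tendsto_indexForm hΩo hΩ hym hxm hψm (fun _ => hxm) hψt hconst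
    simp only [fun n => hweak _ (hψ n)] at h3
    refine tendsto_nhds_unique h3 (Tendsto.const_mul lam ?_)
    have h4 := tendsto_integral_mul (Lp.memLp u) (Lp.memLp v) (fun _ => Lp.memLp u)
      (fun n => hψm n 0) (by simp) hψu
    rw [integral_mul_eq_inner (Lp.memLp u) (Lp.memLp v), Lp.toLp_coeFn, Lp.toLp_coeFn] at h4
    exact h4
  rw [← h2]
  refine h1.congr fun n => ?_
  rw [h.indexForm_jet hΩo hΩ (hψ n) (hφ n).smooth, Catenoid.bilin_comm]

theorem partialD_finset_sum {ι : Type*} [Fintype ι] (c : ι → ℝ) {φ : ι → (Fin 2 → ℝ) → ℝ}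
    (hφ : ∀ i, ContDiff ℝ ∞ (φ i)) (k : Fin 2) (p : Fin 2 → ℝ) :
    partialD k (fun q => ∑ i, c i * φ i q) p = ∑ i, c i * partialD k (φ i) p := by
  have hd : ∀ i, DifferentiableAt ℝ (φ i) p := fun i => (hφ i).differentiable (by simp) p
  unfold partialD
  rw [fderiv_fun_sum fun i _ => (hd i).const_mul (c i)]
  simp [fderiv_const_mul (hd _)]

theorem integral_bilin_sum (h : IsCatenoidProfile a f) {ι : Type*} [Fintype ι] (c : ι → ℝ)
    {φ : ι → (Fin 2 → ℝ) → ℝ} (hφ : ∀ i, ContDiff ℝ ∞ (φ i)) :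
    ∫ p in strip T, Catenoid.bilin a f (fun q => ∑ i, c i * φ i q) (fun q => ∑ i, c i * φ i q) p =
      ∑ i, ∑ j, c i * c j * ∫ p in strip T, Catenoid.bilin a f (φ i) (φ j) p := by
  have hi : ∀ i j, IntegrableOn (fun p => c i * c j * Catenoid.bilin a f (φ i) (φ j) p) (strip T) :=
    fun i j => integrableOn_strip (continuous_const.mul (h.continuous_bilin (hφ i) (hφ j)))
  simp only [← integral_const_mul, ← integral_finsetSum _ fun j _ => hi _ j]
  rw [← integral_finsetSum _ fun i _ => integrable_finsetSum _ fun j _ => hi i j]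
  congr 1
  funext p
  simp only [Catenoid.bilin, partialD_finset_sum c hφ]
  simp only [Finset.sum_mul_sum]
  simp only [Finset.mul_sum, ← Finset.sum_add_distrib, ← Finset.sum_sub_distrib]
  exact Finset.sum_congr rfl fun i _ => Finset.sum_congr rfl fun j _ => by ring

/-- Among `N > 1 + 2m` functions there is a combination whose Fourier modes `|k| ≤ m` vanish at the
neck; hence a limit of index forms on `N`-tuples of test functions is not negative definite. -/
theorem exists_sum_bilin_nonneg (h : IsCatenoidProfile a f) {m N : ℕ} (hN : 1 + 2 * m < N)
    (hm : a ^ 2 + 2 ≤ ((m : ℝ) + 1) ^ 2) (hT : 0 ≤ T)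
    (hΩT : ∀ p, revolutionSurface f p ∈ Ω → |p 0| < T) {φ : Fin N → ℕ → (Fin 2 → ℝ) → ℝ}
    (hφ : ∀ i n, IsTestFunction (revolutionSurface f) Ω (φ i n)) {B : Fin N → Fin N → ℝ}
    (hlim : ∀ i j, Tendsto (fun n => ∫ p in strip T, Catenoid.bilin a f (φ i n) (φ j n) p) atTop
      (𝓝 (B i j))) :
    ∃ c : Fin N → ℝ, c ≠ 0 ∧ 0 ≤ ∑ i, ∑ j, c i * c j * B i j := by
  let A : ℕ → Matrix (Fin (m + 1) ⊕ Fin m) (Fin N) ℝ := fun n => Matrix.of fun s i =>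
    Sum.elim (fun k : Fin (m + 1) => ∫ θ in (0 : ℝ)..(2 * Real.pi),
      φ i n ![0, θ] * Real.cos ((k : ℕ) * θ)) (fun k : Fin m => ∫ θ in (0 : ℝ)..(2 * Real.pi),
      φ i n ![0, θ] * Real.sin (((k : ℕ) + 1 : ℕ) * θ)) s
  have hnonneg : ∀ n c, A n *ᵥ c = 0 →
      0 ≤ ∑ i, ∑ j, c i * c j * ∫ p in strip T, Catenoid.bilin a f (φ i n) (φ j n) p := by
    intro n c hc
    have hs : ∀ i, ContDiff ℝ ∞ (φ i n) := fun i => (hφ i n).smooth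
    rw [← h.integral_bilin_sum c hs]
    have hcont : ∀ i, Continuous fun θ : ℝ => φ i n ![0, θ] := fun i =>
      (hs i).continuous.comp (continuous_vec.comp (by fun_prop : Continuous fun θ : ℝ => ((0 : ℝ), θ)))
    have hint : ∀ g : ℝ → ℝ, Continuous g → ∫ θ in (0 : ℝ)..(2 * Real.pi),
        (∑ i, c i * φ i n ![0, θ]) * g θ =
        ∑ i, (∫ θ in (0 : ℝ)..(2 * Real.pi), φ i n ![0, θ] * g θ) * c i := fun g hg => by
      simp only [Finset.sum_mul]
      rw [intervalIntegral.integral_finsetSum fun i _ => Continuous.intervalIntegrable (by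
        have := hcont i
        fun_prop) _ _]
      refine Finset.sum_congr rfl fun i _ => ?_
      rw [← intervalIntegral.integral_mul_const]
      exact intervalIntegral.integral_congr fun θ _ => by ring
    refine h.integral_bilin_self_nonneg hT hm (ContDiff.sum fun i _ => contDiff_const.mul (hs i))
      (fun t θ => ?_) (fun θ => ?_) (fun k hk => ?_) (fun k hk => ?_)
    · exact Finset.sum_congr rfl fun i _ => by rw [(hφ i n).isPeriodic]
    · have h0 : ∀ (p : Fin 2 → ℝ), |p 0| = T → ∀ i, φ i n p = 0 := fun p hp i =>
        image_eq_zero_of_notMem_tsupport fun hmem => (hΩT p ((hφ i n).support hmem)).ne hp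
      constructor
      · simp [h0 ![T, θ] (by simpa using hT)]
      · simp [h0 ![-T, θ] (by simpa using hT)]
    · have := congrFun hc (Sum.inl ⟨k, by omega⟩)
      rw [hint (fun θ => Real.cos (k * θ)) (by fun_prop)]
      exact this
    · rcases k with _ | k
      · simp
      have := congrFun hc (Sum.inr ⟨k, by omega⟩)
      rw [hint (fun θ => Real.sin (((k + 1 : ℕ) : ℝ) * θ)) (by fun_prop)]
      exact this
  exact exists_ne_zero_of_tendsto (by simp; omega) A hlim hnonneg

theorem exists_linearIndependent_fin {H : Type*} [AddCommGroup H] [Module ℝ H] {S : Set H} {N : ℕ}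
    (hN : (N : ℕ∞) < Cardinal.toENat (Module.rank ℝ (Submodule.span ℝ S))) :
    ∃ e : Fin (N + 1) → H, LinearIndependent ℝ e ∧ ∀ i, e i ∈ S := by
  obtain ⟨b, hbS, hbspan, hb⟩ := exists_linearIndependent ℝ S
  have hcard : ((N + 1 : ℕ) : Cardinal) ≤ Cardinal.mk b := by
    rw [← hbspan, rank_span_set hb, ← not_le, Cardinal.toENat_le_natCast, not_le] at hN
    exact_mod_cast Order.succ_le_of_lt hN
  obtain ⟨e⟩ : Nonempty (Fin (N + 1) ↪ b) := by
    rw [← Cardinal.lift_mk_le']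
    simpa using hcard
  exact ⟨fun i => e i, hb.comp e e.injective, fun i => hbS (e i).2⟩

/-- The index of a relatively compact domain is at most the number `1 + 2m` of Fourier
coefficients on the neck circle `t = 0` which have to vanish for the index form to be
non-negative. -/
theorem dirichletIndex_le (h : IsCatenoidProfile a f) {m : ℕ}
    (hm : a ^ 2 + 2 ≤ ((m : ℝ) + 1) ^ 2) (hΩ : IsRegularDomain (revolutionSurface f) Ω) :
    dirichletIndex (revolutionSurface f) Ω ≤ ((1 + 2 * m : ℕ) : ℕ∞) := by
  obtain ⟨T, hT, hΩT⟩ := hΩ.exists_bound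
  by_contra! hlt
  obtain ⟨e, hLI, hmem⟩ := exists_linearIndependent_fin hlt
  choose lam hlam hH10 hweak using hmem
  choose φ w hφ hφu hφw using hH10
  have hlim : ∀ i j, Tendsto (fun n => ∫ p in strip T, Catenoid.bilin a f (φ i n) (φ j n) p) atTop
      (𝓝 (lam i * inner ℝ (e i) (e j))) :=
    fun i j => h.indexForm_eigen hT hΩ.isOpen hΩT (hweak i) (hφ i) (hφu i) (hφw i) (hφ j) (hφu j)
      (hφw j)
  obtain ⟨c, hc0, hc⟩ := h.exists_sum_bilin_nonneg (by omega) hm hT hΩT hφ hlim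
  refine absurd hc (not_le.2 (sum_mul_inner_neg hLI hlam (fun i j => rfl) (fun i j => ?_) hc0))
  refine tendsto_nhds_unique (hlim i j) ?_
  simpa only [Catenoid.bilin_comm a f (φ i _)] using hlim j i

theorem morseIndex_le (h : IsCatenoidProfile a f) :
    morseIndex (revolutionSurface f) ≤ ((1 + 2 * ⌊√(a ^ 2 + 2)⌋₊ : ℕ) : ℕ∞) := by
  refine iSup₂_le fun Ω hΩ => h.dirichletIndex_le ?_ hΩ
  have h1 := (Nat.lt_floor_add_one √(a ^ 2 + 2)).le
  calc a ^ 2 + 2 = √(a ^ 2 + 2) ^ 2 := (Real.sq_sqrt (by positivity)).symm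
    _ ≤ _ := by gcongr

end IsCatenoidProfile

/-! ### Shooting with the Prüfer angle -/

/-- The equation of the Prüfer angle of the Sturm–Liouville equation `(u' / A)' = -q u`:
if `u = r cos θ` and `u' / A = -r sin θ`, then `θ' = pruferField A q t θ`. -/
def pruferField (A q : ℝ → ℝ) (t x : ℝ) : ℝ := A t * Real.sin x ^ 2 + q t * Real.cos x ^ 2

theorem abs_sin_sq_sub_le (x y : ℝ) : |Real.sin x ^ 2 - Real.sin y ^ 2| ≤ |x - y| := by
  have e : Real.sin x ^ 2 - Real.sin y ^ 2 = Real.sin (x + y) * Real.sin (x - y) := by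
    rw [Real.sin_add, Real.sin_sub]
    linear_combination Real.sin y ^ 2 * Real.sin_sq_add_cos_sq x -
      Real.sin x ^ 2 * Real.sin_sq_add_cos_sq y
  rw [e, abs_mul]
  exact (mul_le_mul (Real.abs_sin_le_one _) Real.abs_sin_le_abs (abs_nonneg _)
    zero_le_one).trans_eq (one_mul _)

theorem lipschitzWith_pruferField {A q : ℝ → ℝ} {t M : ℝ} (hA : |A t| ≤ M) (hq : |q t| ≤ M) :
    LipschitzWith (2 * M).toNNReal (pruferField A q t) := by
  refine LipschitzWith.of_dist_le_mul fun x y => ?_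
  have hM := (abs_nonneg _).trans hA
  rw [Real.dist_eq, Real.dist_eq, Real.coe_toNNReal _ (by positivity)]
  have e : pruferField A q t x - pruferField A q t y =
      (A t - q t) * (Real.sin x ^ 2 - Real.sin y ^ 2) := by
    unfold pruferField; rw [Real.cos_sq', Real.cos_sq']; ring
  rw [e, abs_mul]
  have := abs_sub (A t) (q t)
  have := abs_sin_sq_sub_le x y
  gcongr
  linarith

theorem abs_pruferField_le {A q : ℝ → ℝ} {t M : ℝ} (hA : |A t| ≤ M) (hq : |q t| ≤ M) (x : ℝ) :
    |pruferField A q t x| ≤ 2 * M := by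
  have h1 := Real.sin_sq_le_one x
  have h2 := Real.cos_sq_le_one x
  rw [abs_le] at *
  unfold pruferField
  constructor <;> nlinarith [sq_nonneg (Real.sin x), sq_nonneg (Real.cos x)]

theorem exists_abs_le_on_Icc {A q : ℝ → ℝ} (hA : Continuous A) (hq : Continuous q) (S : ℝ) :
    ∃ M, 0 ≤ M ∧ ∀ t ∈ Icc (-S) S, |A t| ≤ M ∧ |q t| ≤ M := by
  obtain ⟨C, hC⟩ := isCompact_Icc.exists_bound_of_continuousOn (s := Icc (-S) S) hA.continuousOn
  obtain ⟨D, hD⟩ := isCompact_Icc.exists_bound_of_continuousOn (s := Icc (-S) S) hq.continuousOn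
  exact ⟨max (max C D) 0, le_max_right _ _, fun t ht =>
    ⟨(hC t ht).trans ((le_max_left _ _).trans (le_max_left _ _)),
     (hD t ht).trans ((le_max_right _ _).trans (le_max_left _ _))⟩⟩

theorem exists_prufer_local {A q : ℝ → ℝ} (hA : Continuous A) (hq : Continuous q) {S : ℝ}
    (hS : 0 ≤ S) : ∃ θ : ℝ → ℝ, θ 0 = 0 ∧
      ∀ t ∈ Ioo (-S) S, HasDerivAt θ (pruferField A q t (θ t)) t := by
  obtain ⟨M, hM0, hM⟩ := exists_abs_le_on_Icc hA hq S
  have hP : IsPicardLindelof (pruferField A q) (⟨0, by simpa using hS⟩ : Icc (-S) S) 0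
      (2 * M * S).toNNReal 0 (2 * M).toNNReal (2 * M).toNNReal := by
    refine ⟨fun t ht => (lipschitzWith_pruferField (hM t ht).1 (hM t ht).2).lipschitzOnWith,
      fun x _ => ?_, fun t ht x _ => ?_, ?_⟩
    · unfold pruferField; fun_prop
    · rw [Real.norm_eq_abs, Real.coe_toNNReal _ (by positivity)]
      exact abs_pruferField_le (hM t ht).1 (hM t ht).2 x
    · rw [Real.coe_toNNReal _ (by positivity), Real.coe_toNNReal _ (by positivity)]
      simp
  obtain ⟨θ, h0, hθ⟩ := hP.exists_eq_forall_mem_Icc_hasDerivWithinAt₀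
  exact ⟨θ, h0, fun t ht => (hθ t (Ioo_subset_Icc_self ht)).hasDerivAt (Icc_mem_nhds ht.1 ht.2)⟩

theorem prufer_unique {A q : ℝ → ℝ} (hA : Continuous A) (hq : Continuous q) {S : ℝ}
    {θ η : ℝ → ℝ} (h0 : θ 0 = η 0)
    (hθ : ∀ t ∈ Ioo (-S) S, HasDerivAt θ (pruferField A q t (θ t)) t)
    (hη : ∀ t ∈ Ioo (-S) S, HasDerivAt η (pruferField A q t (η t)) t) {t : ℝ}
    (ht : t ∈ Ioo (-S) S) : θ t = η t := by
  obtain ⟨M, hM0, hM⟩ := exists_abs_le_on_Icc hA hq S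
  have hS : 0 < S := by have := ht.1.trans ht.2; linarith
  exact ODE_solution_unique_of_mem_Ioo (v := pruferField A q) (s := fun _ => univ)
    (fun t ht => (lipschitzWith_pruferField (hM t (Ioo_subset_Icc_self ht)).1
      (hM t (Ioo_subset_Icc_self ht)).2).lipschitzOnWith)
    (t₀ := 0) ⟨by linarith, hS⟩ (fun t ht => ⟨hθ t ht, trivial⟩) (fun t ht => ⟨hη t ht, trivial⟩) h0 ht

/-- Solutions of the Prüfer equation are global; they are glued from solutions on compact
intervals, on which the field is bounded and uniformly Lipschitz. -/
theorem exists_prufer {A q : ℝ → ℝ} (hA : Continuous A) (hq : Continuous q) :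
    ∃ θ : ℝ → ℝ, θ 0 = 0 ∧ ∀ t, HasDerivAt θ (pruferField A q t (θ t)) t := by
  choose α hα0 hα using fun n : ℕ => exists_prufer_local hA hq (S := n + 1) (by positivity)
  have hglue : ∀ (n m : ℕ) (t : ℝ), |t| < n + 1 → |t| < m + 1 → α n t = α m t := by
    have key : ∀ (n m : ℕ) (t : ℝ), n ≤ m → |t| < n + 1 → α n t = α m t := fun n m t hnm ht => by
      have hc : (n : ℝ) ≤ m := by exact_mod_cast hnm
      refine prufer_unique hA hq (S := n + 1) ((hα0 n).trans (hα0 m).symm) (hα n)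
        (fun s hs => hα m s ⟨by linarith [hs.1], by linarith [hs.2]⟩) (abs_lt.1 ht)
    intro n m t hn hm
    rcases le_total n m with h | h
    · exact key n m t h hn
    · exact (key m n t h hm).symm
  have hceil : ∀ t : ℝ, |t| < (⌈|t|⌉₊ : ℝ) + 1 := fun t =>
    (Nat.le_ceil _).trans_lt (lt_add_one _)
  refine ⟨fun t => α ⌈|t|⌉₊ t, by simp [hα0], fun t => ?_⟩
  refine (hα ⌈|t|⌉₊ t (abs_lt.1 (hceil t))).congr_of_eventuallyEq ?_
  have : ∀ᶠ s in 𝓝 t, |s| < (⌈|t|⌉₊ : ℝ) + 1 :=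
    continuous_abs.continuousAt.eventually_lt continuousAt_const (hceil t)
  filter_upwards [this] with s hs
  exact hglue _ _ s (hceil s) hs

theorem prufer_neg {A q : ℝ → ℝ} (hA : Continuous A) (hq : Continuous q)
    (hAe : ∀ t, A (-t) = A t) (hqe : ∀ t, q (-t) = q t) {θ : ℝ → ℝ} (h0 : θ 0 = 0)
    (hθ : ∀ t, HasDerivAt θ (pruferField A q t (θ t)) t) (t : ℝ) : θ (-t) = -θ t := by
  have h1 : ∀ s, HasDerivAt (fun s => -θ (-s)) (pruferField A q s (-θ (-s))) s := fun s => by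
    have := ((hθ (-s)).comp s (hasDerivAt_neg s)).neg
    refine this.congr_deriv ?_
    simp [pruferField, hAe, hqe]
  have := prufer_unique hA hq (S := |t| + 1) (by simp [h0]) (fun s _ => hθ s) (fun s _ => h1 s)
    (t := t) ⟨by linarith [neg_abs_le t], by linarith [le_abs_self t]⟩
  rw [this, neg_neg]

/-- The Prüfer angle crosses the zeros of the cosine only upwards. -/
theorem prufer_lt {A q : ℝ → ℝ} (hApos : ∀ t, 0 < A t) {θ : ℝ → ℝ}
    (hθ : ∀ t, HasDerivAt θ (pruferField A q t (θ t)) t) {c s t : ℝ} (hc : Real.cos c = 0)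
    (hs : c ≤ θ s) (hst : s < t) : c < θ t := by
  have hF : ∀ r x, x = c → pruferField A q r x = A r := fun r x hx => by
    have := Real.sin_sq_add_cos_sq c
    rw [hc] at this
    simp only [pruferField, hx, hc]
    linear_combination A r * this
  have hcont : Continuous θ := continuous_iff_continuousAt.2 fun t => (hθ t).continuousAt
  have hle : ∀ r ∈ Icc s t, c ≤ θ r := fun r hr => by
    have := image_le_of_deriv_right_lt_deriv_boundary (f := fun r => -θ r)
      (f' := fun r => -pruferField A q r (θ r)) (B := fun _ => -c) (B' := fun _ => 0) (a := s)
      (b := t) hcont.neg.continuousOn (fun x _ => (hθ x).neg.hasDerivWithinAt) (by linarith)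
      (fun x => hasDerivAt_const x _) (fun x _ hx => by
        rw [hF x _ (neg_injective hx)]; linarith [hApos x]) hr
    linarith
  refine lt_of_le_of_ne (hle t ⟨hst.le, le_rfl⟩) fun heq => ?_
  have hd := hθ t
  rw [hF t _ heq.symm] at hd
  have h1 : ∀ᶠ r in 𝓝[<] t, θ r < θ t := by
    have := (hasDerivAt_iff_tendsto_slope_left_right.1 hd).1.eventually_const_lt (hApos t)
    filter_upwards [this, self_mem_nhdsWithin] with r hr hrt
    rw [slope_def_field] at hr
    have hrt' : r - t < 0 := sub_neg.2 hrt
    rcases div_pos_iff.1 hr with h | h <;> linarith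
  have h2 : ∀ᶠ r in 𝓝[<] t, r ∈ Ioo s t := Ioo_mem_nhdsLT hst
  obtain ⟨r, hr, hrs⟩ := (h1.and h2).exists
  have := hle r (Ioo_subset_Icc_self hrs)
  linarith

theorem contDiff_of_system {A q u U : ℝ → ℝ} (hA : ContDiff ℝ ∞ A) (hq : ContDiff ℝ ∞ q)
    (hu : ∀ t, HasDerivAt u (A t * U t) t) (hU : ∀ t, HasDerivAt U (-(q t * u t)) t) :
    ContDiff ℝ ∞ u ∧ ContDiff ℝ ∞ U := by
  have key : ∀ n : ℕ, ContDiff ℝ n u ∧ ContDiff ℝ n U := fun n => by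
    induction n with
    | zero =>
      exact ⟨contDiff_zero.2 (continuous_iff_continuousAt.2 fun t => (hu t).continuousAt),
        contDiff_zero.2 (continuous_iff_continuousAt.2 fun t => (hU t).continuousAt)⟩
    | succ n ih =>
      have hAn : ContDiff ℝ n A := hA.of_le (by exact_mod_cast le_top)
      have hqn : ContDiff ℝ n q := hq.of_le (by exact_mod_cast le_top)
      have e1 : deriv u = fun t => A t * U t := funext fun t => (hu t).deriv
      have e2 : deriv U = fun t => -(q t * u t) := funext fun t => (hU t).deriv
      push_cast
      rw [contDiff_succ_iff_deriv, contDiff_succ_iff_deriv, e1, e2]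
      exact ⟨⟨fun t => (hu t).differentiableAt, by simp, hAn.mul ih.2⟩,
        ⟨fun t => (hU t).differentiableAt, by simp, (hqn.mul ih.1).neg⟩⟩
  exact ⟨contDiff_infty.2 fun n => (key n).1, contDiff_infty.2 fun n => (key n).2⟩

/-- The amplitude `r` turns the Prüfer angle into a solution `u = r cos θ` of the Sturm–Liouville
equation, with `u' / A = -r sin θ`. -/
theorem exists_prufer_amplitude {A q θ : ℝ → ℝ} (hA : Continuous A) (hq : Continuous q)
    (hθ : ∀ t, HasDerivAt θ (pruferField A q t (θ t)) t) :
    ∃ r : ℝ → ℝ, (∀ t, 0 < r t) ∧ r 0 = 1 ∧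
      (∀ t, HasDerivAt (fun t => r t * Real.cos (θ t)) (A t * -(r t * Real.sin (θ t))) t) ∧
      ∀ t, HasDerivAt (fun t => -(r t * Real.sin (θ t))) (-(q t * (r t * Real.cos (θ t)))) t := by
  have hcont : Continuous θ := continuous_iff_continuousAt.2 fun t => (hθ t).continuousAt
  set g : ℝ → ℝ := fun t => (q t - A t) * (Real.sin (θ t) * Real.cos (θ t)) with hg
  have hgc : Continuous g := by fun_prop
  set r : ℝ → ℝ := fun t => Real.exp (∫ s in (0 : ℝ)..t, g s) with hr
  have hrd : ∀ t, HasDerivAt r (r t * g t) t := fun t =>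
    (intervalIntegral.integral_hasDerivAt_right (hgc.intervalIntegrable _ _)
      (hgc.stronglyMeasurableAtFilter _ _) hgc.continuousAt).exp
  refine ⟨r, fun t => Real.exp_pos _, by simp [hr], fun t => ?_, fun t => ?_⟩
  · refine ((hrd t).mul (hθ t).cos).congr_deriv ?_
    simp only [hg, pruferField]
    linear_combination (-(A t * r t * Real.sin (θ t))) * Real.sin_sq_add_cos_sq (θ t)
  · refine ((hrd t).mul (hθ t).sin).neg.congr_deriv ?_
    simp only [hg, pruferField]
    linear_combination (-(q t * r t * Real.cos (θ t))) * Real.sin_sq_add_cos_sq (θ t)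

/-- The Prüfer angle at `T` depends continuously on the spectral parameter, by Grönwall's
inequality. -/
theorem continuous_prufer_apply {A q w : ℝ → ℝ} (hA : Continuous A) (hq : Continuous q) (hw : Continuous w)
    {Θ : ℝ → ℝ → ℝ} (h0 : ∀ lam, Θ lam 0 = 0)
    (hΘ : ∀ lam t, HasDerivAt (Θ lam) (pruferField A (fun t => q t + lam * w t) t (Θ lam t)) t)
    {T : ℝ} (hT : 0 ≤ T) : Continuous fun lam => Θ lam T := by
  obtain ⟨C, hC⟩ := isCompact_Icc.exists_bound_of_continuousOn (s := Icc (-T) T) hw.continuousOn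
  refine continuous_iff_continuousAt.2 fun l => ?_
  obtain ⟨M, hM0, hM⟩ := exists_abs_le_on_Icc hA
    (show Continuous fun t => q t + l * w t by fun_prop) T
  have hcont : ∀ l, Continuous (Θ l) := fun l =>
    continuous_iff_continuousAt.2 fun t => (hΘ l t).continuousAt
  have hb : ∀ m, dist (Θ m T) (Θ l T) ≤ gronwallBound 0 (2 * M).toNNReal (|m - l| * C) T := by
    intro m
    have hsub : ∀ t ∈ Ico (0 : ℝ) T, t ∈ Icc (-T) T := fun t ht => ⟨by linarith [ht.1], ht.2.le⟩
    have := dist_le_of_approx_trajectories_ODE_of_mem (s := fun _ => univ)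
      (v := pruferField A fun t => q t + l * w t) (a := 0) (b := T)
      (f := Θ m) (g := Θ l) (εf := |m - l| * C) (εg := 0) (δ := 0)
      (fun t ht => (lipschitzWith_pruferField (hM t (hsub t ht)).1
        (hM t (hsub t ht)).2).lipschitzOnWith)
      (hcont m).continuousOn (fun t _ => (hΘ m t).hasDerivWithinAt) (fun t ht => ?_)
      (fun _ _ => trivial) (hcont l).continuousOn (fun t _ => (hΘ l t).hasDerivWithinAt)
      (fun t _ => (dist_self _).le) (fun _ _ => trivial) (by simp [h0]) T ⟨hT, le_rfl⟩
    · simpa using this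
    · have e : pruferField A (fun t => q t + m * w t) t (Θ m t) -
          pruferField A (fun t => q t + l * w t) t (Θ m t) =
          (m - l) * (w t * Real.cos (Θ m t) ^ 2) := by unfold pruferField; ring
      have hC0 := (norm_nonneg _).trans (hC t (hsub t ht))
      rw [Real.dist_eq, e, abs_mul, abs_mul, abs_of_nonneg (sq_nonneg (Real.cos _))]
      refine mul_le_mul_of_nonneg_left ?_ (abs_nonneg _)
      exact (mul_le_mul (hC t (hsub t ht)) (Real.cos_sq_le_one _) (sq_nonneg _) hC0).trans_eq
        (mul_one _)
  rw [ContinuousAt, tendsto_iff_dist_tendsto_zero]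
  refine squeeze_zero (fun _ => dist_nonneg) hb ?_
  have h1 : Continuous fun m : ℝ => gronwallBound 0 (2 * M).toNNReal (|m - l| * C) T :=
    (gronwallBound_continuous_ε 0 _ T).comp (by fun_prop)
  have := h1.tendsto l
  simpa [gronwallBound_ε0_δ0] using this

/-- Sturm comparison: if `r ≤ q` and the solution `z` for `r` with `z' 0 = 0` is nonpositive at some
`s ∈ (0, T)`, the Prüfer angle for `q` exceeds `π / 2` at `T`. -/
theorem pi_div_two_lt_prufer {A q r z Z θ : ℝ → ℝ} (hA : Continuous A) (hApos : ∀ t, 0 < A t)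
    (hq : Continuous q) (h0 : θ 0 = 0) (hθ : ∀ t, HasDerivAt θ (pruferField A q t (θ t)) t)
    (hz : ∀ t, HasDerivAt z (A t * Z t) t) (hZ : ∀ t, HasDerivAt Z (-(r t * z t)) t)
    (hrq : ∀ t, r t ≤ q t) (hz0 : 0 < z 0) (hZ0 : Z 0 = 0) {s T : ℝ} (hs : 0 < s)
    (hzs : z s ≤ 0) (hsT : s < T) : Real.pi / 2 < θ T := by
  have hzc : Continuous z := continuous_iff_continuousAt.2 fun t => (hz t).continuousAt
  obtain ⟨ρ, hρ, hρ0, hu, hU⟩ := exists_prufer_amplitude hA hq hθ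
  set u : ℝ → ℝ := fun t => ρ t * Real.cos (θ t) with hudef
  set U : ℝ → ℝ := fun t => -(ρ t * Real.sin (θ t)) with hUdef
  have hcross : ∃ t ∈ Icc 0 s, Real.cos (θ t) ≤ 0 := by
    by_contra! hpos
    -- The first zero `b` of `z`; on `[0, b]` the quotient `z / u` would be nondecreasing.
    obtain ⟨b, ⟨hb, hzb⟩, hmin⟩ := (isCompact_Icc.inter_right
      (isClosed_le hzc continuous_const)).exists_isLeast (s := Icc 0 s ∩ {t | z t ≤ 0})
      ⟨s, ⟨hs.le, le_rfl⟩, hzs⟩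
    have hznn : ∀ t ∈ Ico 0 b, 0 < z t := fun t ht => by
      by_contra! hle
      exact absurd (hmin ⟨⟨ht.1, ht.2.le.trans hb.2⟩, hle⟩) (not_le.2 ht.2)
    have hupos : ∀ t ∈ Icc 0 b, 0 < u t := fun t ht =>
      mul_pos (hρ t) (hpos t ⟨ht.1, ht.2.trans hb.2⟩)
    have hW : MonotoneOn (fun t => Z t * u t - z t * U t) (Icc 0 b) := by
      have hd : ∀ t, HasDerivAt (fun t => Z t * u t - z t * U t) ((q t - r t) * (z t * u t)) t :=
        fun t => (((hZ t).mul (hu t)).sub ((hz t).mul (hU t))).congr_deriv (by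
          simp only [hudef, hUdef]; ring)
      refine monotoneOn_of_deriv_nonneg (convex_Icc _ _)
        (fun t _ => (hd t).continuousAt.continuousWithinAt)
        (fun t _ => (hd t).differentiableAt.differentiableWithinAt) fun t ht => ?_
      rw [interior_Icc] at ht
      rw [(hd t).deriv]
      have h1 := hznn t ⟨ht.1.le, ht.2⟩
      have h2 := hupos t (Ioo_subset_Icc_self ht)
      have h3 := sub_nonneg.2 (hrq t)
      positivity
    have hquot : MonotoneOn (fun t => z t / u t) (Icc 0 b) := by
      have hd : ∀ t ∈ Icc 0 b, HasDerivAt (fun t => z t / u t)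
          (A t * (Z t * u t - z t * U t) / u t ^ 2) t := fun t ht =>
        ((hz t).div (hu t) (hupos t ht).ne').congr_deriv (by simp only [hudef, hUdef]; ring)
      refine monotoneOn_of_deriv_nonneg (convex_Icc _ _)
        (fun t ht => (hd t ht).continuousAt.continuousWithinAt)
        (fun t ht => (hd t (interior_subset ht)).differentiableAt.differentiableWithinAt)
        fun t ht => ?_
      have ht' := interior_subset ht
      rw [(hd t ht').deriv]
      have h1 := hW ⟨le_rfl, hb.1⟩ ht' ht'.1
      have h2 : (0 : ℝ) ≤ Z t * u t - z t * U t := by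
        refine le_trans (le_of_eq ?_) h1
        simp [hUdef, hZ0, h0]
      have h3 := hApos t
      positivity
    have h1 := hquot ⟨le_rfl, hb.1⟩ ⟨hb.1, le_rfl⟩ hb.1
    have h2 : 0 < z 0 / u 0 := div_pos hz0 (hupos 0 ⟨le_rfl, hb.1⟩)
    have h3 : z b / u b ≤ 0 := div_nonpos_of_nonpos_of_nonneg hzb (hupos b ⟨hb.1, le_rfl⟩).le
    simp only at h1
    linarith
  obtain ⟨t, ht, hcos⟩ := hcross
  have htpos : 0 < t := lt_of_le_of_ne ht.1 fun h => by
    rw [← h, h0, Real.cos_zero] at hcos; linarith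
  have hlow : -(Real.pi / 2) < θ t := prufer_lt hApos hθ (by simp) (by
    rw [h0]; linarith [Real.pi_pos]) htpos
  refine prufer_lt hApos hθ Real.cos_pi_div_two ?_ (ht.2.trans_lt hsT)
  by_contra! hlt
  linarith [Real.cos_pos_of_mem_Ioo ⟨hlow, hlt⟩]

/-- A negative Dirichlet eigenvalue of the even problem `-(u' / A)' - q u = λ w u` on `[-T, T]`,
produced by shooting: the comparison function `z` shows that the solution for `λ = 0` has a zero
in `(0, T)`. -/
theorem exists_neg_eigenvalue {A q w r z Z : ℝ → ℝ} (hA : ContDiff ℝ ∞ A) (hq : ContDiff ℝ ∞ q)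
    (hw : ContDiff ℝ ∞ w) (hApos : ∀ t, 0 < A t) (hwpos : ∀ t, 0 < w t)
    (hAe : ∀ t, A (-t) = A t) (hqe : ∀ t, q (-t) = q t) (hwe : ∀ t, w (-t) = w t)
    (hz : ∀ t, HasDerivAt z (A t * Z t) t) (hZ : ∀ t, HasDerivAt Z (-(r t * z t)) t)
    (hrq : ∀ t, r t ≤ q t) (hz0 : 0 < z 0) (hZ0 : Z 0 = 0) {s T : ℝ} (hs : 0 < s)
    (hzs : z s ≤ 0) (hsT : s < T) :
    ∃ lam < 0, ∃ u U : ℝ → ℝ, ContDiff ℝ ∞ u ∧ ContDiff ℝ ∞ U ∧ u 0 = 1 ∧ u T = 0 ∧ u (-T) = 0 ∧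
      (∀ t, HasDerivAt u (A t * U t) t) ∧
      ∀ t, HasDerivAt U (-((q t + lam * w t) * u t)) t := by
  have hT : 0 < T := hs.trans hsT
  have hAc := hA.continuous
  have hqc := hq.continuous
  have hwc := hw.continuous
  have hqlc : ∀ lam : ℝ, Continuous fun t => q t + lam * w t := fun lam => by fun_prop
  choose Θ hΘ0 hΘ using fun lam : ℝ => exists_prufer hAc (hqlc lam)
  have hcont := continuous_prufer_apply hAc hqc hwc hΘ0 hΘ hT.le
  have htop : Real.pi / 2 < Θ 0 T := by
    have h1 : ∀ t, HasDerivAt (Θ 0) (pruferField A q t (Θ 0 t)) t := fun t => by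
      simpa using hΘ 0 t
    exact pi_div_two_lt_prufer hAc hApos hqc (hΘ0 0) h1 hz hZ hrq hz0 hZ0 hs hzs hsT
  obtain ⟨l, hl0, hl⟩ : ∃ l ≤ (0 : ℝ), Θ l T ≤ 0 := by
    -- For `λ` so negative that `q + λ w < 0` on `[0, T]`, the angle cannot become positive.
    obtain ⟨C, hC⟩ := isCompact_Icc.exists_bound_of_continuousOn (s := Icc 0 T)
      (hqc.div hwc fun t => (hwpos t).ne').continuousOn
    have hneg : ∀ t ∈ Icc 0 T, q t + -(|C| + 1) * w t < 0 := fun t ht => by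
      have h1 := (le_abs_self _).trans ((hC t ht).trans (le_abs_self C))
      rw [Pi.div_apply, div_le_iff₀ (hwpos t)] at h1
      nlinarith [hwpos t]
    refine ⟨-(|C| + 1), by linarith [abs_nonneg C], ?_⟩
    have hc : Continuous (Θ (-(|C| + 1))) :=
      continuous_iff_continuousAt.2 fun t => (hΘ _ t).continuousAt
    refine image_le_of_deriv_right_lt_deriv_boundary (B := fun _ => 0) (B' := fun _ => 0)
      hc.continuousOn (fun x _ => (hΘ _ x).hasDerivWithinAt) (hΘ0 _).le
      (fun x => hasDerivAt_const x _) (fun x hx h => ?_) ⟨hT.le, le_rfl⟩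
    rw [h]
    simpa [pruferField] using hneg x ⟨hx.1, hx.2.le⟩
  obtain ⟨lam, hlam, hlamT⟩ := intermediate_value_Icc hl0 hcont.continuousOn
    (show Real.pi / 2 ∈ Icc (Θ l T) (Θ 0 T) from ⟨hl.trans Real.pi_div_two_pos.le, htop.le⟩)
  obtain ⟨ρ, hρ, hρ0, hu, hU⟩ := exists_prufer_amplitude hAc (hqlc lam) (hΘ lam)
  have hsm := contDiff_of_system hA (hq.add (contDiff_const.mul hw)) hu hU
  have hodd := prufer_neg hAc (hqlc lam) hAe (by simp [hqe, hwe]) (hΘ0 lam) (hΘ lam) T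
  simp only at hlamT
  refine ⟨lam, lt_of_le_of_ne hlam.2 ?_, _, _, hsm.1, hsm.2, ?_, ?_, ?_, hu, hU⟩
  · rintro rfl; exact htop.ne' hlamT
  · simp [hΘ0, hρ0]
  · simp [hlamT]
  · simp [hodd, hlamT]

/-! ### Comparison functions on the catenoids -/

namespace IsCatenoidProfile

variable {a : ℝ} {f : ℝ → ℝ}

theorem tendsto_atTop (h : IsCatenoidProfile a f) : Tendsto f atTop atTop := by
  have hd := h.deriv_pos one_pos
  have hlin : Tendsto (fun t => deriv f 1 * (t - 1)) atTop atTop :=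
    (tendsto_atTop_add_const_right _ (-1 : ℝ) tendsto_id).const_mul_atTop hd
  refine tendsto_atTop_mono' _ ?_ hlin
  filter_upwards [eventually_ge_atTop 1] with t ht
  have := (convex_Ici (1 : ℝ)).mul_sub_le_image_sub_of_le_deriv
    (f := f) (fun t _ => (h.hasDerivAt t).continuousAt.continuousWithinAt)
    (fun t _ => (h.hasDerivAt t).differentiableAt.differentiableWithinAt)
    (fun t ht => h.strictMono_deriv.monotone (interior_subset ht)) 1 self_mem_Ici t ht ht
  linarith [h.pos 1]

theorem strictMono_phase (h : IsCatenoidProfile a f) : StrictMono (phase f) :=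
  strictMono_of_deriv_pos fun t => by rw [(h.hasDerivAt_phase t).deriv]; positivity

/-- The comparison function for the modes of order at most one comes from a Killing field of
`Nil₃`: it is the coefficient of `cos (θ - phase f t)` in the normal component of a horizontal
translation. -/
theorem hasDerivAt_translation (h : IsCatenoidProfile a f) (t : ℝ) :
    HasDerivAt (fun t => (Real.cos (phase f t) - f t * deriv f t / 2 * Real.sin (phase f t)) / f t)
      (Catenoid.weight a f t * -(a / 4 * ((4 + 2 * deriv f t ^ 2) * Real.sin (phase f t) / f t +
        deriv f t * (2 * f t ^ 2 + 4) * Real.cos (phase f t) / f t ^ 2))) t := by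
  have ha := h.a_pos
  have hf := h.pos t
  refine (((h.hasDerivAt_phase t).cos.sub ((((h.hasDerivAt t).mul (h.hasDerivAt_deriv t)).div_const
    2).mul (h.hasDerivAt_phase t).sin)).div (h.hasDerivAt t) hf.ne').congr_deriv ?_
  unfold Catenoid.weight
  simp only [Pi.mul_apply, Pi.sub_apply]
  field_simp
  ring

theorem hasDerivAt_translation_flux (h : IsCatenoidProfile a f) (t : ℝ) :
    HasDerivAt (fun t => -(a / 4 * ((4 + 2 * deriv f t ^ 2) * Real.sin (phase f t) / f t +
        deriv f t * (2 * f t ^ 2 + 4) * Real.cos (phase f t) / f t ^ 2)))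
      (-(Catenoid.weight a f t * (Catenoid.potential a f t - 1) *
        ((Real.cos (phase f t) - f t * deriv f t / 2 * Real.sin (phase f t)) / f t))) t := by
  have ha := h.a_pos
  have hf := h.pos t
  have hE : 0 < f t ^ 2 + 4 := by positivity
  have h1 := ((((h.hasDerivAt_deriv t).pow 2).const_mul 2).const_add 4).mul (h.hasDerivAt_phase t).sin
  have h2 := ((h.hasDerivAt_deriv t).mul ((((h.hasDerivAt t).pow 2).const_mul 2).add_const 4)).mul
    (h.hasDerivAt_phase t).cos
  refine (((h1.div (h.hasDerivAt t) hf.ne').add (h2.div ((h.hasDerivAt t).pow 2)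
    (pow_ne_zero 2 hf.ne'))).const_mul (a / 4)).neg.congr_deriv ?_
  have hen := sub_eq_zero.2 (h.energy t)
  unfold Catenoid.weight Catenoid.potential
  simp only [Pi.mul_apply, Pi.pow_apply]
  rw [← sub_eq_zero]
  set c := Real.cos (phase f t)
  set s := Real.sin (phase f t)
  set p := deriv f t
  set F := f t
  -- The two sides differ by a multiple of the energy identity.
  trans (-(F ^ 2 - 4) / (a * F ^ 2 * (F ^ 2 + 4) ^ 2) * ((c - F * p / 2 * s) / F)) *
    (a ^ 2 * (F ^ 2 + 4) * p ^ 2 - 4 * (F ^ 2 - a ^ 2))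
  · field_simp
    ring
  · rw [hen]; ring

theorem exists_translation_nonpos (h : IsCatenoidProfile a f) :
    ∃ s > 0, (Real.cos (phase f s) - f s * deriv f s / 2 * Real.sin (phase f s)) / f s ≤ 0 := by
  by_cases hp : ∃ t > 0, Real.pi / 2 ≤ phase f t
  · obtain ⟨t, ht, hpt⟩ := hp
    obtain ⟨s, hs, hps⟩ := intermediate_value_Icc ht.le h.contDiff_phase.continuous.continuousOn
      (show Real.pi / 2 ∈ Icc (phase f 0) (phase f t) from
        ⟨by rw [phase_zero]; exact Real.pi_div_two_pos.le, hpt⟩)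
    have hs0 : 0 < s := lt_of_le_of_ne hs.1 fun h0 => by
      rw [← h0, phase_zero] at hps; exact Real.pi_div_two_pos.ne hps
    refine ⟨s, hs0, ?_⟩
    rw [hps, Real.cos_pi_div_two, Real.sin_pi_div_two]
    refine div_nonpos_of_nonpos_of_nonneg ?_ (h.pos s).le
    have h1 := h.pos s
    have h2 := h.deriv_pos hs0
    have : 0 < f s * deriv f s / 2 := by positivity
    linarith
  · push Not at hp
    have hφ1 : 0 < phase f 1 := by simpa using h.strictMono_phase one_pos
    have hsin : 0 < Real.sin (phase f 1) := Real.sin_pos_of_pos_of_lt_pi hφ1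
      ((hp 1 one_pos).trans (by linarith [Real.pi_pos]))
    have hd := h.deriv_pos one_pos
    obtain ⟨s, hs, hs1⟩ := ((h.tendsto_atTop.eventually_ge_atTop
      (2 / (deriv f 1 * Real.sin (phase f 1)))).and (eventually_ge_atTop 1)).exists
    refine ⟨s, by linarith, div_nonpos_of_nonpos_of_nonneg ?_ (h.pos s).le⟩
    have hφ := h.strictMono_phase.monotone hs1
    have h1 : Real.sin (phase f 1) ≤ Real.sin (phase f s) :=
      Real.sin_le_sin_of_le_of_le_pi_div_two (by linarith [Real.pi_pos])
        (hp s (by linarith)).le hφ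
    have h2 := h.strictMono_deriv.monotone hs1
    have h3 : 1 ≤ f s * deriv f 1 / 2 * Real.sin (phase f 1) := by
      rw [div_le_iff₀ (by positivity)] at hs
      linarith
    have h4 : f s * deriv f 1 / 2 * Real.sin (phase f 1) ≤
        f s * deriv f s / 2 * Real.sin (phase f s) := by
      have := h.pos s
      have := hd.trans_le h2
      gcongr
    linarith [Real.cos_le_one (phase f s)]

/-- The parameter `σ` along the generating curve for which the metric is conformal to
`dσ² + dϑ²`. -/
def _root_.Catenoid.conformal (a : ℝ) (f : ℝ → ℝ) (t : ℝ) : ℝ :=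
  ∫ s in (0 : ℝ)..t, Catenoid.weight a f s

theorem hasDerivAt_conformal (h : IsCatenoidProfile a f) (t : ℝ) :
    HasDerivAt (Catenoid.conformal a f) (Catenoid.weight a f t) t :=
  intervalIntegral.integral_hasDerivAt_right
    (h.contDiff_weight.continuous.intervalIntegrable _ _)
    (h.contDiff_weight.continuous.stronglyMeasurableAtFilter _ _)
    h.contDiff_weight.continuous.continuousAt

/-- Half of the conformal length of the catenoid is at least `π / √(a² + 4)`; this is the limit of
the lower bound given here. -/
theorem arctan_le_conformal (h : IsCatenoidProfile a f) {t : ℝ} (ht : 0 ≤ t) :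
    2 / √(a ^ 2 + 4) * Real.arctan (deriv f t * √(f t ^ 2 + 4) / 2) ≤ Catenoid.conformal a f t := by
  have ha := h.a_pos
  have hd : ∀ t, HasDerivAt (fun t => Catenoid.conformal a f t -
      2 / √(a ^ 2 + 4) * Real.arctan (deriv f t * √(f t ^ 2 + 4) / 2))
      (4 / (a * (f t ^ 2 + 4)) - 4 / (√(a ^ 2 + 4) * (f t * √(f t ^ 2 + 4)))) t := fun t => by
    have hf := h.pos t
    refine ((h.hasDerivAt_conformal t).sub
      ((h.hasDerivAt_sinh t).arctan.const_mul (2 / √(a ^ 2 + 4)))).congr_deriv ?_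
    have hs : 0 < √(f t ^ 2 + 4) := by positivity
    have hs' : 0 < √(a ^ 2 + 4) := by positivity
    have e : 1 + (deriv f t * √(f t ^ 2 + 4) / 2) ^ 2 = f t ^ 2 / a ^ 2 := by
      rw [eq_div_iff (by positivity), mul_comm]; exact (h.sq_eq t).symm
    rw [e, Catenoid.weight]
    field_simp
    ring
  have hmono : Monotone fun t => Catenoid.conformal a f t -
      2 / √(a ^ 2 + 4) * Real.arctan (deriv f t * √(f t ^ 2 + 4) / 2) := by
    refine monotone_of_deriv_nonneg (fun t => (hd t).differentiableAt) fun t => ?_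
    rw [(hd t).deriv, sub_nonneg]
    have hf := h.pos t
    have hle := h.le_apply t
    have key : a * √(f t ^ 2 + 4) ≤ √(a ^ 2 + 4) * f t := by
      refine abs_le_of_sq_le_sq' ?_ (by positivity) |>.2
      rw [mul_pow, mul_pow, Real.sq_sqrt (by positivity), Real.sq_sqrt (by positivity)]
      nlinarith
    refine div_le_div_of_nonneg_left (by norm_num) (by positivity) ?_
    calc a * (f t ^ 2 + 4) = a * √(f t ^ 2 + 4) * √(f t ^ 2 + 4) := by
          rw [mul_assoc, Real.mul_self_sqrt (by positivity)]
      _ ≤ √(a ^ 2 + 4) * f t * √(f t ^ 2 + 4) := by gcongr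
      _ = _ := by ring
  have := hmono ht
  simp only [h.init', zero_mul, zero_div, Real.arctan_zero, mul_zero, sub_zero] at this
  simp only [Catenoid.conformal, intervalIntegral.integral_same] at this ⊢
  linarith

theorem exists_conformal_eq (h : IsCatenoidProfile a f) {μ : ℝ} (hμ : √(a ^ 2 + 4) / 2 < μ) :
    ∃ s > 0, μ * Catenoid.conformal a f s = Real.pi / 2 := by
  have hs' : 0 < √(a ^ 2 + 4) := by positivity
  have hμ0 : 0 < μ := lt_trans (by positivity) hμ
  have hX : Tendsto (fun t => deriv f t * √(f t ^ 2 + 4) / 2) atTop atTop := by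
    have hd := h.deriv_pos one_pos
    refine tendsto_atTop_mono' _ ?_ (h.tendsto_atTop.const_mul_atTop (half_pos hd))
    filter_upwards [eventually_ge_atTop 1] with t ht
    have h2 := h.strictMono_deriv.monotone ht
    have h3 : f t ≤ √(f t ^ 2 + 4) := Real.le_sqrt_of_sq_le (by linarith)
    have := h.pos t
    have := hd.trans_le h2
    have : deriv f 1 * f t ≤ deriv f t * √(f t ^ 2 + 4) := by gcongr
    linarith
  have hlim : Tendsto (fun t => μ * (2 / √(a ^ 2 + 4) *
      Real.arctan (deriv f t * √(f t ^ 2 + 4) / 2))) atTop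
      (𝓝 (μ * (2 / √(a ^ 2 + 4) * (Real.pi / 2)))) :=
    (((Real.tendsto_arctan_atTop.mono_right nhdsWithin_le_nhds).comp hX).const_mul _).const_mul _
  have hgt : Real.pi / 2 < μ * (2 / √(a ^ 2 + 4) * (Real.pi / 2)) := by
    have h1 : 1 < μ * (2 / √(a ^ 2 + 4)) := by
      rw [mul_div_assoc', one_lt_div hs']; linarith
    nlinarith [Real.pi_pos]
  obtain ⟨t, ht, ht0⟩ := ((hlim.eventually_const_lt hgt).and (eventually_ge_atTop 0)).exists
  have hc : Continuous fun t => μ * Catenoid.conformal a f t :=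
    continuous_const.mul (continuous_iff_continuousAt.2 fun t =>
      (h.hasDerivAt_conformal t).continuousAt)
  have h0 : Catenoid.conformal a f 0 = 0 := by simp [Catenoid.conformal]
  obtain ⟨s, hs, hps⟩ := intermediate_value_Icc ht0 hc.continuousOn
    (show Real.pi / 2 ∈ Icc (μ * Catenoid.conformal a f 0) (μ * Catenoid.conformal a f t) from
      ⟨by rw [h0, mul_zero]; exact Real.pi_div_two_pos.le,
        ht.le.trans (mul_le_mul_of_nonneg_left (h.arctan_le_conformal ht0) hμ0.le)⟩)
  refine ⟨s, lt_of_le_of_ne hs.1 fun hs0 => ?_, hps⟩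
  simp only [← hs0, h0, mul_zero] at hps
  exact Real.pi_div_two_pos.ne hps

/-- A comparison function for the modes of order at most `K`, with a zero: for `K = 1` from the
translations of `Nil₃`, and for `K² < 3a²/4 - 1` by comparing the potential with the constant
`a²` and the conformal length with `2π / √(a² + 4)`. -/
theorem exists_comparison (h : IsCatenoidProfile a f) {K : ℕ}
    (hK : K = 1 ∨ (K : ℝ) ^ 2 < 3 * a ^ 2 / 4 - 1) :
    ∃ r z Z : ℝ → ℝ, (∀ t, HasDerivAt z (Catenoid.weight a f t * Z t) t) ∧
      (∀ t, HasDerivAt Z (-(r t * z t)) t) ∧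
      (∀ t, r t ≤ Catenoid.weight a f t * (Catenoid.potential a f t - (K : ℝ) ^ 2)) ∧
      0 < z 0 ∧ Z 0 = 0 ∧ ∃ s > 0, z s ≤ 0 := by
  rcases hK with rfl | hK
  · refine ⟨_, _, _, h.hasDerivAt_translation, h.hasDerivAt_translation_flux, fun t => by simp,
      ?_, ?_, h.exists_translation_nonpos⟩
    · simpa [h.init'] using h.pos 0
    · simp [h.init']
  · set μ := √(a ^ 2 - (K : ℝ) ^ 2) with hμ
    have ha := h.a_pos
    have hpos : 0 < a ^ 2 - (K : ℝ) ^ 2 := by nlinarith [sq_nonneg a]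
    have hμsq : μ ^ 2 = a ^ 2 - (K : ℝ) ^ 2 := Real.sq_sqrt hpos.le
    have hμgt : √(a ^ 2 + 4) / 2 < μ := by
      rw [hμ, div_lt_iff₀ two_pos, Real.sqrt_lt' (by positivity), mul_pow, ← hμ, hμsq]
      linarith
    obtain ⟨s, hs, hsz⟩ := h.exists_conformal_eq hμgt
    have h0 : Catenoid.conformal a f 0 = 0 := by simp [Catenoid.conformal]
    refine ⟨fun t => Catenoid.weight a f t * μ ^ 2, fun t => Real.cos (μ * Catenoid.conformal a f t),
      fun t => -(μ * Real.sin (μ * Catenoid.conformal a f t)), fun t => ?_, fun t => ?_, fun t => ?_,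
      by simp [h0], by simp [h0], s, hs, ?_⟩
    · exact ((h.hasDerivAt_conformal t).const_mul μ).cos.congr_deriv (by ring)
    · exact (((h.hasDerivAt_conformal t).const_mul μ).sin.const_mul μ).neg.congr_deriv (by ring)
    · have h1 := h.weight_pos t
      have h2 := h.le_potential t
      simp only
      gcongr
      linarith
    · simp [hsz]

end IsCatenoidProfile

/-! ### The Dirichlet problem on the bands `|t| < T` -/

/-- The part `|t| < T` of a surface of revolution. -/
def band (f : ℝ → ℝ) (T : ℝ) : Set (Fin 3 → ℝ) := revolutionSurface f '' {p | |p 0| < T}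

theorem mem_band {f : ℝ → ℝ} {T : ℝ} {p : Fin 2 → ℝ} :
    revolutionSurface f p ∈ band f T ↔ |p 0| < T := by
  refine ⟨fun ⟨q, hq, hqp⟩ => ?_, fun hp => ⟨p, hp, rfl⟩⟩
  have : q 0 = p 0 := by simpa [revolutionSurface] using congrFun hqp 2
  rwa [← this]

theorem preimage_band (f : ℝ → ℝ) (T : ℝ) : revolutionSurface f ⁻¹' band f T = {p | |p 0| < T} :=
  Set.ext fun _ => mem_band

theorem isOpen_preimage_band (f : ℝ → ℝ) (T : ℝ) : IsOpen (revolutionSurface f ⁻¹' band f T) := by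
  rw [preimage_band]
  exact isOpen_lt (by fun_prop) continuous_const

theorem continuous_revolutionSurface {f : ℝ → ℝ} (hf : Continuous f) :
    Continuous (revolutionSurface f) := by
  refine continuous_pi fun i => ?_
  fin_cases i <;> simp [revolutionSurface] <;> fun_prop

theorem IsPeriodic.factorsThrough {f : ℝ → ℝ} (hf : ∀ t, 0 < f t) {u : (Fin 2 → ℝ) → ℝ}
    (hu : IsPeriodic u) : Function.FactorsThrough u (revolutionSurface f) := by
  intro p q hpq
  have h0 : p 0 = q 0 := by simpa [revolutionSurface] using congrFun hpq 2
  have h1 : Real.cos (p 1) = Real.cos (q 1) := by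
    have := congrFun hpq 0
    simp only [revolutionSurface, Matrix.cons_val_zero, h0] at this
    exact mul_left_cancel₀ (hf _).ne' this
  have h2 : Real.sin (p 1) = Real.sin (q 1) := by
    have := congrFun hpq 1
    simp only [revolutionSurface, Matrix.cons_val_one, Matrix.cons_val_zero, h0] at this
    exact mul_left_cancel₀ (hf _).ne' this
  obtain ⟨k, hk⟩ := Real.Angle.angle_eq_iff_two_pi_dvd_sub.1 (Real.Angle.cos_sin_inj h1 h2)
  have hper : Function.Periodic (fun θ => u ![q 0, θ]) (2 * Real.pi) := hu (q 0)
  have := hper.int_mul k (q 1)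
  rw [← vec_eta p, ← vec_eta q, h0, show p 1 = q 1 + k * (2 * Real.pi) by linarith]
  exact this

theorem band_eq_image {f : ℝ → ℝ} (T : ℝ) :
    band f T = revolutionSurface f '' {p | |p 0| < T ∧ p 1 ∈ Icc 0 (2 * Real.pi)} := by
  refine subset_antisymm ?_ (image_mono fun p hp => hp.1)
  rintro _ ⟨p, hp, rfl⟩
  have hper : Function.Periodic (fun θ => revolutionSurface f ![p 0, θ]) (2 * Real.pi) :=
    revolutionSurface_add_two_pi f (p 0)
  obtain ⟨θ, hθ, he⟩ := hper.exists_mem_Ico₀ Real.two_pi_pos (p 1)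
  refine ⟨![p 0, θ], ⟨by simpa using hp, by simpa using Ico_subset_Icc_self hθ⟩, ?_⟩
  simp only [vec_eta] at he
  exact he.symm

theorem isRegularDomain_band {f : ℝ → ℝ} (hf : Continuous f) {T : ℝ} (hT : 0 < T) :
    IsRegularDomain (revolutionSurface f) (band f T) := by
  have hF := continuous_revolutionSurface hf
  have hK : IsCompact (revolutionSurface f '' Icc ![-T, 0] ![T, 2 * Real.pi]) :=
    isCompact_Icc.image hF
  have hcl : closure (band f T) ⊆ revolutionSurface f '' Icc ![-T, 0] ![T, 2 * Real.pi] := by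
    refine closure_minimal ?_ hK.isClosed
    rw [band_eq_image]
    refine image_mono fun p hp => ?_
    obtain ⟨h1, h2, h3⟩ := hp
    have h4 := abs_lt.1 h1
    constructor <;> intro i <;> fin_cases i <;> simp <;> linarith
  refine ⟨?_, isOpen_preimage_band f T, hK.of_isClosed_subset isClosed_closure hcl,
    hcl.trans (image_subset_range _ _), ?_⟩
  · refine IsConnected.image ⟨⟨0, by simpa using hT⟩, ?_⟩ _ hF.continuousOn
    refine Convex.isPreconnected fun p hp q hq s t hs ht hst => ?_
    simp only [mem_ofPred_eq, Pi.add_apply, Pi.smul_apply, smul_eq_mul, abs_lt] at hp hq ⊢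
    have := (convex_Ioo (-T) T) hp hq hs ht hst
    simpa using this
  · intro p hp
    rw [preimage_band] at hp
    have hpT : |p 0| = T := frontier_lt_subset_eq (f := fun p : Fin 2 → ℝ => |p 0|)
      (g := fun _ => T) (by fun_prop) continuous_const hp
    refine ⟨univ, univ_mem, fun q => q 0 ^ 2 - T ^ 2, by fun_prop, fun h0 => ?_, fun q _ => ?_⟩
    · have hd : DifferentiableAt ℝ (fun q : Fin 2 → ℝ => q 0 ^ 2 - T ^ 2) ![p 0, p 1] := by fun_prop
      have h1 := hasDerivAt_vec_zero hd
      have h2 : HasDerivAt (fun s : ℝ => s ^ 2 - T ^ 2) (2 * p 0) (p 0) := by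
        simpa using (hasDerivAt_pow 2 (p 0)).sub_const (T ^ 2)
      have h3 := h1.unique h2
      rw [vec_eta, partialD, h0] at h3
      have : p 0 = 0 := by simpa using h3.symm
      rw [this, abs_zero] at hpT
      exact hT.ne hpT
    · rw [preimage_band, mem_ofPred_eq, sub_neg, sq_lt_sq, abs_of_pos hT]

theorem tendsto_eLpNorm_of_bounded {α : Type*} [MeasurableSpace α] {μ : Measure α}
    [IsFiniteMeasure μ] {g : ℕ → α → ℝ} (hm : ∀ n, AEStronglyMeasurable (g n) μ) {C : ℝ}
    (hC : ∀ n, ∀ᵐ p ∂μ, ‖g n p‖ ≤ C) (hlim : ∀ᵐ p ∂μ, Tendsto (fun n => g n p) atTop (𝓝 0)) :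
    Tendsto (fun n => eLpNorm (g n) 2 μ) atTop (𝓝 0) := by
  have h1 : Tendsto (fun n => ∫⁻ p, ‖g n p‖ₑ ^ (2 : ℝ) ∂μ) atTop (𝓝 (∫⁻ _, 0 ∂μ)) := by
    refine tendsto_lintegral_of_dominated_convergence' (fun _ => ENNReal.ofReal C ^ (2 : ℝ))
      (fun n => (hm n).enorm.pow_const _) (fun n => ?_) ?_ ?_
    · filter_upwards [hC n] with p hp
      gcongr
      rw [← ofReal_norm]
      exact ENNReal.ofReal_le_ofReal hp
    · rw [lintegral_const]
      exact ENNReal.mul_ne_top (ENNReal.rpow_ne_top_of_nonneg (by norm_num) ENNReal.ofReal_ne_top)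
        (measure_ne_top _ _)
    · filter_upwards [hlim] with p hp
      have := (hp.enorm).ennrpow_const 2
      simpa using this
  have h2 : ∀ n, eLpNorm (g n) 2 μ = (∫⁻ p, ‖g n p‖ₑ ^ (2 : ℝ) ∂μ) ^ (1 / 2 : ℝ) := fun n => by
    rw [eLpNorm_eq_lintegral_rpow_enorm_toReal (by norm_num) (by norm_num)]
    simp
  simp only [h2]
  have := h1.ennrpow_const (1 / 2)
  simpa using this

theorem deriv_smoothTransition_of_one_lt {y : ℝ} (hy : 1 < y) :
    deriv Real.smoothTransition y = 0 := by
  have : Real.smoothTransition =ᶠ[𝓝 y] fun _ => 1 := by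
    filter_upwards [Ioi_mem_nhds hy] with x hx
    exact Real.smoothTransition.one_of_one_le (le_of_lt hx)
  rw [this.deriv_eq]; simp

theorem exists_deriv_smoothTransition_bound :
    ∃ D, ∀ y : ℝ, |deriv Real.smoothTransition y| * |y + 1| ≤ D := by
  have hc : Continuous fun y => |deriv Real.smoothTransition y| * |y + 1| := by
    have : Continuous (deriv Real.smoothTransition) :=
      (Real.smoothTransition.contDiff (n := 1)).continuous_deriv le_rfl
    fun_prop
  obtain ⟨D, hD⟩ := isCompact_Icc.exists_bound_of_continuousOn (s := Icc 0 1) hc.continuousOn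
  refine ⟨max D 0, fun y => ?_⟩
  by_cases hy : y ∈ Icc (0 : ℝ) 1
  · exact (le_abs_self _).trans ((hD y hy).trans (le_max_left _ _))
  · have : deriv Real.smoothTransition y = 0 := by
      rw [mem_Icc, not_and_or, not_le, not_le] at hy
      rcases hy with hy | hy
      · have : Real.smoothTransition =ᶠ[𝓝 y] fun _ => 0 := by
          filter_upwards [Iio_mem_nhds hy] with x hx
          exact Real.smoothTransition.zero_of_nonpos (le_of_lt hx)
        rw [this.deriv_eq]; simp
      · exact deriv_smoothTransition_of_one_lt hy
    simp [this]

namespace IsCatenoidProfile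

variable {a : ℝ} {f : ℝ → ℝ} {T : ℝ}

/-- A smooth function vanishing on the boundary of a band belongs to `H¹₀`: it is approximated by
its products with the cut-offs `smoothTransition (n (T² - t²) - 1)`, whose derivatives are of
order `n` only where the function is of order `1 / n`. -/
theorem isH10_band (h : IsCatenoidProfile a f) (hT : 0 < T) {v : (Fin 2 → ℝ) → ℝ}
    (hv : ContDiff ℝ ∞ v) (hvp : IsPeriodic v) {C : ℝ} (hC0 : 0 ≤ C)
    (hC : ∀ p : Fin 2 → ℝ, |p 0| < T → |v p| ≤ C * (T ^ 2 - p 0 ^ 2)) :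
    IsH10 (revolutionSurface f) (band f T) ((h.memLp_of_continuous (isOpen_preimage_band f T)
      (fun _ => mem_band.1) hv.continuous).toLp v) := by
  have hΩo := isOpen_preimage_band f T
  have hΩ : ∀ p, revolutionSurface f p ∈ band f T → |p 0| < T := fun _ => mem_band.1
  have hfin := h.isFiniteMeasure_domainMeasure hΩ
  have hwm : ∀ i, MemLp (partialD i v) 2 (domainMeasure (revolutionSurface f) (band f T)) :=
    fun i => h.memLp_of_continuous hΩo hΩ (contDiff_partialD hv i).continuous
  have hae : ∀ᵐ p ∂(domainMeasure (revolutionSurface f) (band f T)), |p 0| < T := by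
    filter_upwards [h.ae_domainMeasure hΩo] with p hp using hΩ p hp.2
  set η : ℕ → (Fin 2 → ℝ) → ℝ := fun n p =>
    Real.smoothTransition (n * (T ^ 2 - p 0 ^ 2) - 1) with hη
  have hηs : ∀ n, ContDiff ℝ ∞ (η n) := fun n =>
    (Real.smoothTransition.contDiff (n := ⊤)).comp (by fun_prop)
  have hφs : ∀ n, ContDiff ℝ ∞ fun p => η n p * v p := fun n => (hηs n).mul hv
  have hη01 : ∀ n p, |η n p - 1| ≤ 1 := fun n p => by
    have h1 := Real.smoothTransition.nonneg (n * (T ^ 2 - p 0 ^ 2) - 1)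
    have h2 := Real.smoothTransition.le_one (n * (T ^ 2 - p 0 ^ 2) - 1)
    rw [abs_le]; constructor <;> simp only [hη] <;> linarith
  have hlarge : ∀ p : Fin 2 → ℝ, |p 0| < T → ∀ᶠ n : ℕ in atTop,
      1 < (n : ℝ) * (T ^ 2 - p 0 ^ 2) - 1 := fun p hp => by
    have hpos : 0 < T ^ 2 - p 0 ^ 2 := by
      rw [sub_pos, sq_lt_sq]; exact hp.trans_le (le_abs_self T)
    filter_upwards [(tendsto_natCast_atTop_atTop.atTop_mul_const hpos).eventually_gt_atTop 2]
      with n hn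
    linarith
  have hη1 : ∀ p : Fin 2 → ℝ, |p 0| < T → ∀ᶠ n in atTop, η n p = 1 := fun p hp => by
    filter_upwards [hlarge p hp] with n hn using Real.smoothTransition.one_of_one_le hn.le
  have hd0 : ∀ n p, partialD 0 (fun p => η n p * v p) p = η n p * partialD 0 v p +
      deriv Real.smoothTransition (n * (T ^ 2 - p 0 ^ 2) - 1) * (n * (-2 * p 0)) * v p := by
    intro n p
    have h1 := hasDerivAt_vec_zero (t := p 0) (θ := p 1) ((hφs n).differentiable (by simp) _)
    have h2 := hasDerivAt_vec_zero (t := p 0) (θ := p 1) (hv.differentiable (by simp) _)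
    have h3 : HasDerivAt (fun s : ℝ => Real.smoothTransition (n * (T ^ 2 - s ^ 2) - 1))
        (deriv Real.smoothTransition (n * (T ^ 2 - p 0 ^ 2) - 1) * (n * (-2 * p 0))) (p 0) := by
      have h4 : HasDerivAt (fun s : ℝ => n * (T ^ 2 - s ^ 2) - 1) (n * (-2 * p 0)) (p 0) := by
        refine ((((hasDerivAt_pow 2 (p 0)).const_sub (T ^ 2)).const_mul (n : ℝ)).sub_const
          1).congr_deriv ?_
        simp
      exact ((Real.smoothTransition.contDiff (n := 1)).differentiable (by simp)
        _).hasDerivAt.comp (p 0) h4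
    have := h1.unique (h3.mul h2)
    rw [vec_eta] at this
    rw [this, hη]
    ring
  have hd1 : ∀ n p, partialD 1 (fun p => η n p * v p) p = η n p * partialD 1 v p := by
    intro n p
    have h1 := hasDerivAt_vec_one (t := p 0) (θ := p 1) ((hφs n).differentiable (by simp) _)
    have h2 := hasDerivAt_vec_one (t := p 0) (θ := p 1) (hv.differentiable (by simp) _)
    have := h1.unique (h2.const_mul (Real.smoothTransition (n * (T ^ 2 - p 0 ^ 2) - 1)))
    rw [vec_eta] at this
    rw [this, hη]
  have hcut : ∀ {g : (Fin 2 → ℝ) → ℝ}, Continuous g → Tendsto (fun n =>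
      eLpNorm (fun p => η n p * g p - g p) 2 (domainMeasure (revolutionSurface f) (band f T)))
      atTop (𝓝 0) := fun {g} hg => by
    obtain ⟨B, hB⟩ := h.exists_ae_bound hΩo hΩ hg
    refine tendsto_eLpNorm_of_bounded (fun n => (((hηs n).continuous.mul hg).sub
      hg).aestronglyMeasurable) (C := B) (fun n => ?_) ?_
    · filter_upwards [hB] with p hp
      have e : η n p * g p - g p = (η n p - 1) * g p := by ring
      rw [e, norm_mul]
      calc _ ≤ 1 * ‖g p‖ := by gcongr; exact hη01 n p
        _ ≤ B := by rwa [one_mul]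
    · filter_upwards [hae] with p hp
      refine tendsto_const_nhds.congr' ?_
      filter_upwards [hη1 p hp] with n hn
      rw [hn]; ring
  have hcoe : ∀ {g : (Fin 2 → ℝ) → ℝ} (G : (Fin 2 → ℝ) → ℝ)
      (hg : MemLp g 2 (domainMeasure (revolutionSurface f) (band f T))),
      eLpNorm (fun p => G p - hg.toLp g p) 2 (domainMeasure (revolutionSurface f) (band f T)) =
      eLpNorm (fun p => G p - g p) 2 (domainMeasure (revolutionSurface f) (band f T)) :=
    fun G hg => eLpNorm_congr_ae (by
      filter_upwards [hg.coeFn_toLp] with p hp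
      rw [hp])
  refine ⟨fun n p => η n p * v p, fun i => (hwm i).toLp _, fun n => ⟨hφs n,
    IsPeriodic.factorsThrough h.pos fun t θ => ?_, ?_⟩, ?_, fun i => ?_⟩
  · simp only [hη]; rw [hvp]; simp
  · have hcl : IsClosed {p : Fin 2 → ℝ | 1 ≤ (n : ℝ) * (T ^ 2 - p 0 ^ 2)} :=
      isClosed_le continuous_const (by fun_prop)
    refine (closure_minimal (fun p hp => ?_) hcl).trans fun p hp => ?_
    · by_contra hlt
      rw [mem_ofPred_eq, not_le] at hlt
      refine hp ?_
      simp only [hη]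
      rw [Real.smoothTransition.zero_of_nonpos (by linarith), zero_mul]
    · rw [mem_ofPred_eq] at hp
      have hn : (0 : ℝ) ≤ n := Nat.cast_nonneg n
      refine mem_band.2 ?_
      have hpos : 0 < T ^ 2 - p 0 ^ 2 := by
        by_contra! hle
        nlinarith
      rw [← abs_of_pos hT]
      exact sq_lt_sq.1 (by linarith)
  · simp only [hcoe]
    exact hcut hv.continuous
  · simp only [hcoe]
    fin_cases i
    · simp only [Fin.zero_eta, hd0]
      obtain ⟨B, hB⟩ := h.exists_ae_bound hΩo hΩ (contDiff_partialD hv 0).continuous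
      obtain ⟨D, hD⟩ := exists_deriv_smoothTransition_bound
      refine tendsto_eLpNorm_of_bounded (fun n => ?_) (C := B + D * (2 * T * C)) (fun n => ?_) ?_
      · have h1 : Continuous fun p => partialD 0 (fun p => η n p * v p) p :=
          (contDiff_partialD (hφs n) 0).continuous
        simp only [hd0] at h1
        exact (h1.sub (contDiff_partialD hv 0).continuous).aestronglyMeasurable
      · filter_upwards [hB, hae] with p hp hpT
        set y : ℝ := n * (T ^ 2 - p 0 ^ 2) - 1 with hy
        have e : η n p * partialD 0 v p + deriv Real.smoothTransition y * (n * (-2 * p 0)) * v p -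
            partialD 0 v p = (η n p - 1) * partialD 0 v p +
            deriv Real.smoothTransition y * (n * (-2 * p 0)) * v p := by ring
        have h1 : ‖(η n p - 1) * partialD 0 v p‖ ≤ B := by
          rw [norm_mul]
          calc _ ≤ 1 * ‖partialD 0 v p‖ := by gcongr; exact hη01 n p
            _ ≤ B := by rwa [one_mul]
        have h2 : ‖deriv Real.smoothTransition y * (n * (-2 * p 0)) * v p‖ ≤ D * (2 * T * C) := by
          have hpos : 0 < T ^ 2 - p 0 ^ 2 := by
            rw [sub_pos, sq_lt_sq, abs_of_pos hT]; exact hpT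
          have hy1 : |y + 1| = n * (T ^ 2 - p 0 ^ 2) := by
            rw [hy, sub_add_cancel, abs_of_nonneg (by positivity)]
          have hDy := hD y
          rw [hy1] at hDy
          have hle : |p 0| * |v p| ≤ T * (C * (T ^ 2 - p 0 ^ 2)) := by
            gcongr
            exact hC p hpT
          calc _ = |deriv Real.smoothTransition y| * (n * 2) * (|p 0| * |v p|) := by
                simp only [Real.norm_eq_abs, abs_mul, abs_neg, Nat.abs_cast, abs_two]; ring
            _ ≤ |deriv Real.smoothTransition y| * (n * 2) * (T * (C * (T ^ 2 - p 0 ^ 2))) := by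
                gcongr
            _ = |deriv Real.smoothTransition y| * (n * (T ^ 2 - p 0 ^ 2)) * (2 * T * C) := by ring
            _ ≤ _ := by gcongr
        rw [e]
        exact (norm_add_le _ _).trans (add_le_add h1 h2)
      · filter_upwards [hae] with p hp
        refine tendsto_const_nhds.congr' ?_
        filter_upwards [hη1 p hp, hlarge p hp] with n hn hl
        rw [hn, deriv_smoothTransition_of_one_lt hl]; ring
    · simp only [Fin.mk_one, hd1]
      exact hcut (contDiff_partialD hv 1).continuous

end IsCatenoidProfile

/-! ### Eigenfunctions on the bands -/

/-- The function `u(t) cos (k (θ - χ(t)) - c)`, where `χ` is the phase: the twist by `χ` separates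
the variables in the Jacobi equation. -/
def angularMode (f u : ℝ → ℝ) (k : ℕ) (c : ℝ) (p : Fin 2 → ℝ) : ℝ :=
  u (p 0) * Real.cos (k * (p 1 - phase f (p 0)) - c)

theorem isPeriodic_angularMode (f u : ℝ → ℝ) (k : ℕ) (c : ℝ) : IsPeriodic (angularMode f u k c) := by
  intro t θ
  have e : k * (θ + 2 * Real.pi - phase f t) - c = k * (θ - phase f t) - c + k * (2 * Real.pi) := by
    ring
  simp only [angularMode, Matrix.cons_val_zero, Matrix.cons_val_one]
  rw [e, Real.cos_add_nat_mul_two_pi]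

theorem partialD_zero_of_hasDerivAt {u : (Fin 2 → ℝ) → ℝ} (hu : Differentiable ℝ u) {t θ d : ℝ}
    (hd : HasDerivAt (fun s => u ![s, θ]) d t) : partialD 0 u ![t, θ] = d :=
  (hasDerivAt_vec_zero (hu _)).unique hd

theorem partialD_one_of_hasDerivAt {u : (Fin 2 → ℝ) → ℝ} (hu : Differentiable ℝ u) {t θ d : ℝ}
    (hd : HasDerivAt (fun s => u ![t, s]) d θ) : partialD 1 u ![t, θ] = d :=
  (hasDerivAt_vec_one (hu _)).unique hd

theorem integral_cos_int_mul_sub {n : ℤ} (hn : n ≠ 0) (γ : ℝ) :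
    ∫ θ in (0 : ℝ)..(2 * Real.pi), Real.cos (n * θ - γ) = 0 := by
  have hn' : (n : ℝ) ≠ 0 := by exact_mod_cast hn
  have hd : ∀ θ : ℝ, HasDerivAt (fun θ => Real.sin (n * θ - γ) / n) (Real.cos (n * θ - γ)) θ :=
    fun θ => by
      refine ((((hasDerivAt_id θ).const_mul (n : ℝ)).sub_const γ).sin.div_const (n : ℝ)).congr_deriv ?_
      field_simp
      simp
  rw [intervalIntegral.integral_eq_sub_of_hasDerivAt (fun θ _ => hd θ)
    (Continuous.intervalIntegrable (by fun_prop) _ _)]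
  rw [show n * (2 * Real.pi) - γ = n * 0 - γ + n * (2 * Real.pi) by ring,
    Real.sin_add_int_mul_two_pi, sub_self]

theorem integral_cos_mul_cos (k l : ℕ) (γ δ : ℝ) :
    ∫ θ in (0 : ℝ)..(2 * Real.pi), Real.cos (k * θ - γ) * Real.cos (l * θ - δ) =
      (∫ θ in (0 : ℝ)..(2 * Real.pi), Real.cos (((k : ℤ) - l : ℤ) * θ - (γ - δ))) / 2 +
      (∫ θ in (0 : ℝ)..(2 * Real.pi), Real.cos (((k : ℤ) + l : ℤ) * θ - (γ + δ))) / 2 := by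
  rw [← intervalIntegral.integral_div, ← intervalIntegral.integral_div,
    ← intervalIntegral.integral_add (Continuous.intervalIntegrable (by fun_prop) _ _)
      (Continuous.intervalIntegrable (by fun_prop) _ _)]
  refine intervalIntegral.integral_congr fun θ _ => ?_
  have e1 : (((k : ℤ) - l : ℤ) : ℝ) * θ - (γ - δ) = (k * θ - γ) - (l * θ - δ) := by push_cast; ring
  have e2 : (((k : ℤ) + l : ℤ) : ℝ) * θ - (γ + δ) = (k * θ - γ) + (l * θ - δ) := by push_cast; ring
  rw [e1, e2, Real.cos_sub (k * θ - γ), Real.cos_add (k * θ - γ)]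
  ring

theorem integral_cos_mul_cos_of_ne {k l : ℕ} (hkl : k ≠ l) (γ δ : ℝ) :
    ∫ θ in (0 : ℝ)..(2 * Real.pi), Real.cos (k * θ - γ) * Real.cos (l * θ - δ) = 0 := by
  rw [integral_cos_mul_cos, integral_cos_int_mul_sub (by omega), integral_cos_int_mul_sub (by omega)]
  simp

theorem integral_cos_mul_cos_self {k : ℕ} (hk : 0 < k) (γ δ : ℝ) :
    ∫ θ in (0 : ℝ)..(2 * Real.pi), Real.cos (k * θ - γ) * Real.cos (k * θ - δ) =
      Real.pi * Real.cos (γ - δ) := by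
  rw [integral_cos_mul_cos, integral_cos_int_mul_sub (n := (k : ℤ) + k) (by omega),
    ← Real.cos_neg (γ - δ)]
  simp
  ring

namespace IsCatenoidProfile

variable {a : ℝ} {f : ℝ → ℝ} {T : ℝ}

theorem contDiff_angularMode (h : IsCatenoidProfile a f) {u : ℝ → ℝ} (hu : ContDiff ℝ ∞ u) (k : ℕ)
    (c : ℝ) : ContDiff ℝ ∞ (angularMode f u k c) := by
  have h1 := h.contDiff_phase
  have h2 : ContDiff ℝ ∞ fun p : Fin 2 → ℝ => p 0 := contDiff_apply ℝ ℝ 0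
  have h3 : ContDiff ℝ ∞ fun p : Fin 2 → ℝ => p 1 := contDiff_apply ℝ ℝ 1
  exact (hu.comp h2).mul (((contDiff_const.mul (h3.sub (h1.comp h2))).sub contDiff_const).cos)

theorem jacobiOp_angularMode (h : IsCatenoidProfile a f) {u U : ℝ → ℝ} (hu : ContDiff ℝ ∞ u)
    (hUs : ContDiff ℝ ∞ U) {k : ℕ} {lam : ℝ}
    (hd : ∀ t, HasDerivAt u (Catenoid.weight a f t * U t) t)
    (hU : ∀ t, HasDerivAt U (-((Catenoid.weight a f t *
      (Catenoid.potential a f t - (k : ℝ) ^ 2) + lam * (f t ^ 2 / a)) * u t)) t)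
    (c : ℝ) (p : Fin 2 → ℝ) :
    jacobiOp (revolutionSurface f) (angularMode f u k c) p = lam * angularMode f u k c p := by
  have ha := h.a_pos
  have hf := h.pos
  have hv := h.contDiff_angularMode hu k c
  have hv' := hv.differentiable (by simp)
  have hψ : ∀ t θ, HasDerivAt (fun s => k * (θ - phase f s) - c) (k * (-(2 / (f t ^ 2 + 4)))) t :=
    fun t θ => (((h.hasDerivAt_phase t).const_sub θ).const_mul (k : ℝ)).sub_const c
  have hψ1 : ∀ t θ : ℝ, HasDerivAt (fun s => k * (s - phase f t) - c) k θ := fun t θ => by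
    simpa using (((hasDerivAt_id θ).sub_const (phase f t)).const_mul (k : ℝ)).sub_const c
  have h0 : ∀ q : Fin 2 → ℝ, partialD 0 (angularMode f u k c) q =
      Catenoid.weight a f (q 0) * U (q 0) * Real.cos (k * (q 1 - phase f (q 0)) - c) +
      u (q 0) * (k * (2 / (f (q 0) ^ 2 + 4))) * Real.sin (k * (q 1 - phase f (q 0)) - c) := fun q => by
    conv_lhs => rw [← vec_eta q]
    refine partialD_zero_of_hasDerivAt hv' (((hd (q 0)).mul (hψ (q 0) (q 1)).cos).congr_deriv ?_)
    ring
  have h1 : ∀ q : Fin 2 → ℝ, partialD 1 (angularMode f u k c) q =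
      -(k * u (q 0) * Real.sin (k * (q 1 - phase f (q 0)) - c)) := fun q => by
    conv_lhs => rw [← vec_eta q]
    refine partialD_one_of_hasDerivAt hv' (((hψ1 (q 0) (q 1)).cos.const_mul (u (q 0))).congr_deriv ?_)
    ring
  have e0 : (fun q : Fin 2 → ℝ => Catenoid.radial a f (q 0) * partialD 0 (angularMode f u k c) q +
      a / 2 * partialD 1 (angularMode f u k c) q) = angularMode f U k c := funext fun q => by
    have := hf (q 0)
    rw [h0, h1, angularMode, Catenoid.radial, Catenoid.weight]
    field_simp
    ring
  have e1 : (fun q : Fin 2 → ℝ => a / 2 * partialD 0 (angularMode f u k c) q +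
      Catenoid.angular a f (q 0) * partialD 1 (angularMode f u k c) q) = fun q =>
      Catenoid.weight a f (q 0) * (a / 2 * U (q 0) * Real.cos (k * (q 1 - phase f (q 0)) - c) -
        k * u (q 0) * Real.sin (k * (q 1 - phase f (q 0)) - c)) := funext fun q => by
    have := hf (q 0)
    rw [h0, h1, Catenoid.angular, Catenoid.weight]
    field_simp
    ring
  have hs1 := (h.contDiff_flux hv).2.differentiable (by simp)
  have key := h.jacobiOp_eq (angularMode f u k c) p
  rw [e1] at hs1
  rw [e0, e1] at key
  have d0 : partialD 0 (angularMode f U k c) p = -((Catenoid.weight a f (p 0) *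
      (Catenoid.potential a f (p 0) - (k : ℝ) ^ 2) + lam * (f (p 0) ^ 2 / a)) * u (p 0)) *
      Real.cos (k * (p 1 - phase f (p 0)) - c) +
      U (p 0) * (k * (2 / (f (p 0) ^ 2 + 4))) * Real.sin (k * (p 1 - phase f (p 0)) - c) := by
    conv_lhs => rw [← vec_eta p]
    refine partialD_zero_of_hasDerivAt ((h.contDiff_angularMode hUs k c).differentiable (by simp))
      (((hU (p 0)).mul (hψ (p 0) (p 1)).cos).congr_deriv ?_)
    ring
  have d1 : partialD 1 (fun q : Fin 2 → ℝ =>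
      Catenoid.weight a f (q 0) * (a / 2 * U (q 0) * Real.cos (k * (q 1 - phase f (q 0)) - c) -
        k * u (q 0) * Real.sin (k * (q 1 - phase f (q 0)) - c))) p = Catenoid.weight a f (p 0) *
      (-(a / 2 * U (p 0) * (k * Real.sin (k * (p 1 - phase f (p 0)) - c))) -
        k * u (p 0) * (k * Real.cos (k * (p 1 - phase f (p 0)) - c))) := by
    conv_lhs => rw [← vec_eta p]
    refine partialD_one_of_hasDerivAt hs1 (((((hψ1 (p 0) (p 1)).cos.const_mul
      (a / 2 * U (p 0))).sub ((hψ1 (p 0) (p 1)).sin.const_mul (k * u (p 0)))).const_mul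
      (Catenoid.weight a f (p 0))).congr_deriv ?_)
    ring
  rw [d0, d1] at key
  have hne : f (p 0) ^ 2 / a ≠ 0 := by have := hf (p 0); positivity
  refine mul_left_cancel₀ hne (key.trans ?_)
  have hw : Catenoid.weight a f (p 0) * (a / 2) = 2 / (f (p 0) ^ 2 + 4) := by
    have := hf (p 0)
    rw [Catenoid.weight]; field_simp; norm_num
  rw [angularMode, ← hw]
  ring

theorem exists_le_mul_sq_sub_sq (hT : 0 < T) {u : ℝ → ℝ} (hu : ContDiff ℝ ∞ u) (h1 : u T = 0)
    (h2 : u (-T) = 0) : ∃ C, 0 ≤ C ∧ ∀ t, |t| < T → |u t| ≤ C * (T ^ 2 - t ^ 2) := by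
  have hc : Continuous (deriv u) := hu.continuous_deriv (by simp)
  obtain ⟨L, hL⟩ := isCompact_Icc.exists_bound_of_continuousOn (s := Icc (-T) T) hc.continuousOn
  have hL0 : 0 ≤ L := (norm_nonneg _).trans (hL 0 ⟨by linarith, hT.le⟩)
  have hlip : ∀ x ∈ Icc (-T) T, ∀ y ∈ Icc (-T) T, |u y - u x| ≤ L * |y - x| := fun x hx y hy =>
    (convex_Icc _ _).norm_image_sub_le_of_norm_deriv_le (fun t _ => hu.differentiable (by simp) t)
      hL hx hy
  refine ⟨L / T, by positivity, fun t ht => ?_⟩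
  have ht' := abs_lt.1 ht
  have hm : t ∈ Icc (-T) T := ⟨ht'.1.le, ht'.2.le⟩
  rw [div_mul_eq_mul_div, le_div_iff₀ hT]
  rcases le_total 0 t with h0 | h0
  · have := hlip T ⟨by linarith, le_rfl⟩ t hm
    rw [h1, sub_zero, abs_sub_comm t T, abs_of_pos (by linarith : 0 < T - t)] at this
    have h3 : 0 ≤ L * (T - t) := mul_nonneg hL0 (by linarith)
    nlinarith
  · have := hlip (-T) ⟨le_rfl, by linarith⟩ t hm
    rw [h2, sub_zero, abs_of_pos (by linarith : 0 < t - -T)] at this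
    have h3 : 0 ≤ L * (T + t) := mul_nonneg hL0 (by linarith)
    nlinarith

theorem isDirichletEigen_angularMode (h : IsCatenoidProfile a f) (hT : 0 < T) {u U : ℝ → ℝ}
    (hu : ContDiff ℝ ∞ u) (hUs : ContDiff ℝ ∞ U) {k : ℕ} {lam : ℝ} (h1 : u T = 0) (h2 : u (-T) = 0)
    (hd : ∀ t, HasDerivAt u (Catenoid.weight a f t * U t) t)
    (hU : ∀ t, HasDerivAt U (-((Catenoid.weight a f t *
      (Catenoid.potential a f t - (k : ℝ) ^ 2) + lam * (f t ^ 2 / a)) * u t)) t) (c : ℝ) :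
    IsDirichletEigen (revolutionSurface f) (band f T) lam
      ((h.memLp_of_continuous (isOpen_preimage_band f T) (fun _ => mem_band.1)
        (h.contDiff_angularMode hu k c).continuous).toLp _) := by
  have hv := h.contDiff_angularMode hu k c
  have hvp := isPeriodic_angularMode f u k c
  have hΩ : ∀ p, revolutionSurface f p ∈ band f T → |p 0| < T := fun _ => mem_band.1
  have hm := h.memLp_of_continuous (isOpen_preimage_band f T) hΩ hv.continuous
  obtain ⟨C, hC0, hC⟩ := exists_le_mul_sq_sub_sq hT hu h1 h2
  refine ⟨h.isH10_band hT hv hvp hC0 fun p hp => ?_, fun φ hφ => ?_⟩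
  · rw [angularMode, abs_mul]
    calc _ ≤ |u (p 0)| * 1 := by gcongr; exact Real.abs_cos_le_one _
      _ ≤ _ := by rw [mul_one]; exact hC _ hp
  · have hcoe : ∀ g : (Fin 2 → ℝ) → ℝ,
        ∫ p, hm.toLp _ p * g p ∂(domainMeasure (revolutionSurface f) (band f T)) =
        ∫ p, angularMode f u k c p * g p ∂(domainMeasure (revolutionSurface f) (band f T)) :=
      fun g => integral_congr_ae (by
        filter_upwards [hm.coeFn_toLp] with p hp
        rw [hp])
    have hφ0 : ∀ p : Fin 2 → ℝ, ¬|p 0| < T → φ p = 0 := fun p hp =>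
      image_eq_zero_of_notMem_tsupport fun hmem => hp (hΩ p (hφ.support hmem))
    rw [hcoe, hcoe, h.integral_mul_jacobiOp_domain hT.le hΩ hφ hv hvp, Catenoid.bilin_comm,
      ← h.integral_mul_jacobiOp hT.le hv hφ.smooth hvp hφ.isPeriodic
        fun p hp => Or.inl (hφ0 p (by rw [hp]; exact lt_irrefl T)),
      h.integral_domainMeasure hΩ fun p _ hp => by rw [hφ0 p fun hlt => hp (mem_band.2 hlt), mul_zero],
      ← integral_const_mul]
    simp only [h.jacobiOp_angularMode hu hUs hd hU]
    congr 1
    funext p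
    ring

theorem inner_angularMode (h : IsCatenoidProfile a f) (hT : 0 < T) {u v : ℝ → ℝ}
    (hu : ContDiff ℝ ∞ u) (hv : ContDiff ℝ ∞ v) (h1 : u T = 0) (k l : ℕ) (c d : ℝ) :
    inner ℝ ((h.memLp_of_continuous (isOpen_preimage_band f T) (fun _ => mem_band.1)
        (h.contDiff_angularMode hu k c).continuous).toLp _)
      ((h.memLp_of_continuous (isOpen_preimage_band f T) (fun _ => mem_band.1)
        (h.contDiff_angularMode hv l d).continuous).toLp _) =
      ∫ t in (-T)..T, f t ^ 2 / a * (u t * v t) * ∫ θ in (0 : ℝ)..(2 * Real.pi),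
        Real.cos (k * θ - (k * phase f t + c)) * Real.cos (l * θ - (l * phase f t + d)) := by
  rw [← integral_mul_eq_inner, h.integral_domainMeasure (fun _ => mem_band.1),
    setIntegral_strip hT.le]
  · refine intervalIntegral.integral_congr fun t _ => ?_
    rw [← intervalIntegral.integral_const_mul]
    refine intervalIntegral.integral_congr fun θ _ => ?_
    simp only [angularMode, Matrix.cons_val_zero, Matrix.cons_val_one]
    rw [show k * (θ - phase f t) - c = k * θ - (k * phase f t + c) by ring,
      show l * (θ - phase f t) - d = l * θ - (l * phase f t + d) by ring]
    ring
  · exact h.continuous_area.mul ((h.contDiff_angularMode hu k c).continuous.mul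
      (h.contDiff_angularMode hv l d).continuous)
  · intro p hp hpb
    have hpT : p 0 = T := by
      refine le_antisymm hp.1.2 (not_lt.1 fun hlt => hpb (mem_band.2 (abs_lt.2 ⟨hp.1.1, hlt⟩)))
    simp [angularMode, hpT, h1]


/-- The order and the phase shift of the modes `1, cos kϑ, sin kϑ`, `1 ≤ k ≤ K`. -/
def _root_.modeIndex (K : ℕ) : Fin (K + 1) ⊕ Fin K → ℕ × ℝ :=
  Sum.elim (fun i => (i, 0)) (fun i => (i + 1, Real.pi / 2))

theorem _root_.modeIndex_fst_le {K : ℕ} (s : Fin (K + 1) ⊕ Fin K) : (modeIndex K s).1 ≤ K := by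
  rcases s with i | i <;> simp only [modeIndex, Sum.elim_inl, Sum.elim_inr] <;> omega

/-- If a comparison function exists for the modes of order at most `K`, each of these modes
contributes a negative eigenvalue on a large band. -/
theorem le_morseIndex (h : IsCatenoidProfile a f) {K : ℕ}
    (hK : K = 1 ∨ (K : ℝ) ^ 2 < 3 * a ^ 2 / 4 - 1) :
    ((2 * K + 1 : ℕ) : ℕ∞) ≤ morseIndex (revolutionSurface f) := by
  have ha := h.a_pos
  have hfc := h.contDiff.continuous
  obtain ⟨r, z, Z, hz, hZ, hr, hz0, hZ0, s₀, hs₀, hzs⟩ := h.exists_comparison hK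
  have hweight : ∀ t, Catenoid.weight a f (-t) = Catenoid.weight a f t := fun t => by
    simp only [Catenoid.weight, h.apply_neg]
  have hpot : ∀ t, Catenoid.potential a f (-t) = Catenoid.potential a f t := fun t => by
    simp only [Catenoid.potential, h.apply_neg]
  set T := s₀ + 1 with hTdef
  have hT : 0 < T := by positivity
  have hex : ∀ k : ℕ, k ≤ K → _ := fun k hk =>
    exists_neg_eigenvalue (A := Catenoid.weight a f) (w := fun t => f t ^ 2 / a)
      (q := fun t => Catenoid.weight a f t * (Catenoid.potential a f t - (k : ℝ) ^ 2))
      h.contDiff_weight (h.contDiff_weight.mul (h.contDiff_potential.sub contDiff_const))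
      ((h.contDiff.pow 2).div_const a) h.weight_pos
      (fun t => div_pos (pow_pos (h.pos t) 2) ha) hweight
      (fun t => by simp only [hweight, hpot]) (fun t => by simp only [h.apply_neg]) hz hZ
      (fun t => (hr t).trans (mul_le_mul_of_nonneg_left (by gcongr) (h.weight_pos t).le))
      hz0 hZ0 hs₀ hzs (lt_add_one s₀)
  choose! lam hlam u U hu hU hu0 huT huT' hd hd' using hex
  have hle : ∀ s, (modeIndex K s).1 ≤ K := modeIndex_fst_le
  set e : Fin (K + 1) ⊕ Fin K → Lp ℝ 2 (domainMeasure (revolutionSurface f) (band f T)) :=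
    fun s => (h.memLp_of_continuous (isOpen_preimage_band f T) (fun _ => mem_band.1)
      (h.contDiff_angularMode (hu _ (hle s)) (modeIndex K s).1 (modeIndex K s).2).continuous).toLp _
    with he
  have hmem : ∀ s, e s ∈ {v : Lp ℝ 2 (domainMeasure (revolutionSurface f) (band f T)) |
      ∃ lam < 0, IsDirichletEigen (revolutionSurface f) (band f T) lam v} := fun s =>
    ⟨lam (modeIndex K s).1, hlam _ (hle s), h.isDirichletEigen_angularMode hT (hu _ (hle s))
      (hU _ (hle s)) (huT _ (hle s)) (huT' _ (hle s)) (hd _ (hle s)) (hd' _ (hle s)) _⟩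
  have hpos : ∀ k ≤ K, 0 < ∫ t in (-T)..T, f t ^ 2 / a * (u k t * u k t) := fun k hk => by
    have hc := (hu k hk).continuous
    refine intervalIntegral.integral_pos (by linarith) (Continuous.continuousOn (by fun_prop))
      (fun t _ => ?_) ⟨0, ⟨by linarith, hT.le⟩, ?_⟩
    · exact mul_nonneg (by positivity) (mul_self_nonneg _)
    · have := h.pos 0
      rw [hu0 k hk]
      positivity
  have hne : ∀ s, e s ≠ 0 := fun s hs => by
    have h1 : inner ℝ (e s) (e s) = 0 := by rw [hs, inner_zero_left]
    rw [he, h.inner_angularMode hT (hu _ (hle s)) (hu _ (hle s)) (huT _ (hle s))] at h1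
    have hp := hpos _ (hle s)
    obtain ⟨c, hc, hcθ⟩ : ∃ c : ℝ, 0 < c ∧ ∀ t : ℝ, ∫ θ in (0 : ℝ)..(2 * Real.pi),
        Real.cos ((modeIndex K s).1 * θ - ((modeIndex K s).1 * phase f t + (modeIndex K s).2)) *
        Real.cos ((modeIndex K s).1 * θ - ((modeIndex K s).1 * phase f t + (modeIndex K s).2)) =
        c := by
      rcases Nat.eq_zero_or_pos (modeIndex K s).1 with h0 | h0
      · refine ⟨2 * Real.pi, Real.two_pi_pos, fun t => ?_⟩
        have h2 : (modeIndex K s).2 = 0 := by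
          rcases s with i | i
          · rfl
          · simp [modeIndex] at h0
        simp [h0, h2]
      · refine ⟨Real.pi, Real.pi_pos, fun t => ?_⟩
        rw [integral_cos_mul_cos_self h0]
        simp
    simp only [hcθ, intervalIntegral.integral_mul_const] at h1
    exact (mul_pos hp hc).ne' h1
  have horth : Pairwise fun s s' => inner ℝ (e s) (e s') = 0 := fun s s' hss => by
    change inner ℝ (e s) (e s') = 0
    rw [he, h.inner_angularMode hT (hu _ (hle s)) (hu _ (hle s')) (huT _ (hle s))]
    have hz : ∀ t : ℝ, ∫ θ in (0 : ℝ)..(2 * Real.pi),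
        Real.cos ((modeIndex K s).1 * θ - ((modeIndex K s).1 * phase f t + (modeIndex K s).2)) *
        Real.cos ((modeIndex K s').1 * θ - ((modeIndex K s').1 * phase f t + (modeIndex K s').2)) =
        0 := fun t => by
      by_cases hk : (modeIndex K s).1 = (modeIndex K s').1
      · rcases s with i | i <;> rcases s' with j | j
        · exact absurd (by simpa [modeIndex, Fin.ext_iff] using hk)
            (fun hij : i = j => hss (by rw [hij]))
        · rw [hk, integral_cos_mul_cos_self (by simp [modeIndex])]
          simp [modeIndex]
        · rw [hk, integral_cos_mul_cos_self (by rw [← hk]; simp [modeIndex])]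
          simp [modeIndex]
        · exact absurd (by simpa [modeIndex, Fin.ext_iff] using hk)
            (fun hij : i = j => hss (by rw [hij]))
      · exact integral_cos_mul_cos_of_ne hk _ _
    simp [hz]
  have hLI : LinearIndependent ℝ e := linearIndependent_of_ne_zero_of_inner_eq_zero hne horth
  refine le_iSup₂_of_le (band f T) (isRegularDomain_band hfc hT) ?_
  rw [dirichletIndex, Cardinal.natCast_le_toENat]
  calc ((2 * K + 1 : ℕ) : Cardinal) = Cardinal.mk (range e) := by
        rw [Cardinal.mk_range_eq _ hLI.injective]
        simp
        ring
    _ = Module.rank ℝ (Submodule.span ℝ (range e)) := (rank_span hLI).symm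
    _ ≤ _ := Submodule.rank_mono (Submodule.span_mono (range_subset_iff.2 hmem))

end IsCatenoidProfile

end


theorem IsCatenoidProfile.three_le_morseIndex {a : ℝ} {f : ℝ → ℝ} (h : IsCatenoidProfile a f) :
    3 ≤ morseIndex (revolutionSurface f) :=
  h.le_morseIndex (K := 1) (Or.inl rfl)

/-- The largest `K` with `K² < 3a²/4 - 1` yields linear growth of the index with slope `√3`. -/
theorem IsCatenoidProfile.le_morseIndex_of_sq_lt {a c : ℝ} {f : ℝ → ℝ} (h : IsCatenoidProfile a f)
    (hc : c * a + 1 ≤ 2 * √(3 * a ^ 2 / 4 - 1)) (ha : 1 < 3 * a ^ 2 / 4) :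
    c * a ≤ ((morseIndex (revolutionSurface f)).toNat : ℝ) := by
  set R := √(3 * a ^ 2 / 4 - 1) with hR
  have hR0 : 0 < R := Real.sqrt_pos.2 (by linarith)
  have hceil : 0 < ⌈R⌉₊ := Nat.ceil_pos.2 hR0
  have hK : ((⌈R⌉₊ - 1 : ℕ) : ℝ) ^ 2 < 3 * a ^ 2 / 4 - 1 := by
    have h1 : ((⌈R⌉₊ - 1 : ℕ) : ℝ) < R := by
      rw [← Nat.lt_ceil]; omega
    calc ((⌈R⌉₊ - 1 : ℕ) : ℝ) ^ 2 < R ^ 2 := by gcongr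
      _ = _ := Real.sq_sqrt (by linarith)
  have h1 := h.le_morseIndex (Or.inr hK)
  have htop : morseIndex (revolutionSurface f) ≠ ⊤ :=
    (h.morseIndex_le.trans_lt (ENat.natCast_lt_top _)).ne
  have h2 : 2 * (⌈R⌉₊ - 1) + 1 ≤ (morseIndex (revolutionSurface f)).toNat := by
    rw [← ENat.natCast_toNat htop] at h1
    exact_mod_cast h1
  have h3 : 2 * (⌈R⌉₊ : ℝ) - 1 ≤ ((morseIndex (revolutionSurface f)).toNat : ℝ) := by
    have h4 : 2 * ⌈R⌉₊ ≤ (morseIndex (revolutionSurface f)).toNat + 1 := by omega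
    have h5 : 2 * (⌈R⌉₊ : ℝ) ≤ ((morseIndex (revolutionSurface f)).toNat : ℝ) + 1 := by
      exact_mod_cast h4
    linarith
  have h4 := Nat.le_ceil R
  linarith

theorem eventually_add_one_le_sqrt {c : ℝ} (hc : c < √3) :
    ∀ᶠ a : ℝ in atTop, c * a + 1 ≤ 2 * √(3 * a ^ 2 / 4 - 1) := by
  set d := √3 - c with hd
  have hd0 : 0 < d := sub_pos.2 hc
  have h3 : √3 ^ 2 = 3 := Real.sq_sqrt (by norm_num)
  filter_upwards [eventually_ge_atTop 2, eventually_ge_atTop (2 / d)] with a ha1 ha2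
  rw [div_le_iff₀ hd0] at ha2
  -- `2 √(3a²/4 - 1) ≥ √3 a - 1` for `a ≥ 2`, and `d a ≥ 2`.
  have hle : (√3 * a - 1) / 2 ≤ √(3 * a ^ 2 / 4 - 1) := by
    refine Real.le_sqrt_of_sq_le ?_
    have h1 : 1.5 ≤ √3 := Real.le_sqrt_of_sq_le (by norm_num)
    nlinarith
  nlinarith

theorem theorem2 :
    (∀ a : ℝ, 0 < a →
      morseIndex (catenoid a) ≠ ⊤ ∧
      3 ≤ morseIndex (catenoid a) ∧
      morseIndex (catenoid a) ≤ ((1 + 2 * ⌊√(a ^ 2 + 2)⌋₊ : ℕ) : ℕ∞)) ∧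
    (∀ᶠ a : ℝ in 𝓝[>] 0, morseIndex (catenoid a) = 3) ∧
    (∀ c : ℝ, c < √3 → ∀ᶠ a : ℝ in atTop, c * a ≤ ((morseIndex (catenoid a)).toNat : ℝ)) ∧
    Tendsto (fun a : ℝ => (morseIndex (catenoid a)).toNat) atTop atTop := by
  have hle : ∀ a : ℝ, 0 < a →
      morseIndex (catenoid a) ≤ ((1 + 2 * ⌊√(a ^ 2 + 2)⌋₊ : ℕ) : ℕ∞) := fun a ha =>
    (isCatenoidProfile_catenoidProfile ha).morseIndex_le
  have hge : ∀ a : ℝ, 0 < a → 3 ≤ morseIndex (catenoid a) := fun a ha =>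
    (isCatenoidProfile_catenoidProfile ha).three_le_morseIndex
  have hgrow : ∀ c : ℝ, c < √3 →
      ∀ᶠ a : ℝ in atTop, c * a ≤ ((morseIndex (catenoid a)).toNat : ℝ) := fun c hc => by
    filter_upwards [eventually_add_one_le_sqrt hc, eventually_ge_atTop 2] with a h1 h2
    exact (isCatenoidProfile_catenoidProfile (by linarith)).le_morseIndex_of_sq_lt h1 (by nlinarith)
  refine ⟨fun a ha => ⟨((hle a ha).trans_lt (ENat.natCast_lt_top _)).ne, hge a ha, hle a ha⟩, ?_,
    hgrow, ?_⟩
  · filter_upwards [Ioo_mem_nhdsGT (zero_lt_one (α := ℝ))] with a ha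
    refine le_antisymm ((hle a ha.1).trans ?_) (hge a ha.1)
    have h1 : ⌊√(a ^ 2 + 2)⌋₊ < 2 := by
      rw [Nat.floor_lt (by positivity), Real.sqrt_lt' (by norm_num)]
      have := ha.1
      have := ha.2
      push_cast
      nlinarith
    have h2 : 1 + 2 * ⌊√(a ^ 2 + 2)⌋₊ ≤ 3 := by omega
    exact_mod_cast h2
  · refine tendsto_natCast_atTop_iff.1 (tendsto_atTop_mono' _ ?_ tendsto_id)
    have h1 : (1 : ℝ) < √3 := Real.lt_sqrt_of_sq_lt (by norm_num)
    filter_upwards [hgrow 1 h1] with a ha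
    simpa using ha
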